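/- Let $0\le \ell\le n$, $L=\{1,\dots,\ell\}$, $t=(t_1,\dots,t_n)$ and let $\mathcal O_{X,0}=\mathbb C\{t\}$ be the ring of convergent power series. For $I\subset L$ let $D_I=\{t_i=0\ \forall i\in I\}$, $I^c=L\setminus I$, $D(J)=\bigcup_{j\in J}\{t_j=0\}$ for $J\subset L$, and $D=D(L)$. Let $\mathcal O_{\widehat D_I,0}$ be the ring of series $\sum_{\nu\in\mathbb N^I}f_\nu t_I^\nu$ whose coefficients $f_\nu$ are power series in the variables $t_j$, $j\notin I$, all convergent in a common neighbourhood of $0$ independent of $\nu$, and let $\mathcal O_{\widehat 0}=\mathbb C[[t]]$. For each such ring $\mathcal O$ write $\mathcal O(*D(J))=\mathcal O[1/\prod_{j\in J}t_j]$. A finite subset $\Phi$ of $\mathcal O(*D)/\mathcal O(*D(J))$ is called good if for all $\varphi\ne\psi$ in $\Phi$ the difference $\varphi-\psi$ is the class of $t^{-m}u$ for some $u\in\mathcal O$ with $u(0)\neq0$ and some $m\in\mathbb N^L$ with $m_i\neq0$ for at least one $i\in L\setminus J$. Let $(E,\nabla)$ be a free $\mathcal O_{X,0}$-module of finite rank with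 a flat meromorphic connection $\nabla:E\to\Omega^1_{X,0}(*D)\otimes E$. For $\mathcal O$ as above and a finite set $\Phi\subset\mathcal O(*D)/\mathcal O(*D(J))$, say that $\mathcal O\otimes E$ has a $\Phi$-decomposition if $$\mathcal O\otimes_{\mathcal O_{X,0}}(E,\nabla)\simeq\bigoplus_{\varphi\in\Phi}\big((\mathcal O,d+d\varphi)\otimes(R_\varphi,\nabla)\big),$$ where $d\varphi$ is computed with a lifting of $\varphi$ to $\mathcal O(*D)$ (the choice does not matter), and each $R_\varphi$ is a nonzero free $\mathcal O$-module of finite rank with a flat meromorphic connection such that $\nabla R_\varphi\subset R_\varphi\otimes\mathcal O(*D(J))\cdot\Omega^1(\log D)$. **Theorem (Mochizuki).** Assume that $(E,\nabla)$ is a good lattice with formal exponential factors $\widehat\Phi$, that is, $\widehat\Phi\subset\mathcal O_{\widehat0}(*D)/\mathcal O_{\widehat0}$ is a good finite set and $\mathcal O_{\widehat0}\otimes E$ has a $\widehat\Phi$-decomposition (with $J=\emptyset$). Then: 1. $\widehat\Phi\subset\mathcal O_{X,0}(*D)/\mathcal O_{X,0}$, i.e. $\widehat\Phi$ is the image of a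 finite set $\Phi\subset\mathcal O_{X,0}(*D)/\mathcal O_{X,0}$, and $\Phi$ is good. 2. $(E,\nabla)$ has a good formal $\Phi$-decomposition: for every $I\subset L$ (including $I=\emptyset$ and $I=L$), the image $\Phi_I$ of $\Phi$ in $\mathcal O_{X,0}(*D)/\mathcal O_{X,0}(*D(I^c))$ is good, and $\mathcal O_{\widehat D_I,0}\otimes E$ has a $\Phi_I$-decomposition (with $J=I^c$). -/

import Mathlib

open scoped TensorProduct

noncomputable section

namespace GoodLattice

/-! ### Rings of convergent, partially formal and formal power series -/

/-- The weight `‖f_d‖ r^|d|` of the coefficient of `t^d` in `f` if every exponent `d i`, `i ∈ S`,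
is at most `N`, and `0` otherwise. -/
def weight {n : ℕ} (S : Set (Fin n)) (r : ℝ) (N : ℕ) (f : MvPowerSeries (Fin n) ℂ)
    (d : Fin n →₀ ℕ) : ℝ :=
  Set.indicator {d : Fin n →₀ ℕ | ∀ i ∈ S, d i ≤ N}
    (fun d => ‖MvPowerSeries.coeff d f‖ * r ^ d.degree) d

/-- `f` is formal in the variables `t_i`, `i ∈ S`, and convergent in the other ones: there is a
radius `r > 0` such that every coefficient `f_ν` of the expansion `f = ∑ f_ν t_S^ν`, which is a
power series in the variables outside `S`, converges absolutely at radius `r` (the radius does not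
depend on `ν`). This is expressed on the finitely many `ν` with all entries at most `N`, for
each `N`. -/
def IsGermAlong {n : ℕ} (S : Set (Fin n)) (f : MvPowerSeries (Fin n) ℂ) : Prop :=
  ∃ r : ℝ, 0 < r ∧ ∀ N : ℕ, Summable (weight S r N f)

lemma weight_nonneg {n : ℕ} {S : Set (Fin n)} {r : ℝ} (hr : 0 ≤ r) (N : ℕ)
    (f : MvPowerSeries (Fin n) ℂ) (d : Fin n →₀ ℕ) : 0 ≤ weight S r N f d :=
  Set.indicator_nonneg (fun _ _ => by positivity) _

lemma weight_mono {n : ℕ} {S S' : Set (Fin n)} (h : S ⊆ S') {r r' : ℝ} (hr : 0 ≤ r)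
    (hrr : r ≤ r') (N : ℕ) (f : MvPowerSeries (Fin n) ℂ) (d : Fin n →₀ ℕ) :
    weight S' r N f d ≤ weight S r' N f d := by
  unfold weight
  by_cases hd : ∀ i ∈ S', d i ≤ N
  · rw [Set.indicator_of_mem (show d ∈ {d : Fin n →₀ ℕ | ∀ i ∈ S', d i ≤ N} from hd),
      Set.indicator_of_mem (show d ∈ {d : Fin n →₀ ℕ | ∀ i ∈ S, d i ≤ N} from
        fun i hi => hd i (h hi))]
    gcongr
  · rw [Set.indicator_of_notMem (show d ∉ {d : Fin n →₀ ℕ | ∀ i ∈ S', d i ≤ N} from hd)]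
    exact weight_nonneg (hr.trans hrr) N f d

lemma IsGermAlong.mono {n : ℕ} {S S' : Set (Fin n)} (h : S ⊆ S')
    {f : MvPowerSeries (Fin n) ℂ} (hf : IsGermAlong S f) : IsGermAlong S' f := by
  obtain ⟨r, hr, hs⟩ := hf
  exact ⟨r, hr, fun N => (hs N).of_nonneg_of_le (weight_nonneg hr.le N f)
    (weight_mono h hr.le le_rfl N f)⟩

lemma weight_add_le {n : ℕ} (S : Set (Fin n)) {r : ℝ} (hr : 0 ≤ r) (N : ℕ)
    (f g : MvPowerSeries (Fin n) ℂ) (d : Fin n →₀ ℕ) :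
    weight S r N (f + g) d ≤ weight S r N f d + weight S r N g d := by
  unfold weight
  by_cases hd : d ∈ {d : Fin n →₀ ℕ | ∀ i ∈ S, d i ≤ N}
  · simp only [Set.indicator_of_mem hd, map_add]
    rw [← add_mul]
    gcongr
    exact norm_add_le _ _
  · simp only [Set.indicator_of_notMem hd, add_zero, le_refl]

lemma weight_mul_le {n : ℕ} (S : Set (Fin n)) {r : ℝ} (hr : 0 ≤ r) (N : ℕ)
    (f g : MvPowerSeries (Fin n) ℂ) (d : Fin n →₀ ℕ) :
    weight S r N (f * g) d ≤
      ∑ p ∈ Finset.HasAntidiagonal.antidiagonal d, weight S r N f p.1 * weight S r N g p.2 := by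
  by_cases hd : d ∈ {d : Fin n →₀ ℕ | ∀ i ∈ S, d i ≤ N}
  · have key : ∀ p ∈ Finset.HasAntidiagonal.antidiagonal d, weight S r N f p.1 * weight S r N g p.2 =
        ‖MvPowerSeries.coeff p.1 f * MvPowerSeries.coeff p.2 g‖ * r ^ d.degree := by
      intro p hp
      rw [Finset.HasAntidiagonal.mem_antidiagonal] at hp
      have h1 : p.1 ∈ {d : Fin n →₀ ℕ | ∀ i ∈ S, d i ≤ N} := fun i hi => by
        have := hd i hi
        rw [← hp, Finsupp.add_apply] at this
        omega
      have h2 : p.2 ∈ {d : Fin n →₀ ℕ | ∀ i ∈ S, d i ≤ N} := fun i hi => by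
        have := hd i hi
        rw [← hp, Finsupp.add_apply] at this
        omega
      unfold weight
      rw [Set.indicator_of_mem h1, Set.indicator_of_mem h2, norm_mul, ← hp, map_add, pow_add]
      ring
    rw [Finset.sum_congr rfl key, ← Finset.sum_mul]
    unfold weight
    rw [Set.indicator_of_mem hd, MvPowerSeries.coeff_mul]
    gcongr
    exact norm_sum_le _ _
  · have : weight S r N (f * g) d = 0 := Set.indicator_of_notMem hd _
    rw [this]
    exact Finset.sum_nonneg fun p _ =>
      mul_nonneg (weight_nonneg hr N f p.1) (weight_nonneg hr N g p.2)

lemma IsGermAlong.add {n : ℕ} {S : Set (Fin n)} {f g : MvPowerSeries (Fin n) ℂ}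
    (hf : IsGermAlong S f) (hg : IsGermAlong S g) : IsGermAlong S (f + g) := by
  obtain ⟨r, hr, hf⟩ := hf
  obtain ⟨s, hs, hg⟩ := hg
  have hm : 0 < min r s := lt_min hr hs
  refine ⟨min r s, hm, fun N => ?_⟩
  refine ((hf N).add (hg N)).of_nonneg_of_le (weight_nonneg hm.le N _) fun d => ?_
  exact (weight_add_le S hm.le N f g d).trans (add_le_add
    (weight_mono subset_rfl hm.le (min_le_left _ _) N f d)
    (weight_mono subset_rfl hm.le (min_le_right _ _) N g d))

lemma IsGermAlong.mul {n : ℕ} {S : Set (Fin n)} {f g : MvPowerSeries (Fin n) ℂ}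
    (hf : IsGermAlong S f) (hg : IsGermAlong S g) : IsGermAlong S (f * g) := by
  obtain ⟨r, hr, hf⟩ := hf
  obtain ⟨s, hs, hg⟩ := hg
  have hm : 0 < min r s := lt_min hr hs
  refine ⟨min r s, hm, fun N => ?_⟩
  have h1 : Summable (weight S (min r s) N f) := (hf N).of_nonneg_of_le
    (weight_nonneg hm.le N f) (weight_mono subset_rfl hm.le (min_le_left _ _) N f)
  have h2 : Summable (weight S (min r s) N g) := (hg N).of_nonneg_of_le
    (weight_nonneg hm.le N g) (weight_mono subset_rfl hm.le (min_le_right _ _) N g)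
  have h3 := summable_sum_mul_antidiagonal_of_summable_mul
    (h1.mul_of_nonneg h2 (weight_nonneg hm.le N f) (weight_nonneg hm.le N g))
  exact h3.of_nonneg_of_le (weight_nonneg hm.le N _) (weight_mul_le S hm.le N f g)

lemma isGermAlong_algebraMap {n : ℕ} (S : Set (Fin n)) (c : ℂ) :
    IsGermAlong S (algebraMap ℂ (MvPowerSeries (Fin n) ℂ) c) := by
  classical
  refine ⟨1, one_pos, fun N => summable_of_ne_finset_zero (s := {0}) fun d hd => ?_⟩
  have hd' : d ≠ 0 := by simpa using hd
  simp [weight, Set.indicator_apply, MvPowerSeries.algebraMap_apply, MvPowerSeries.coeff_C, hd']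

/-- The ring of power series in `t_1, …, t_n` that are formal in the variables `t_i`, `i ∈ S`, and
convergent in the other ones. For `S = ∅` it is `𝒪_{X,0} = ℂ{t_1, …, t_n}`, for `S = I` it is the
stalk at `0` of the structure sheaf of the formal completion of `X` along
`D_I = ⋂_{i ∈ I} {t_i = 0}`, and for `S = univ` it is `ℂ⟦t_1, …, t_n⟧`. -/
def germs {n : ℕ} (S : Set (Fin n)) : Subalgebra ℂ (MvPowerSeries (Fin n) ℂ) where
  carrier := {f | IsGermAlong S f}
  mul_mem' := IsGermAlong.mul
  add_mem' := IsGermAlong.add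
  algebraMap_mem' := isGermAlong_algebraMap S

/-! ### Poles along the divisor -/

/-- The equation `∏_{i ∈ J} t_i` of the divisor `D(J) = ⋃_{i ∈ J} {t_i = 0}`. -/
def divEq {n : ℕ} (J : Finset (Fin n)) : MvPowerSeries (Fin n) ℂ :=
  ∏ i ∈ J, MvPowerSeries.X i

lemma divEq_mem {n : ℕ} (S : Set (Fin n)) (J : Finset (Fin n)) : divEq J ∈ germs S := by
  classical
  refine prod_mem fun i _ => ⟨1, one_pos, fun N => summable_of_ne_finset_zero
    (s := {Finsupp.single i 1}) fun d hd => ?_⟩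
  have hd' : d ≠ Finsupp.single i 1 := by simpa using hd
  simp [weight, Set.indicator_apply, MvPowerSeries.coeff_X, hd']

/-- The ring `ℂ⟦t_1, …, t_n⟧(*D)`, where `D = D(L) = ⋃_{i ∈ L} {t_i = 0}`. All the rings
below are subrings of it. -/
abbrev FormalMero {n : ℕ} (L : Finset (Fin n)) : Type :=
  Localization.Away (divEq L)

/-- The ring `germs S (*D(J))`, for `J ⊆ L`. -/
def mero {n : ℕ} (L : Finset (Fin n)) (S : Set (Fin n)) (J : Finset (Fin n)) :
    Subalgebra ℂ (FormalMero L) where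
  carrier := {f | ∃ N : ℕ, ∃ g ∈ germs S,
    algebraMap _ (FormalMero L) (divEq J) ^ N * f = algebraMap _ (FormalMero L) g}
  mul_mem' := by
    rintro a b ⟨N, g, hg, ha⟩ ⟨M, h, hh, hb⟩
    refine ⟨N + M, g * h, mul_mem hg hh, ?_⟩
    rw [map_mul, ← ha, ← hb]
    ring
  add_mem' := by
    rintro a b ⟨N, g, hg, ha⟩ ⟨M, h, hh, hb⟩
    have hX := divEq_mem S J
    refine ⟨N + M, divEq J ^ M * g + divEq J ^ N * h,
      add_mem (mul_mem (pow_mem hX _) hg) (mul_mem (pow_mem hX _) hh), ?_⟩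
    rw [map_add, map_mul, map_mul, ← ha, ← hb, map_pow, map_pow]
    ring
  algebraMap_mem' := fun c => ⟨0, algebraMap ℂ _ c, (germs S).algebraMap_mem c, by
    rw [pow_zero, one_mul, ← IsScalarTower.algebraMap_apply]⟩

/-- The partial derivative `∂/∂t_i` on `ℂ⟦t_1, …, t_n⟧(*D)`: the unique derivation that extends
the one of `ℂ⟦t_1, …, t_n⟧` (obtained from the module of Kähler differentials of a
localization). -/
def pd {n : ℕ} (L : Finset (Fin n)) (i : Fin n) :
    Derivation ℂ (FormalMero L) (FormalMero L) :=
  haveI : Algebra.FormallyEtale (MvPowerSeries (Fin n) ℂ) (FormalMero L) :=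
    Algebra.FormallyEtale.of_isLocalization (Submonoid.powers (divEq L))
  (((((Algebra.linearMap (MvPowerSeries (Fin n) ℂ) (FormalMero L)).compDer
      (MvPowerSeries.pderiv ℂ i)).liftKaehlerDifferential).liftBaseChange (FormalMero L)).comp
    (KaehlerDifferential.tensorKaehlerEquivOfFormallyEtale ℂ (MvPowerSeries (Fin n) ℂ)
      (FormalMero L)).symm.toLinearMap).compDer (KaehlerDifferential.D ℂ (FormalMero L))

lemma pd_algebraMap {n : ℕ} (L : Finset (Fin n)) (i : Fin n) (f : MvPowerSeries (Fin n) ℂ) :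
    pd L i (algebraMap _ (FormalMero L) f) =
      algebraMap _ (FormalMero L) (MvPowerSeries.pderiv ℂ i f) := by
  have : Algebra.FormallyEtale (MvPowerSeries (Fin n) ℂ) (FormalMero L) :=
    Algebra.FormallyEtale.of_isLocalization (Submonoid.powers (divEq L))
  simp [pd, KaehlerDifferential.tensorKaehlerEquivOfFormallyEtale_symm_D_algebraMap]

/-! ### Polar parts and goodness -/

/-- The group `germs S (*D) / germs S (*D(J))`, where `J ⊆ L`. -/
abbrev Polar {n : ℕ} (L : Finset (Fin n)) (S : Set (Fin n)) (J : Finset (Fin n)) : Type :=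
  (mero L S L).toSubmodule ⧸
    ((mero L S J).toSubmodule).submoduleOf ((mero L S L).toSubmodule)

/-- The class in `germs S (*D) / germs S (*D(J))` of an element of `germs S (*D)`. -/
def polarMk {n : ℕ} (L : Finset (Fin n)) (S : Set (Fin n)) (J : Finset (Fin n)) :
    (mero L S L).toSubmodule →ₗ[ℂ] Polar L S J :=
  Submodule.mkQ _

lemma mero_mono {n : ℕ} (L : Finset (Fin n)) {S S' : Set (Fin n)} {J J' : Finset (Fin n)}
    (hS : S ⊆ S') (hJ : J ⊆ J') : mero L S J ≤ mero L S' J' := by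
  rintro f ⟨N, g, hg, h⟩
  refine ⟨N, divEq (J' \ J) ^ N * g,
    mul_mem (pow_mem (divEq_mem S' _) N) (IsGermAlong.mono hS hg), ?_⟩
  have : divEq J' = divEq (J' \ J) * divEq J := (Finset.prod_sdiff hJ).symm
  rw [this, map_mul, map_mul, map_pow, mul_pow, mul_assoc, h]

/-- The natural map `germs S (*D) / germs S (*D(J)) → germs S' (*D) / germs S' (*D(J'))` for
`S ⊆ S'` and `J ⊆ J'`. -/
def polarMap {n : ℕ} (L : Finset (Fin n)) {S S' : Set (Fin n)} {J J' : Finset (Fin n)}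
    (hS : S ⊆ S') (hJ : J ⊆ J') : Polar L S J →ₗ[ℂ] Polar L S' J' :=
  Submodule.mapQ _ _
    (Submodule.inclusion (Subalgebra.toSubmodule.monotone (mero_mono L hS (subset_refl L))))
    (fun _ hx => mero_mono L hS hJ hx)

/-- `η ∈ germs S (*D) / germs S (*D(J))` is nonzero and purely monomial (along the components of
`D` that are not in `D(J)`): it is the class of `t^{-m} u`, where `m ∈ ℕ^L` has a nonzero component
outside `J`, and `u ∈ germs S` satisfies `u(0) ≠ 0`. -/
def IsPurelyMonomial {n : ℕ} {L : Finset (Fin n)} {S : Set (Fin n)} {J : Finset (Fin n)}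
    (η : Polar L S J) : Prop :=
  ∃ m : Fin n →₀ ℕ, m.support ⊆ L ∧ (∃ i ∈ L \ J, m i ≠ 0) ∧
    ∃ u ∈ germs S, MvPowerSeries.constantCoeff u ≠ 0 ∧
      ∃ f : (mero L S L).toSubmodule, polarMk L S J f = η ∧
        algebraMap _ (FormalMero L) (MvPowerSeries.monomial m (1 : ℂ)) * (f : FormalMero L) =
          algebraMap _ (FormalMero L) u

/-- A finite set of polar parts is good if the difference of any two distinct elements is purely
monomial. -/
def IsGood {n : ℕ} {L : Finset (Fin n)} {S : Set (Fin n)} {J : Finset (Fin n)}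
    (Φ : Set (Polar L S J)) : Prop :=
  Φ.Finite ∧ ∀ φ ∈ Φ, ∀ ψ ∈ Φ, φ ≠ ψ → IsPurelyMonomial (φ - ψ)

/-! ### Meromorphic connections and their decompositions -/

/-- The ring `𝒪_{X,0}` of convergent power series. -/
abbrev Conv (n : ℕ) : Subalgebra ℂ (MvPowerSeries (Fin n) ℂ) := germs ∅

/-- The formalization `ℂ⟦t⟧(*D) ⊗ E` of an `𝒪_{X,0}`-module `E`. -/
abbrev FormalModule {n : ℕ} (L : Finset (Fin n)) (E : Type*) [AddCommGroup E]
    [Module (Conv n) E] : Type _ :=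
  FormalMero L ⊗[Conv n] E

/-- The `germs S`-lattice `germs S ⊗ E` generated by `E` in `ℂ⟦t⟧(*D) ⊗ E`. For `S = I ⊆ L` it is
the restriction of `E` to the formal completion along `D_I`, for `S = univ` it is the formal
completion at the origin. -/
def lattice {n : ℕ} (L : Finset (Fin n)) (S : Set (Fin n)) (E : Type*) [AddCommGroup E]
    [Module (Conv n) E] : Submodule (germs S) (FormalModule L E) :=
  Submodule.span (germs S) (Set.range fun e : E => (1 : FormalMero L) ⊗ₜ[Conv n] e)

/-- A meromorphic connection `∇ : E → Ω¹(*D) ⊗ E` on an `𝒪_{X,0}`-module `E`, written as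
`∇ = ∑ dt_i ⊗ ∇_i` with `∇_i : E → E(*D)`. Here `E(*D)` is the `𝒪_{X,0}(*D)`-submodule of
`ℂ⟦t⟧(*D) ⊗ E` generated by `E`. -/
structure MeroConnection {n : ℕ} (L : Finset (Fin n)) (E : Type*) [AddCommGroup E]
    [Module (Conv n) E] where
  /-- the components `∇_i` -/
  nabla : Fin n → E →+ FormalModule L E
  nabla_mem : ∀ i e, nabla i e ∈ Submodule.span (mero L ∅ L)
    (Set.range fun e : E => (1 : FormalMero L) ⊗ₜ[Conv n] e)
  leibniz : ∀ i (f : Conv n) (e : E), nabla i (f • e) =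
    pd L i (algebraMap (Conv n) (FormalMero L) f) ⊗ₜ[Conv n] e + f • nabla i e

namespace MeroConnection

variable {n : ℕ} {L : Finset (Fin n)} {E : Type*} [AddCommGroup E] [Module (Conv n) E]

/-- The extension of `∇_i` to `ℂ⟦t⟧(*D) ⊗ E`, given by
`∇_i (g ⊗ e) = ∂g/∂t_i ⊗ e + g ∇_i e`. -/
def ext (C : MeroConnection L E) (i : Fin n) : FormalModule L E →+ FormalModule L E :=
  TensorProduct.liftAddHom
    (AddMonoidHom.mk' (fun g : FormalMero L =>
      AddMonoidHom.mk' (fun e : E => pd L i g ⊗ₜ[Conv n] e + g • C.nabla i e)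
        (fun a b => by
          rw [map_add, smul_add, TensorProduct.tmul_add]; abel))
      (fun g h => by
        ext e
        simp only [AddMonoidHom.mk'_apply, AddMonoidHom.add_apply, map_add, add_smul,
          TensorProduct.add_tmul]
        abel))
    (fun f g e => by
      simp only [AddMonoidHom.mk'_apply]
      rw [C.leibniz, Algebra.smul_def, Derivation.leibniz, TensorProduct.tmul_smul, smul_add,
        TensorProduct.add_tmul, TensorProduct.smul_tmul', TensorProduct.smul_tmul',
        algebraMap_smul, ← Algebra.smul_def, smul_assoc, smul_comm f g]
      abel)

lemma ext_tmul (C : MeroConnection L E) (i : Fin n) (g : FormalMero L) (e : E) :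
    C.ext i (g ⊗ₜ[Conv n] e) = pd L i g ⊗ₜ[Conv n] e + g • C.nabla i e := rfl

/-- Flatness: the operators `∇_i` commute, i.e. the curvature `∇ ∘ ∇` is zero. -/
def IsFlat (C : MeroConnection L E) : Prop :=
  ∀ i j e, C.ext i (C.nabla j e) = C.ext j (C.nabla i e)

/-- The vector field `t_i ∂/∂t_i` (if `i ∈ L`) or `∂/∂t_i` (if `i ∉ L`) is `logCoord L i • ∂/∂t_i`;
these vector fields are dual to the basis `dt_i / t_i` (`i ∈ L`), `dt_i` (`i ∉ L`) of the
logarithmic forms `Ω¹(log D)`. -/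
def logCoord (L : Finset (Fin n)) (i : Fin n) : FormalMero L :=
  algebraMap _ (FormalMero L) (if i ∈ L then MvPowerSeries.X i else 1 : MvPowerSeries (Fin n) ℂ)

/-- Let `Φ ⊆ germs S (*D) / germs S (*D(J))`. The module `germs S ⊗ E` with its connection has a
`Φ`-decomposition if it is a direct sum `⨁_{φ ∈ Φ} N φ` of nonzero free submodules, such that
`N φ ≃ E^φ ⊗ R_φ` with `E^φ = (germs S, d + dφ)` and `R_φ` has only logarithmic poles, apart
from poles of arbitrary order along `D(J)`. In other words `R_φ` is `N φ` with the connection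
`∇ - dφ`, and this sends `N φ` into `germs S (*D(J)) Ω¹(log D) ⊗ N φ`, for any lifting of `φ`
(this does not depend on the lifting). -/
def HasDecomposition (C : MeroConnection L E) (S : Set (Fin n)) (J : Finset (Fin n))
    (Φ : Set (Polar L S J)) : Prop :=
  ∃ N : Φ → Submodule (germs S) (FormalModule L E),
    iSupIndep N ∧ (⨆ φ, N φ) = lattice L S E ∧
    ∀ φ : Φ, N φ ≠ ⊥ ∧ Module.Free (germs S) (N φ) ∧
      ∀ f : (mero L S L).toSubmodule, polarMk L S J f = φ →
        ∀ i, ∀ v ∈ N φ, logCoord L i • (C.ext i v - pd L i (f : FormalMero L) • v) ∈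
          Submodule.span (mero L S J) (N φ : Set (FormalModule L E))

end MeroConnection

end GoodLattice

end

open GoodLattice

/-! ### Truncated weighted norms of power series. -/

namespace GoodLattice

open Filter Topology

/-! In a basis of `E`, the formal decomposition becomes a complete system of orthogonal idempotent
matrices P_φ over ℂ⟦t⟧ that commute with the connection and on whose images ∇ - df_φ is logarithmic
(`FormalSplitting`). A single P_φ need not converge. The key fact is that, for i ∈ L, the sum of the
P_φ over all factors with the same polar part along t_i = 0 is formal in t_i only
(`FormalSplitting.mem_germs_polarClass`). The rest follows from this by traces and algebra.

The analytic core is `mem_germs_of_horizontal_idempotent`: an idempotent P with t^m t_i ∂_i P = [P,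
N], where N is formal in few variables, is formal in these variables only. Write P = p + Y with p =
P(0), and let q = N(0). Idempotency reads Y - pY - Yp = Y², and its left side inverts, up to sign,
the diagonal blocks with respect to p and kills the other two. The commutator of the differential
equation with p expresses [p, [q, Y]] by small terms, and this operator acts on the off-diagonal
blocks, invertibly if q has no common eigenvalue on the images of p and 1 - p. So the sum of both
operators is invertible on constant matrices and acts coefficientwise on Y. The right side consists
of products with a factor vanishing at the origin, hence its part of degree at most k + 1 is bounded
by the part of Y of degree at most k, and a quadratic recursion bounds all truncated norms. The
weights are r^|d| times σ to the power of the total exponent in the formal variables, cut off at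
exponent N in each of them. On the kept terms t_i ∂_i costs a factor N while t^m gains a factor σ,
so σ is chosen after N, and r stays independent of N.

To apply this, the factors are peeled off level by level (`FormalSplitting.mem_germs_of_level`). By
goodness the pole orders of the differences f_φ - f_φ₀ are totally ordered, and for the largest one
the factors with vanishing leading coefficient are split from the others. The matrix N has to be
convergent although f_φ₀ is not yet known to be; t_i ∂_i f_φ₀ is therefore replaced by tr(P_s t_i
A_i) / tr P_s, which involves only the projector already controlled.

The same quotient of traces, taken on a whole class, computes t_i ∂_i f_φ up to terms without pole
along t_i = 0. Integrating coefficientwise makes f_φ convergent modulo ℂ⟦t⟧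
(`exists_convergent_of_pd`), and the projectors are unchanged when the factors are replaced by
convergent lifts.

Finally, two factors have the same polar part along D_I exactly if they have the same one along
every t_i = 0, i ∈ I. So the class projectors for I are products of those for single i, and they cut
the lattice over the partially formal ring into summands, which are free because the ring is local.
The bound on the poles is checked formally and descends, since a formal series with poles in D(J)
that is also partially convergent with poles in D is partially convergent with poles in D(J). -/

/-- The sum of `‖f_d‖ W d` over all exponents `d` of degree at most `k`. -/
noncomputable def truncNorm {n : ℕ} (W : (Fin n →₀ ℕ) → ℝ) (k : ℕ)
    (f : MvPowerSeries (Fin n) ℂ) : ℝ :=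
  ∑ d ∈ (Finsupp.finite_of_degree_le (σ := Fin n) k).toFinset, ‖MvPowerSeries.coeff d f‖ * W d

/-- Nonnegative submultiplicative weights on exponents. -/
structure IsWeight {n : ℕ} (W : (Fin n →₀ ℕ) → ℝ) : Prop where
  nonneg : ∀ d, 0 ≤ W d
  zero_le_one : W 0 ≤ 1
  add_le : ∀ a b, W (a + b) ≤ W a * W b

section TruncNorm

variable {n : ℕ} {W : (Fin n →₀ ℕ) → ℝ}

lemma truncNorm_nonneg (hW : IsWeight W) (k : ℕ) (f : MvPowerSeries (Fin n) ℂ) :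
    0 ≤ truncNorm W k f :=
  Finset.sum_nonneg fun d _ => mul_nonneg (norm_nonneg _) (hW.nonneg d)

lemma truncNorm_add_le (hW : IsWeight W) (k : ℕ) (f g : MvPowerSeries (Fin n) ℂ) :
    truncNorm W k (f + g) ≤ truncNorm W k f + truncNorm W k g := by
  unfold truncNorm
  rw [← Finset.sum_add_distrib]
  refine Finset.sum_le_sum fun d _ => ?_
  rw [← add_mul, map_add]
  exact mul_le_mul_of_nonneg_right (norm_add_le _ _) (hW.nonneg d)

lemma truncNorm_neg (k : ℕ) (f : MvPowerSeries (Fin n) ℂ) :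
    truncNorm W k (-f) = truncNorm W k f := by
  simp [truncNorm]

lemma truncNorm_sub_le (hW : IsWeight W) (k : ℕ) (f g : MvPowerSeries (Fin n) ℂ) :
    truncNorm W k (f - g) ≤ truncNorm W k f + truncNorm W k g := by
  rw [sub_eq_add_neg, ← truncNorm_neg k g]
  exact truncNorm_add_le hW k f (-g)

lemma truncNorm_zero (k : ℕ) : truncNorm W k 0 = 0 := by
  simp [truncNorm]

lemma truncNorm_sum_le (hW : IsWeight W) (k : ℕ) {ι : Type*} (s : Finset ι)
    (f : ι → MvPowerSeries (Fin n) ℂ) :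
    truncNorm W k (∑ a ∈ s, f a) ≤ ∑ a ∈ s, truncNorm W k (f a) := by
  classical
  induction s using Finset.induction_on with
  | empty => simp [truncNorm_zero]
  | insert a s ha ih =>
    rw [Finset.sum_insert ha, Finset.sum_insert ha]
    exact (truncNorm_add_le hW k _ _).trans (by gcongr)

/-- The factors may be cut at levels k and k' below l, as long as every pair of exponents that
really occurs respects these levels. A factor without constant term thus lowers the degree up to
which the other one must be known, which drives all inductions on the degree below. -/
lemma truncNorm_mul_le_of (hW : IsWeight W) {k k' l : ℕ} {f g : MvPowerSeries (Fin n) ℂ}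
    (h : ∀ a b : Fin n →₀ ℕ, (a + b).degree ≤ l → MvPowerSeries.coeff a f ≠ 0 →
      MvPowerSeries.coeff b g ≠ 0 → a.degree ≤ k ∧ b.degree ≤ k') :
    truncNorm W l (f * g) ≤ truncNorm W k f * truncNorm W k' g := by
  classical
  unfold truncNorm
  rw [Finset.sum_mul_sum, ← Finset.sum_product']
  set T := (Finsupp.finite_of_degree_le (σ := Fin n) k).toFinset ×ˢ
    (Finsupp.finite_of_degree_le (σ := Fin n) k').toFinset with hT
  have hnn : ∀ p : (Fin n →₀ ℕ) × (Fin n →₀ ℕ), 0 ≤ ‖MvPowerSeries.coeff p.1 f‖ * W p.1 *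
      (‖MvPowerSeries.coeff p.2 g‖ * W p.2) := fun p =>
    mul_nonneg (mul_nonneg (norm_nonneg _) (hW.nonneg _))
      (mul_nonneg (norm_nonneg _) (hW.nonneg _))
  refine le_trans ?_ (Finset.sum_fiberwise_le_sum_of_sum_fiber_nonneg
    (s := T) (t := (Finsupp.finite_of_degree_le (σ := Fin n) l).toFinset)
    (g := fun p => p.1 + p.2) fun d _ => Finset.sum_nonneg fun p _ => hnn p)
  refine Finset.sum_le_sum fun d hd => ?_
  simp only [Set.Finite.mem_toFinset, Set.mem_ofPred_eq] at hd
  have h1 : ‖MvPowerSeries.coeff d (f * g)‖ * W d ≤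
      ∑ p ∈ Finset.HasAntidiagonal.antidiagonal d, ‖MvPowerSeries.coeff p.1 f‖ * W p.1 *
      (‖MvPowerSeries.coeff p.2 g‖ * W p.2) := by
    rw [MvPowerSeries.coeff_mul]
    refine (mul_le_mul_of_nonneg_right (norm_sum_le _ _) (hW.nonneg d)).trans ?_
    rw [Finset.sum_mul]
    refine Finset.sum_le_sum fun p hp => ?_
    rw [Finset.HasAntidiagonal.mem_antidiagonal] at hp
    rw [norm_mul, ← hp]
    calc ‖MvPowerSeries.coeff p.1 f‖ * ‖MvPowerSeries.coeff p.2 g‖ * W (p.1 + p.2)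
        ≤ ‖MvPowerSeries.coeff p.1 f‖ * ‖MvPowerSeries.coeff p.2 g‖ * (W p.1 * W p.2) :=
          mul_le_mul_of_nonneg_left (hW.add_le _ _) (by positivity)
      _ = _ := by ring
  refine h1.trans ?_
  rw [← Finset.sum_filter_ne_zero]
  refine Finset.sum_le_sum_of_subset_of_nonneg (fun p hp => ?_) fun p _ _ => hnn p
  rw [Finset.mem_filter, Finset.HasAntidiagonal.mem_antidiagonal] at hp
  have hf : MvPowerSeries.coeff p.1 f ≠ 0 := fun h0 => hp.2 (by simp [h0])
  have hg : MvPowerSeries.coeff p.2 g ≠ 0 := fun h0 => hp.2 (by simp [h0])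
  have := h p.1 p.2 (by rw [hp.1]; exact hd) hf hg
  simp only [hT, Finset.mem_filter, Finset.mem_product, Set.Finite.mem_toFinset,
    Set.mem_ofPred_eq]
  exact ⟨this, hp.1⟩

lemma truncNorm_mul_le (hW : IsWeight W) (k : ℕ) (f g : MvPowerSeries (Fin n) ℂ) :
    truncNorm W k (f * g) ≤ truncNorm W k f * truncNorm W k g := by
  refine truncNorm_mul_le_of hW fun a b hab _ _ => ?_
  rw [map_add] at hab
  omega

lemma one_le_degree_of_coeff_ne_zero {f : MvPowerSeries (Fin n) ℂ}
    (hf : MvPowerSeries.constantCoeff f = 0) {a : Fin n →₀ ℕ}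
    (ha : MvPowerSeries.coeff a f ≠ 0) : 1 ≤ a.degree := by
  by_contra h
  have : a = 0 := by rw [← Finsupp.degree_eq_zero_iff]; omega
  subst this
  exact ha (by simpa using hf)

lemma truncNorm_succ_mul_le_left (hW : IsWeight W) (k : ℕ) {f : MvPowerSeries (Fin n) ℂ}
    (hf : MvPowerSeries.constantCoeff f = 0) (g : MvPowerSeries (Fin n) ℂ) :
    truncNorm W (k + 1) (f * g) ≤ truncNorm W (k + 1) f * truncNorm W k g := by
  refine truncNorm_mul_le_of hW fun a b hab ha _ => ?_
  have := one_le_degree_of_coeff_ne_zero hf ha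
  rw [map_add] at hab
  omega

lemma truncNorm_succ_mul_le_right (hW : IsWeight W) (k : ℕ) (f : MvPowerSeries (Fin n) ℂ)
    {g : MvPowerSeries (Fin n) ℂ} (hg : MvPowerSeries.constantCoeff g = 0) :
    truncNorm W (k + 1) (f * g) ≤ truncNorm W k f * truncNorm W (k + 1) g := by
  rw [mul_comm f g, mul_comm (truncNorm W k f)]
  exact truncNorm_succ_mul_le_left hW k hg f

lemma truncNorm_succ_mul_le (hW : IsWeight W) (k : ℕ) {f g : MvPowerSeries (Fin n) ℂ}
    (hf : MvPowerSeries.constantCoeff f = 0) (hg : MvPowerSeries.constantCoeff g = 0) :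
    truncNorm W (k + 1) (f * g) ≤ truncNorm W k f * truncNorm W k g := by
  refine truncNorm_mul_le_of hW fun a b hab ha hb => ?_
  have := one_le_degree_of_coeff_ne_zero hf ha
  have := one_le_degree_of_coeff_ne_zero hg hb
  rw [map_add] at hab
  omega

lemma truncNorm_degree_zero (f : MvPowerSeries (Fin n) ℂ) :
    truncNorm W 0 f = ‖MvPowerSeries.constantCoeff f‖ * W 0 := by
  have : (Finsupp.finite_of_degree_le (σ := Fin n) 0).toFinset = {0} := by
    ext d
    simp [Finsupp.degree_eq_zero_iff]
  rw [truncNorm, this]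
  simp

lemma truncNorm_C_le (hW : IsWeight W) (k : ℕ) (c : ℂ) :
    truncNorm W k (MvPowerSeries.C c) ≤ ‖c‖ := by
  classical
  unfold truncNorm
  rw [Finset.sum_eq_single 0]
  · simpa using mul_le_mul_of_nonneg_left hW.zero_le_one (norm_nonneg c)
  · intro d _ hd
    simp [MvPowerSeries.coeff_C, hd]
  · intro h
    exact absurd (by simp) h

end TruncNorm

/-! ### Weights adapted to series formal in some variables and convergent in the others. -/

/-- The weights `r^|d| σ^(∑ d_i, i ∈ S)`, cut off at exponents `d` with `d_i > N` for some
`i ∈ S`. -/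
noncomputable def cutWeight {n : ℕ} (S : Set (Fin n)) (r σ : ℝ) (N : ℕ) (d : Fin n →₀ ℕ) : ℝ :=
  Set.indicator {d : Fin n →₀ ℕ | ∀ i ∈ S, d i ≤ N}
    (fun d => r ^ d.degree * σ ^ (∑ i ∈ S.toFinite.toFinset, d i)) d

section CutWeight

variable {n : ℕ} {S : Set (Fin n)}

lemma cutWeight_of_mem {r σ : ℝ} {N : ℕ} {d : Fin n →₀ ℕ} (hd : ∀ i ∈ S, d i ≤ N) :
    cutWeight S r σ N d = r ^ d.degree * σ ^ (∑ i ∈ S.toFinite.toFinset, d i) :=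
  Set.indicator_of_mem (show d ∈ {d : Fin n →₀ ℕ | ∀ i ∈ S, d i ≤ N} from hd) _

lemma cutWeight_of_notMem {r σ : ℝ} {N : ℕ} {d : Fin n →₀ ℕ} (hd : ¬ ∀ i ∈ S, d i ≤ N) :
    cutWeight S r σ N d = 0 :=
  Set.indicator_of_notMem (show d ∉ {d : Fin n →₀ ℕ | ∀ i ∈ S, d i ≤ N} from hd) _

lemma isWeight_cutWeight {r σ : ℝ} (hr : 0 ≤ r) (hσ : 0 ≤ σ) (N : ℕ) :
    IsWeight (cutWeight S r σ N) where
  nonneg d := Set.indicator_nonneg (fun _ _ => by positivity) _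
  zero_le_one := by rw [cutWeight_of_mem (by simp)]; simp
  add_le a b := by
    by_cases h : ∀ i ∈ S, (a + b) i ≤ N
    · rw [cutWeight_of_mem h, cutWeight_of_mem fun i hi => (Nat.le_add_right _ _).trans (h i hi),
        cutWeight_of_mem fun i hi => (Nat.le_add_left _ _).trans (h i hi)]
      simp only [map_add, Finsupp.add_apply, Finset.sum_add_distrib, pow_add]
      exact le_of_eq (by ring)
    · rw [cutWeight_of_notMem h]
      exact mul_nonneg (Set.indicator_nonneg (fun _ _ => by positivity) _)
        (Set.indicator_nonneg (fun _ _ => by positivity) _)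

lemma weight_of_mem {r : ℝ} {N : ℕ} {d : Fin n →₀ ℕ} (f : MvPowerSeries (Fin n) ℂ)
    (hd : ∀ i ∈ S, d i ≤ N) : weight S r N f d = ‖MvPowerSeries.coeff d f‖ * r ^ d.degree :=
  Set.indicator_of_mem (show d ∈ {d : Fin n →₀ ℕ | ∀ i ∈ S, d i ≤ N} from hd) _

lemma weight_of_notMem {r : ℝ} {N : ℕ} {d : Fin n →₀ ℕ} (f : MvPowerSeries (Fin n) ℂ)
    (hd : ¬ ∀ i ∈ S, d i ≤ N) : weight S r N f d = 0 :=
  Set.indicator_of_notMem (show d ∉ {d : Fin n →₀ ℕ | ∀ i ∈ S, d i ≤ N} from hd) _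

/-- Bounded truncated norms give convergence. -/
lemma isGermAlong_of_truncNorm_le {f : MvPowerSeries (Fin n) ℂ} {r : ℝ} (hr : 0 < r)
    (h : ∀ N, ∃ σ : ℝ, 0 < σ ∧ ∃ B, ∀ k, truncNorm (cutWeight S r σ N) k f ≤ B) :
    IsGermAlong S f := by
  refine ⟨r, hr, fun N => ?_⟩
  obtain ⟨σ, hσ, B, hB⟩ := h N
  -- On the kept exponents the formal part has total degree at most n * N, so the power of σ is
  -- bounded below by τ ^ (n * N). It costs only a constant depending on N, and the radius r is
  -- unaffected.
  set τ := min σ 1 with hτ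
  have hτ0 : 0 < τ := lt_min hσ one_pos
  have hτ1 : τ ≤ 1 := min_le_right _ _
  have key : ∀ d, τ ^ (n * N) * weight S r N f d ≤
      ‖MvPowerSeries.coeff d f‖ * cutWeight S r σ N d := by
    intro d
    by_cases hd : ∀ i ∈ S, d i ≤ N
    · rw [weight_of_mem f hd, cutWeight_of_mem hd]
      have h1 : ∑ i ∈ S.toFinite.toFinset, d i ≤ n * N := by
        refine (Finset.sum_le_card_nsmul _ _ N fun i hi => hd i (by simpa using hi)).trans ?_
        rw [smul_eq_mul]
        exact Nat.mul_le_mul_right _ ((Finset.card_le_univ _).trans (by simp))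
      have h2 : τ ^ (n * N) ≤ σ ^ (∑ i ∈ S.toFinite.toFinset, d i) :=
        (pow_le_pow_of_le_one hτ0.le hτ1 h1).trans
          (pow_le_pow_left₀ hτ0.le (min_le_left _ _) _)
      calc τ ^ (n * N) * (‖MvPowerSeries.coeff d f‖ * r ^ d.degree)
          ≤ σ ^ (∑ i ∈ S.toFinite.toFinset, d i) *
            (‖MvPowerSeries.coeff d f‖ * r ^ d.degree) := by gcongr
        _ = _ := by ring
    · rw [weight_of_notMem f hd, cutWeight_of_notMem hd]
      simp
  have hs : Summable fun d => τ ^ (n * N) * weight S r N f d := by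
    refine summable_of_sum_le (c := B)
      (fun d => mul_nonneg (by positivity) (weight_nonneg hr.le N f d)) fun u => ?_
    refine (Finset.sum_le_sum fun d _ => key d).trans (le_trans ?_ (hB (u.sup Finsupp.degree)))
    refine Finset.sum_le_sum_of_subset_of_nonneg (fun d hd => ?_)
      fun d _ _ => mul_nonneg (norm_nonneg _) ((isWeight_cutWeight hr.le hσ.le N).nonneg d)
    simpa using Finset.le_sup (f := Finsupp.degree) hd
  exact (summable_mul_left_iff (by positivity)).1 hs

/-- A germ without constant term has small truncated norms for small radii; the radius in the
convergent variables does not depend on the truncation order in the formal variables. -/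
lemma IsGermAlong.eventually_truncNorm_le {f : MvPowerSeries (Fin n) ℂ} (hf : IsGermAlong S f)
    (hf0 : MvPowerSeries.constantCoeff f = 0) {ε : ℝ} (hε : 0 < ε) :
    ∀ᶠ r in 𝓝[>] (0 : ℝ), ∀ N, ∀ᶠ σ in 𝓝[>] (0 : ℝ), ∀ k,
      truncNorm (cutWeight S r σ N) k f ≤ ε := by
  obtain ⟨R, hR, hs⟩ := hf
  have hC : ∀ N, 0 ≤ ∑' d, weight S R N f d := fun N => tsum_nonneg (weight_nonneg hR.le N f)
  -- Terms free of the formal variables have degree at least 1, so passing from R to r gains r / R.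
  -- Only the cutoff 0 enters here, which makes r independent of N. All other terms carry a positive
  -- power of σ, which is chosen after N.
  have hr1 : ∀ᶠ r in 𝓝[>] (0 : ℝ), r / R * ∑' d, weight S R 0 f d < ε / 2 := by
    have : Tendsto (fun r : ℝ => r / R * ∑' d, weight S R 0 f d) (𝓝[>] 0) (𝓝 0) := by
      have h : Continuous fun r : ℝ => r / R * ∑' d, weight S R 0 f d := by fun_prop
      simpa using (h.tendsto 0).mono_left nhdsWithin_le_nhds
    exact this.eventually_lt_const (by positivity)
  filter_upwards [hr1, self_mem_nhdsWithin, Ioc_mem_nhdsGT hR] with r hr1 hr0 hrR N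
  have hr0 : 0 < r := hr0
  have hσ1 : ∀ᶠ σ in 𝓝[>] (0 : ℝ), σ * ∑' d, weight S R N f d < ε / 2 := by
    have : Tendsto (fun r : ℝ => r * ∑' d, weight S R N f d) (𝓝[>] 0) (𝓝 0) := by
      have h : Continuous fun r : ℝ => r * ∑' d, weight S R N f d := by fun_prop
      simpa using (h.tendsto 0).mono_left nhdsWithin_le_nhds
    exact this.eventually_lt_const (by positivity)
  filter_upwards [hσ1, self_mem_nhdsWithin, Ioc_mem_nhdsGT one_pos] with σ hσ1 hσ0 hσ k
  have hσ0 : 0 < σ := hσ0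
  have key : ∀ d, ‖MvPowerSeries.coeff d f‖ * cutWeight S r σ N d ≤
      r / R * weight S R 0 f d + σ * weight S R N f d := by
    intro d
    have hn0 := weight_nonneg (S := S) hR.le 0 f d
    have hnN := weight_nonneg (S := S) hR.le N f d
    by_cases hd : ∀ i ∈ S, d i ≤ N
    swap
    · rw [cutWeight_of_notMem hd, mul_zero]
      positivity
    rw [cutWeight_of_mem hd]
    by_cases hd0 : ∀ i ∈ S, d i ≤ 0
    · refine le_add_of_le_of_nonneg ?_ (by positivity)
      rw [weight_of_mem f hd0]
      by_cases hc : MvPowerSeries.coeff d f = 0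
      · simp [hc]
      obtain ⟨p, hp⟩ := Nat.exists_eq_add_of_le' (one_le_degree_of_coeff_ne_zero hf0 hc)
      have h1 : σ ^ (∑ i ∈ S.toFinite.toFinset, d i) ≤ 1 := pow_le_one₀ hσ0.le hσ.2
      have h2 : r ^ d.degree ≤ r / R * R ^ d.degree := by
        rw [hp, pow_succ, pow_succ]
        have : r / R * (R ^ p * R) = R ^ p * r := by field_simp
        rw [this]
        gcongr
        exact hrR.2
      calc ‖MvPowerSeries.coeff d f‖ * (r ^ d.degree * σ ^ (∑ i ∈ S.toFinite.toFinset, d i))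
          ≤ ‖MvPowerSeries.coeff d f‖ * ((r / R * R ^ d.degree) * 1) := by gcongr
        _ = _ := by ring
    · refine le_add_of_nonneg_of_le (by positivity) ?_
      rw [weight_of_mem f hd]
      push Not at hd0
      obtain ⟨i, hiS, hi⟩ := hd0
      have h1 : 1 ≤ ∑ i ∈ S.toFinite.toFinset, d i :=
        hi.trans_le (Finset.single_le_sum (f := fun i => d i) (fun _ _ => Nat.zero_le _)
          (by simpa using hiS))
      have h2 : σ ^ (∑ i ∈ S.toFinite.toFinset, d i) ≤ σ := by
        simpa using pow_le_pow_of_le_one hσ0.le hσ.2 h1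
      calc ‖MvPowerSeries.coeff d f‖ * (r ^ d.degree * σ ^ (∑ i ∈ S.toFinite.toFinset, d i))
          ≤ ‖MvPowerSeries.coeff d f‖ * (R ^ d.degree * σ) := by
            gcongr
            exact hrR.2
        _ = _ := by ring
  calc truncNorm (cutWeight S r σ N) k f
      ≤ ∑ d ∈ (Finsupp.finite_of_degree_le (σ := Fin n) k).toFinset,
          (r / R * weight S R 0 f d + σ * weight S R N f d) :=
        Finset.sum_le_sum fun d _ => key d
    _ = r / R * ∑ d ∈ (Finsupp.finite_of_degree_le (σ := Fin n) k).toFinset, weight S R 0 f d +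
        σ * ∑ d ∈ (Finsupp.finite_of_degree_le (σ := Fin n) k).toFinset, weight S R N f d := by
        rw [Finset.sum_add_distrib, Finset.mul_sum, Finset.mul_sum]
    _ ≤ r / R * ∑' d, weight S R 0 f d + σ * ∑' d, weight S R N f d := by
        gcongr
        · exact (hs 0).sum_le_tsum _ fun d _ => weight_nonneg hR.le 0 f d
        · exact (hs N).sum_le_tsum _ fun d _ => weight_nonneg hR.le N f d
    _ ≤ ε := by linarith

end CutWeight

/-! ### Units, monomial factors and derivatives of germs -/

section Germs

variable {n : ℕ} {S : Set (Fin n)}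

/-- With c = f(0) and g = f - c one has c f⁻¹ = 1 - g f⁻¹. Since g has no constant term, degree k +
1 on the left needs f⁻¹ only up to degree k, and as soon as g has norm at most ‖c‖ / 2 the bound 2 /
‖c‖ reproduces itself. -/
lemma inv_mem_germs {f : MvPowerSeries (Fin n) ℂ} (hf : f ∈ germs S)
    (hf0 : MvPowerSeries.constantCoeff f ≠ 0) : f⁻¹ ∈ germs S := by
  set c := MvPowerSeries.constantCoeff f with hc
  have hcpos : 0 < ‖c‖ := norm_pos_iff.2 hf0
  set g := f - MvPowerSeries.C c with hg
  have hgS : IsGermAlong S g := (germs S).sub_mem hf ((germs S).algebraMap_mem c)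
  have hg0 : MvPowerSeries.constantCoeff g = 0 := by simp [hg, hc]
  have hmul : MvPowerSeries.C c * f⁻¹ = MvPowerSeries.C 1 - g * f⁻¹ := by
    have := MvPowerSeries.mul_inv_cancel f hf0
    rw [hg, sub_mul, this, map_one]
    ring
  have hev := hgS.eventually_truncNorm_le hg0 (half_pos hcpos)
  obtain ⟨r, hr, hr0⟩ := (hev.and self_mem_nhdsWithin).exists
  have hr0 : 0 < r := hr0
  refine isGermAlong_of_truncNorm_le hr0 fun N => ?_
  obtain ⟨σ, hσ, hσ0⟩ := ((hr N).and self_mem_nhdsWithin).exists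
  have hσ0 : 0 < σ := hσ0
  have hW := isWeight_cutWeight (S := S) hr0.le hσ0.le N
  have hscale : ∀ k, ‖c‖ * truncNorm (cutWeight S r σ N) k f⁻¹ =
      truncNorm (cutWeight S r σ N) k (MvPowerSeries.C c * f⁻¹) := by
    intro k
    simp only [truncNorm, MvPowerSeries.coeff_C_mul, norm_mul, Finset.mul_sum, mul_assoc]
  refine ⟨σ, hσ0, 2 / ‖c‖, fun k => ?_⟩
  rw [le_div_iff₀' hcpos]
  induction k with
  | zero =>
    rw [truncNorm_degree_zero, MvPowerSeries.constantCoeff_inv, ← hc, norm_inv,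
      mul_inv_cancel_left₀ hcpos.ne']
    linarith [hW.zero_le_one]
  | succ k ih =>
    rw [hscale, hmul]
    have h1 := truncNorm_sub_le hW (k + 1) (MvPowerSeries.C 1) (g * f⁻¹)
    have h2 := truncNorm_C_le hW (k + 1) (1 : ℂ)
    have h3 := truncNorm_succ_mul_le_left hW k hg0 f⁻¹
    have h4 := mul_le_mul_of_nonneg_right (hσ (k + 1)) (truncNorm_nonneg hW k f⁻¹)
    rw [norm_one] at h2
    linarith

/-- Multiplication by t^m shifts exponents, so cutoff N for f is covered by cutoff N + |m| for t^m
f, with the same radius. -/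
lemma mem_germs_of_monomial_mul_mem {m : Fin n →₀ ℕ} {f : MvPowerSeries (Fin n) ℂ}
    (h : MvPowerSeries.monomial m 1 * f ∈ germs S) : f ∈ germs S := by
  obtain ⟨r, hr, hs⟩ := h
  refine ⟨r, hr, fun N => ?_⟩
  have h1 := (hs (N + m.degree)).comp_injective (add_right_injective m)
  refine (h1.mul_left ((r ^ m.degree)⁻¹)).of_nonneg_of_le (weight_nonneg hr.le N f) fun d => ?_
  by_cases hd : ∀ i ∈ S, d i ≤ N
  · have hd' : ∀ i ∈ S, (m + d) i ≤ N + m.degree := fun i hi => by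
      have := hd i hi
      have := Finsupp.le_degree i m
      rw [Finsupp.add_apply]
      omega
    rw [Function.comp_apply, weight_of_mem _ hd', weight_of_mem _ hd,
      MvPowerSeries.coeff_add_monomial_mul, map_add, pow_add, one_mul]
    refine le_of_eq ?_
    field_simp
  · rw [weight_of_notMem _ hd]
    exact mul_nonneg (by positivity) (weight_nonneg hr.le _ _ _)

/-- The factor d_i + 1 is at most 2 ^ |d|, which is absorbed by halving the radius. -/
lemma pderiv_mem_germs (i : Fin n) {f : MvPowerSeries (Fin n) ℂ} (hf : f ∈ germs S) :
    MvPowerSeries.pderiv ℂ i f ∈ germs S := by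
  obtain ⟨r, hr, hs⟩ := hf
  refine ⟨r / 2, by positivity, fun N => ?_⟩
  have h1 := (hs (N + 1)).comp_injective (add_left_injective (Finsupp.single i 1))
  refine (h1.mul_left (r⁻¹)).of_nonneg_of_le (weight_nonneg (by positivity) N _) fun d => ?_
  by_cases hd : ∀ i ∈ S, d i ≤ N
  · have hd' : ∀ j ∈ S, (d + Finsupp.single i 1 : Fin n →₀ ℕ) j ≤ N + 1 := fun j hj => by
      have := hd j hj
      have := Finsupp.le_degree j (Finsupp.single i 1)
      rw [Finsupp.degree_single] at this
      rw [Finsupp.add_apply]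
      omega
    rw [Function.comp_apply, weight_of_mem _ hd', weight_of_mem _ hd,
      MvPowerSeries.coeff_pderiv, norm_mul, map_add, Finsupp.degree_single, pow_succ, div_pow]
    have h2 : ‖((d i : ℂ) + 1)‖ ≤ 2 ^ d.degree := by
      have h3 : d i + 1 ≤ 2 ^ d.degree :=
        (Nat.succ_le_succ (Finsupp.le_degree i d)).trans Nat.lt_two_pow_self
      calc ‖((d i : ℂ) + 1)‖ = ((d i + 1 : ℕ) : ℝ) := by
            rw [← Complex.norm_natCast]; push_cast; rfl
        _ ≤ _ := by exact_mod_cast h3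
    calc ‖MvPowerSeries.coeff (d + Finsupp.single i 1) f‖ * ‖((d i : ℂ) + 1)‖ *
          (r ^ d.degree / 2 ^ d.degree)
        ≤ ‖MvPowerSeries.coeff (d + Finsupp.single i 1) f‖ * 2 ^ d.degree *
          (r ^ d.degree / 2 ^ d.degree) := by gcongr
      _ = _ := by field_simp
  · rw [weight_of_notMem _ hd]
    exact mul_nonneg (by positivity) (weight_nonneg hr.le _ _ _)

end Germs

end GoodLattice

namespace GoodLattice

open Filter Topology

/-! ### Norms of matrices of power series. -/

section MatrixNorm

variable {n : ℕ} {W : (Fin n →₀ ℕ) → ℝ} {ι : Type*} [Fintype ι]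

/-- The sum of the truncated norms of the entries of a matrix. -/
noncomputable def matTruncNorm (W : (Fin n →₀ ℕ) → ℝ) (k : ℕ)
    (M : Matrix ι ι (MvPowerSeries (Fin n) ℂ)) : ℝ :=
  ∑ a, ∑ b, truncNorm W k (M a b)

lemma matTruncNorm_nonneg (hW : IsWeight W) (k : ℕ)
    (M : Matrix ι ι (MvPowerSeries (Fin n) ℂ)) : 0 ≤ matTruncNorm W k M :=
  Finset.sum_nonneg fun _ _ => Finset.sum_nonneg fun _ _ => truncNorm_nonneg hW k _

lemma truncNorm_le_matTruncNorm (hW : IsWeight W) (k : ℕ)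
    (M : Matrix ι ι (MvPowerSeries (Fin n) ℂ)) (a b : ι) :
    truncNorm W k (M a b) ≤ matTruncNorm W k M :=
  (Finset.single_le_sum (f := fun b => truncNorm W k (M a b))
    (fun _ _ => truncNorm_nonneg hW k _) (Finset.mem_univ b)).trans
    (Finset.single_le_sum (f := fun a => ∑ b, truncNorm W k (M a b))
      (fun _ _ => Finset.sum_nonneg fun _ _ => truncNorm_nonneg hW k _) (Finset.mem_univ a))

lemma matTruncNorm_add_le (hW : IsWeight W) (k : ℕ)
    (M M' : Matrix ι ι (MvPowerSeries (Fin n) ℂ)) :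
    matTruncNorm W k (M + M') ≤ matTruncNorm W k M + matTruncNorm W k M' := by
  simp only [matTruncNorm, ← Finset.sum_add_distrib]
  exact Finset.sum_le_sum fun a _ => Finset.sum_le_sum fun b _ => truncNorm_add_le hW k _ _

lemma matTruncNorm_sub_le (hW : IsWeight W) (k : ℕ)
    (M M' : Matrix ι ι (MvPowerSeries (Fin n) ℂ)) :
    matTruncNorm W k (M - M') ≤ matTruncNorm W k M + matTruncNorm W k M' := by
  simp only [matTruncNorm, ← Finset.sum_add_distrib]
  exact Finset.sum_le_sum fun a _ => Finset.sum_le_sum fun b _ => truncNorm_sub_le hW k _ _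

lemma matTruncNorm_mul_le_of (hW : IsWeight W) {k k' l : ℕ}
    {M M' : Matrix ι ι (MvPowerSeries (Fin n) ℂ)}
    (h : ∀ a b c, truncNorm W l (M a b * M' b c) ≤
      truncNorm W k (M a b) * truncNorm W k' (M' b c)) :
    matTruncNorm W l (M * M') ≤ matTruncNorm W k M * matTruncNorm W k' M' := by
  unfold matTruncNorm
  rw [Finset.sum_mul]
  refine Finset.sum_le_sum fun a _ => ?_
  calc ∑ c, truncNorm W l ((M * M') a c)
      ≤ ∑ c, ∑ b, truncNorm W k (M a b) * truncNorm W k' (M' b c) :=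
        Finset.sum_le_sum fun c _ => by
          rw [Matrix.mul_apply]
          exact (truncNorm_sum_le hW l _ _).trans (Finset.sum_le_sum fun b _ => h a b c)
    _ = ∑ b, truncNorm W k (M a b) * ∑ c, truncNorm W k' (M' b c) := by
        rw [Finset.sum_comm]
        simp only [Finset.mul_sum]
    _ ≤ ∑ b, truncNorm W k (M a b) * ∑ b, ∑ c, truncNorm W k' (M' b c) := by
        refine Finset.sum_le_sum fun b _ => mul_le_mul_of_nonneg_left ?_ (truncNorm_nonneg hW k _)
        exact Finset.single_le_sum (f := fun b => ∑ c, truncNorm W k' (M' b c))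
          (fun _ _ => Finset.sum_nonneg fun _ _ => truncNorm_nonneg hW k' _) (Finset.mem_univ b)
    _ = _ := by rw [Finset.sum_mul]

lemma matTruncNorm_C_le (hW : IsWeight W) (k : ℕ) (p : Matrix ι ι ℂ) :
    matTruncNorm W k (p.map (MvPowerSeries.C (σ := Fin n))) ≤ ∑ a, ∑ b, ‖p a b‖ :=
  Finset.sum_le_sum fun _ _ => Finset.sum_le_sum fun _ _ => truncNorm_C_le hW k _

/-- The norm of a commutator with a constant matrix. -/
lemma matTruncNorm_commutator_C_le (hW : IsWeight W) (k : ℕ) (p : Matrix ι ι ℂ)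
    (M : Matrix ι ι (MvPowerSeries (Fin n) ℂ)) :
    matTruncNorm W k (p.map (MvPowerSeries.C (σ := Fin n)) * M -
      M * p.map (MvPowerSeries.C (σ := Fin n))) ≤
      2 * (∑ a, ∑ b, ‖p a b‖) * matTruncNorm W k M := by
  have h0 := matTruncNorm_C_le hW k p
  have h1 := matTruncNorm_mul_le_of hW (k := k) (k' := k) (l := k)
    (M := p.map (MvPowerSeries.C (σ := Fin n))) (M' := M) fun _ _ _ => truncNorm_mul_le hW k _ _
  have h2 := matTruncNorm_mul_le_of hW (k := k) (k' := k) (l := k)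
    (M' := p.map (MvPowerSeries.C (σ := Fin n))) (M := M) fun _ _ _ => truncNorm_mul_le hW k _ _
  have h3 := matTruncNorm_sub_le hW k (p.map (MvPowerSeries.C (σ := Fin n)) * M)
    (M * p.map (MvPowerSeries.C (σ := Fin n)))
  have h4 := mul_le_mul_of_nonneg_right h0 (matTruncNorm_nonneg hW k M)
  linarith

/-- An estimate for matrices of power series whose coefficients are related by an injective linear
operator. -/
lemma exists_matTruncNorm_le_of_injective [DecidableEq ι]
    (T : Matrix ι ι ℂ →ₗ[ℂ] Matrix ι ι ℂ) (hT : ∀ Z, T Z = 0 → Z = 0) :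
    ∃ c : ℝ, 0 < c ∧ ∀ {W : (Fin n →₀ ℕ) → ℝ}, IsWeight W →
      ∀ Y Z : Matrix ι ι (MvPowerSeries (Fin n) ℂ),
      (∀ d, T (Y.map (MvPowerSeries.coeff d)) = Z.map (MvPowerSeries.coeff d)) →
      ∀ k, matTruncNorm W k Y ≤ c * matTruncNorm W k Z := by
  let _ : NormedAddCommGroup (Matrix ι ι ℂ) := Matrix.normedAddCommGroup
  let _ : NormedSpace ℂ (Matrix ι ι ℂ) := Matrix.normedSpace
  obtain ⟨K, hK, hKT⟩ := LinearMap.exists_antilipschitzWith T (LinearMap.ker_eq_bot'.2 hT)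
  have key : ∀ (Z : Matrix ι ι ℂ) (a b : ι), ‖Z a b‖ ≤ K * ∑ a, ∑ b, ‖T Z a b‖ := by
    intro Z a b
    have h1 := hKT.le_mul_dist Z 0
    rw [map_zero, dist_zero_right, dist_zero_right] at h1
    refine (Matrix.norm_entry_le_entrywise_sup_norm Z).trans (h1.trans ?_)
    gcongr
    rw [Matrix.norm_le_iff (by positivity)]
    intro a b
    exact (Finset.single_le_sum (f := fun b => ‖T Z a b‖)
      (fun _ _ => norm_nonneg _) (Finset.mem_univ b)).trans
      (Finset.single_le_sum (f := fun a => ∑ b, ‖T Z a b‖)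
        (fun _ _ => Finset.sum_nonneg fun _ _ => norm_nonneg _) (Finset.mem_univ a))
  -- The summand 1 only keeps the constant positive when the index type is empty.
  refine ⟨(Fintype.card ι) * (Fintype.card ι) * K + 1, by positivity, ?_⟩
  intro W hW Y Z hYZ k
  have hswap : ∀ M : Matrix ι ι (MvPowerSeries (Fin n) ℂ), matTruncNorm W k M =
      ∑ d ∈ (Finsupp.finite_of_degree_le (σ := Fin n) k).toFinset,
        (∑ a, ∑ b, ‖M.map (MvPowerSeries.coeff d) a b‖) * W d := by
    intro M
    simp only [matTruncNorm, truncNorm, Matrix.map_apply, Finset.sum_mul]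
    rw [Finset.sum_comm]
    conv_rhs => rw [Finset.sum_comm]
    rw [Finset.sum_comm]
    exact Finset.sum_congr rfl fun a _ => Finset.sum_comm
  refine le_trans ?_ (mul_le_mul_of_nonneg_right
    (le_add_of_nonneg_right zero_le_one) (matTruncNorm_nonneg hW k Z))
  rw [hswap Y, hswap Z, Finset.mul_sum]
  refine Finset.sum_le_sum fun d _ => ?_
  rw [← mul_assoc]
  refine mul_le_mul_of_nonneg_right ?_ (hW.nonneg d)
  rw [← hYZ d]
  calc ∑ a, ∑ b, ‖Y.map (MvPowerSeries.coeff d) a b‖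
      ≤ ∑ _a : ι, ∑ _b : ι, K * ∑ a, ∑ b, ‖T (Y.map (MvPowerSeries.coeff d)) a b‖ :=
        Finset.sum_le_sum fun a _ => Finset.sum_le_sum fun b _ => key _ a b
    _ = _ := by
        simp only [Finset.sum_const, Finset.card_univ, nsmul_eq_mul]
        ring

end MatrixNorm

/-! ### Convergence of horizontal idempotents. -/

section Core

variable {n : ℕ} {S : Set (Fin n)}

lemma coeff_X_mul_pderiv (i : Fin n) (f : MvPowerSeries (Fin n) ℂ) (d : Fin n →₀ ℕ) :
    MvPowerSeries.coeff d (MvPowerSeries.X i * MvPowerSeries.pderiv ℂ i f) =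
      (d i : ℂ) * MvPowerSeries.coeff d f := by
  classical
  rw [MvPowerSeries.X, MvPowerSeries.coeff_monomial_mul]
  split_ifs with h
  · rw [one_mul, MvPowerSeries.coeff_pderiv, tsub_add_cancel_of_le h]
    have h1 : 1 ≤ d i := by simpa using h i
    have h2 : ((d - Finsupp.single i 1 : Fin n →₀ ℕ) i : ℂ) + 1 = d i := by
      rw [Finsupp.tsub_apply, Finsupp.single_eq_same, Nat.cast_sub h1]
      simp
    rw [h2, mul_comm]
  · have : d i = 0 := by
      by_contra h0
      exact h (by simpa using Nat.one_le_iff_ne_zero.2 h0)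
    simp [this]

/-- The Euler operator multiplies the coefficient of t^d by d_i, and the cutoff keeps only d_i ≤ N.
There is no loss of radius, and the factor N is later beaten by σ. -/
lemma truncNorm_X_mul_pderiv_le {i : Fin n} (hi : i ∈ S) {r σ : ℝ} (hr : 0 ≤ r) (hσ : 0 ≤ σ)
    (N k : ℕ) (f : MvPowerSeries (Fin n) ℂ) :
    truncNorm (cutWeight S r σ N) k (MvPowerSeries.X i * MvPowerSeries.pderiv ℂ i f) ≤
      N * truncNorm (cutWeight S r σ N) k f := by
  unfold truncNorm
  rw [Finset.mul_sum]
  refine Finset.sum_le_sum fun d _ => ?_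
  by_cases hd : ∀ i ∈ S, d i ≤ N
  · rw [coeff_X_mul_pderiv, norm_mul, mul_assoc, Complex.norm_natCast]
    refine mul_le_mul_of_nonneg_right (by exact_mod_cast hd i hi)
      (mul_nonneg (norm_nonneg _) ((isWeight_cutWeight hr hσ N).nonneg d))
  · simp [cutWeight_of_notMem hd]

/-- Since t^m contains a formal variable, its weight contains σ at least once. This is the gain that
pays for the Euler operator. -/
lemma truncNorm_monomial_le {i : Fin n} (hi : i ∈ S) {m : Fin n →₀ ℕ} (hm : m i ≠ 0) {r σ : ℝ}
    (hr : 0 ≤ r) (hr1 : r ≤ 1) (hσ : 0 ≤ σ) (hσ1 : σ ≤ 1) (N k : ℕ) :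
    truncNorm (cutWeight S r σ N) k (MvPowerSeries.monomial m 1) ≤ σ := by
  classical
  have h1 : truncNorm (cutWeight S r σ N) k (MvPowerSeries.monomial m 1) ≤
      cutWeight S r σ N m := by
    unfold truncNorm
    by_cases hk : m ∈ (Finsupp.finite_of_degree_le (σ := Fin n) k).toFinset
    · rw [Finset.sum_eq_single_of_mem m hk]
      · simp
      · intro d _ hd
        simp [MvPowerSeries.coeff_monomial, hd]
    · rw [Finset.sum_eq_zero]
      · exact (isWeight_cutWeight hr hσ N).nonneg m
      · intro d hd
        have : d ≠ m := fun h => hk (h ▸ hd)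
        simp [MvPowerSeries.coeff_monomial, this]
  refine h1.trans ?_
  by_cases hd : ∀ i ∈ S, m i ≤ N
  · rw [cutWeight_of_mem hd]
    have h2 : 1 ≤ ∑ i ∈ S.toFinite.toFinset, m i :=
      (Nat.one_le_iff_ne_zero.2 hm).trans (Finset.single_le_sum (f := fun i => m i)
        (fun _ _ => Nat.zero_le _) (by simpa using hi))
    have h3 : σ ^ (∑ i ∈ S.toFinite.toFinset, m i) ≤ σ := by
      simpa using pow_le_pow_of_le_one hσ hσ1 h2
    calc r ^ m.degree * σ ^ (∑ i ∈ S.toFinite.toFinset, m i) ≤ 1 * σ := by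
          gcongr
          exact pow_le_one₀ hr hr1
      _ = σ := one_mul σ
  · rwa [cutWeight_of_notMem hd]

lemma constantCoeff_monomial_eq_zero {m : Fin n →₀ ℕ} (hm : m ≠ 0) :
    MvPowerSeries.constantCoeff (MvPowerSeries.monomial m (1 : ℂ)) = 0 := by
  classical
  rw [← MvPowerSeries.coeff_zero_eq_constantCoeff_apply, MvPowerSeries.coeff_monomial,
    if_neg hm.symm]

lemma map_coeff_sub {ι : Type*} (d : Fin n →₀ ℕ) (M M' : Matrix ι ι (MvPowerSeries (Fin n) ℂ)) :
    (M - M').map (MvPowerSeries.coeff d) =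
      M.map (MvPowerSeries.coeff d) - M'.map (MvPowerSeries.coeff d) := by
  ext a b
  simp

lemma map_coeff_add {ι : Type*} (d : Fin n →₀ ℕ) (M M' : Matrix ι ι (MvPowerSeries (Fin n) ℂ)) :
    (M + M').map (MvPowerSeries.coeff d) =
      M.map (MvPowerSeries.coeff d) + M'.map (MvPowerSeries.coeff d) := by
  ext a b
  simp

variable {ι : Type*} [Fintype ι]

lemma map_coeff_C_mul (d : Fin n →₀ ℕ) (p : Matrix ι ι ℂ)
    (M : Matrix ι ι (MvPowerSeries (Fin n) ℂ)) :
    (p.map (MvPowerSeries.C (σ := Fin n)) * M).map (MvPowerSeries.coeff d) =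
      p * M.map (MvPowerSeries.coeff d) := by
  ext a b
  simp [Matrix.mul_apply, MvPowerSeries.coeff_C_mul]

lemma map_coeff_mul_C (d : Fin n →₀ ℕ) (p : Matrix ι ι ℂ)
    (M : Matrix ι ι (MvPowerSeries (Fin n) ℂ)) :
    (M * p.map (MvPowerSeries.C (σ := Fin n))).map (MvPowerSeries.coeff d) =
      M.map (MvPowerSeries.coeff d) * p := by
  ext a b
  simp [Matrix.mul_apply, MvPowerSeries.coeff_mul_C]

/-- The operator `Z ↦ [p, [q, Z]] + Z - pZ - Zp`, the linearization at `p` of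
`Z ↦ [p, [q, Z]] + Z - Z²`. -/
noncomputable def splitOperator [DecidableEq ι] (p q : Matrix ι ι ℂ) :
    Matrix ι ι ℂ →ₗ[ℂ] Matrix ι ι ℂ :=
  (LinearMap.mulLeft ℂ p - LinearMap.mulRight ℂ p) ∘ₗ
    (LinearMap.mulLeft ℂ q - LinearMap.mulRight ℂ q) +
    (LinearMap.id - LinearMap.mulLeft ℂ p - LinearMap.mulRight ℂ p)

lemma splitOperator_apply [DecidableEq ι] (p q Z : Matrix ι ι ℂ) :
    splitOperator p q Z = p * (q * Z - Z * q) - (q * Z - Z * q) * p + (Z - p * Z - Z * p) := rfl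

/-- A sequence with a quadratic recursive bound and small linear part is bounded. -/
lemma exists_le_of_quadratic_recursion {K : ℝ} (hK : 1 ≤ K) :
    ∃ ε : ℝ, 0 < ε ∧ ∃ B : ℝ, ∀ y : ℕ → ℝ, (∀ k, 0 ≤ y k) → y 0 = 0 →
      (∀ k, y (k + 1) ≤ K * (y k ^ 2 + ε * (1 + y k))) → ∀ k, y k ≤ B := by
  have hK0 : 0 < K := by linarith
  -- With 2KB = 1, B ≤ 1 and ε = B² / 2 one gets K (B² + ε (1 + B)) ≤ 2KB² = B, so the bound B is
  -- stable under the recursion.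
  set B := 1 / (2 * K) with hB
  have hB0 : 0 < B := by positivity
  have hKB : K * B = 1 / 2 := by rw [hB]; field_simp
  have hB1 : B ≤ 1 := by nlinarith
  refine ⟨B ^ 2 / 2, by positivity, B, fun y hy0 hy hrec k => ?_⟩
  induction k with
  | zero => rw [hy]; exact hB0.le
  | succ k ih =>
    refine (hrec k).trans ?_
    have h1 : y k ^ 2 ≤ B ^ 2 := pow_le_pow_left₀ (hy0 k) ih 2
    calc K * (y k ^ 2 + B ^ 2 / 2 * (1 + y k)) ≤ K * (B ^ 2 + B ^ 2 / 2 * (1 + 1)) := by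
          gcongr
          exact ih.trans hB1
      _ = 2 * (K * B) * B := by ring
      _ = B := by rw [hKB]; ring

/-- Convergence of horizontal projectors: let `P` be a formal idempotent matrix satisfying the
differential equation `t^m t_i ∂P/∂t_i = [P, N]`, where `N` is formal in the variables in `S` only,
`i ∈ S` and `m_i > 0`. If the linearized problem at the origin is nondegenerate, then `P` is formal
in the variables in `S` only. -/
theorem mem_germs_of_horizontal_idempotent [DecidableEq ι] {i : Fin n} (hi : i ∈ S)
    {m : Fin n →₀ ℕ} (hm : m i ≠ 0) {N P : Matrix ι ι (MvPowerSeries (Fin n) ℂ)}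
    (hN : ∀ a b, N a b ∈ germs S) (hP : P * P = P)
    (hPN : P.map (fun f => MvPowerSeries.monomial m 1 *
      (MvPowerSeries.X i * MvPowerSeries.pderiv ℂ i f)) = P * N - N * P)
    (hinj : ∀ Z, splitOperator (P.map (MvPowerSeries.constantCoeff (R := ℂ)))
      (N.map (MvPowerSeries.constantCoeff (R := ℂ))) Z = 0 → Z = 0) (a b : ι) :
    P a b ∈ germs S := by
  have hm0 : m ≠ 0 := fun h => hm (by simp [h])
  set p : Matrix ι ι ℂ := P.map (MvPowerSeries.constantCoeff (R := ℂ)) with hp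
  set q : Matrix ι ι ℂ := N.map (MvPowerSeries.constantCoeff (R := ℂ)) with hq
  set pC := p.map (MvPowerSeries.C (σ := Fin n)) with hpC
  set qC := q.map (MvPowerSeries.C (σ := Fin n)) with hqC
  set D := P.map (fun f => MvPowerSeries.monomial m 1 *
      (MvPowerSeries.X i * MvPowerSeries.pderiv ℂ i f)) with hD
  set Y := P - pC with hY
  set N' := N - qC with hN'
  have hpp : p * p = p := by
    rw [hp, ← Matrix.map_mul, hP]
  -- At the origin t^m vanishes, so the differential equation says that p and q commute.
  have hqp : p * q - q * p = 0 := by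
    have h := congrArg (fun M : Matrix ι ι (MvPowerSeries (Fin n) ℂ) =>
      M.map (MvPowerSeries.constantCoeff (R := ℂ))) hPN
    have h1 : (P * N - N * P).map (MvPowerSeries.constantCoeff (R := ℂ)) = p * q - q * p := by
      rw [Matrix.map_sub _ (map_sub _), Matrix.map_mul, Matrix.map_mul]
    simp only [h1] at h
    rw [← h]
    ext a b
    simp [hD, constantCoeff_monomial_eq_zero hm0]
  have hppC : pC * pC = pC := by rw [hpC, ← Matrix.map_mul, hpp]
  have hqpC : pC * qC - qC * pC = 0 := by
    have h : (p * q - q * p).map (MvPowerSeries.C (σ := Fin n)) = pC * qC - qC * pC := by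
      rw [Matrix.map_sub _ (map_sub _), Matrix.map_mul, Matrix.map_mul]
    rw [← h, hqp, Matrix.map_zero _ (map_zero _)]
  have hY0 : ∀ a b, MvPowerSeries.constantCoeff (Y a b) = 0 := fun a b => by
    simp [hY, hpC, hp]
  have hN0 : ∀ a b, MvPowerSeries.constantCoeff (N' a b) = 0 := fun a b => by
    simp [hN', hqC, hq]
  have hPY : P = pC + Y := by rw [hY]; abel
  -- Y² comes from idempotency; the other two terms come from the commutator of p with D = [P, N]
  -- after N = q + N'. In Y * Y both factors vanish at the origin, elsewhere N' or the monomial in D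
  -- does.
  set R := Y * Y - (pC * (N' * P - P * N') - (N' * P - P * N') * pC) - (pC * D - D * pC) with hR
  have hid : pC * (qC * Y - Y * qC) - (qC * Y - Y * qC) * pC + (Y - pC * Y - Y * pC) = R := by
    -- A formal identity: the difference of the two sides is a combination of the defects in P² = P,
    -- p² = p, D = [P, N] and [p, q] = 0.
    have h1 : pC * (qC * Y - Y * qC) - (qC * Y - Y * qC) * pC + (Y - pC * Y - Y * pC) - R =
        (P - P * P) - (pC - pC * pC) + (pC * (D - (P * N - N * P)) - (D - (P * N - N * P)) * pC)
          + (pC * (pC * qC - qC * pC) - (pC * qC - qC * pC) * pC) := by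
      rw [hR, hY, hN']
      noncomm_ring
    rw [← sub_eq_zero, h1, hP, hppC, hqpC, hPN]
    simp
  obtain ⟨c, hc0, hc⟩ := exists_matTruncNorm_le_of_injective (n := n) (splitOperator p q) hinj
  have hbound : ∀ {W : (Fin n →₀ ℕ) → ℝ}, IsWeight W → ∀ k,
      matTruncNorm W k Y ≤ c * matTruncNorm W k R := fun hW => hc hW Y R fun d => by
    rw [← hid, splitOperator_apply]
    simp only [map_coeff_add, map_coeff_sub, hpC, hqC, map_coeff_C_mul, map_coeff_mul_C]
  set cp := ∑ a, ∑ b, ‖p a b‖ with hcp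
  have hcp0 : 0 ≤ cp := by positivity
  -- The norm of R in degree k + 1 is at most y² + 4 cp² ε + 6 cp ε y, with y the norm of Y in
  -- degree k. K dominates these coefficients times c, and the final 1 ensures K ≥ 1.
  set K := c * (1 + 4 * cp ^ 2 + 6 * cp) + 1 with hK
  have hK1 : 1 ≤ K := by rw [hK]; exact le_add_of_nonneg_left (by positivity)
  obtain ⟨ε, hε, B, hB⟩ := exists_le_of_quadratic_recursion hK1
  set ε' := ε / (Fintype.card ι * Fintype.card ι + 1) with hε'
  have hε'0 : 0 < ε' := by positivity
  have hev : ∀ᶠ r in 𝓝[>] (0 : ℝ), ∀ a b, ∀ N, ∀ᶠ σ in 𝓝[>] (0 : ℝ), ∀ k,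
      truncNorm (cutWeight S r σ N) k (N' a b) ≤ ε' := by
    rw [eventually_all]
    intro a
    rw [eventually_all]
    intro b
    refine IsGermAlong.eventually_truncNorm_le ?_ (hN0 a b) hε'0
    exact (germs S).sub_mem (hN a b) ((germs S).algebraMap_mem (q a b))
  obtain ⟨r, hr, hr1⟩ := (hev.and (Ioc_mem_nhdsGT one_pos)).exists
  have hr0 : 0 < r := hr1.1
  suffices hYg : IsGermAlong S (Y a b) by
    rw [hPY]
    exact (germs S).add_mem ((germs S).algebraMap_mem (p a b)) hYg
  refine isGermAlong_of_truncNorm_le hr0 fun M => ?_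
  have hev2 : ∀ᶠ σ in 𝓝[>] (0 : ℝ), ∀ a b, ∀ k,
      truncNorm (cutWeight S r σ M) k (N' a b) ≤ ε' := by
    rw [eventually_all]
    intro a
    rw [eventually_all]
    intro b
    exact hr a b M
  -- σ M bounds the cost of t^m t_i ∂_i at cutoff M. That σ depends on M is harmless, because only r
  -- has to be uniform.
  have hev3 : ∀ᶠ σ in 𝓝[>] (0 : ℝ), σ * M < ε := by
    have : Tendsto (fun r : ℝ => r * M) (𝓝[>] 0) (𝓝 0) := by
      have h : Continuous fun r : ℝ => r * (M : ℝ) := by fun_prop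
      simpa using (h.tendsto 0).mono_left nhdsWithin_le_nhds
    exact this.eventually_lt_const hε
  obtain ⟨σ, ⟨hσN, hσM⟩, hσ1⟩ := ((hev2.and hev3).and (Ioc_mem_nhdsGT one_pos)).exists
  have hσ0 : 0 < σ := hσ1.1
  have hW := isWeight_cutWeight (S := S) hr0.le hσ0.le M
  refine ⟨σ, hσ0, B, fun k => (truncNorm_le_matTruncNorm hW k Y a b).trans ?_⟩
  refine hB (fun k => matTruncNorm (cutWeight S r σ M) k Y) (fun k => matTruncNorm_nonneg hW k Y)
    ?_ (fun k => ?_) k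
  · simp [matTruncNorm, truncNorm_degree_zero, hY0]
  · set W := cutWeight S r σ M with hWdef
    set y := matTruncNorm W k Y with hy
    have hy0 : 0 ≤ y := matTruncNorm_nonneg hW k Y
    have hN1 : matTruncNorm W (k + 1) N' ≤ ε := by
      calc matTruncNorm W (k + 1) N' ≤ ∑ _a : ι, ∑ _b : ι, ε' :=
            Finset.sum_le_sum fun a _ => Finset.sum_le_sum fun b _ => hσN a b (k + 1)
        _ = (Fintype.card ι * Fintype.card ι : ℝ) * ε' := by
            simp only [Finset.sum_const, Finset.card_univ, nsmul_eq_mul]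
            ring
        _ ≤ (Fintype.card ι * Fintype.card ι + 1 : ℝ) * ε' := by gcongr; simp
        _ = ε := by rw [hε']; field_simp
    have hN10 := matTruncNorm_nonneg hW (k + 1) N'
    have hPk : matTruncNorm W k P ≤ cp + y := by
      rw [hPY]
      exact (matTruncNorm_add_le hW k _ _).trans (by gcongr; exact matTruncNorm_C_le hW k p)
    have hPk0 := matTruncNorm_nonneg hW k P
    have hYY : matTruncNorm W (k + 1) (Y * Y) ≤ y * y :=
      matTruncNorm_mul_le_of hW fun a b c => truncNorm_succ_mul_le hW k (hY0 a b) (hY0 b c)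
    have hNP : matTruncNorm W (k + 1) (N' * P) ≤ ε * (cp + y) :=
      (matTruncNorm_mul_le_of hW fun a b c =>
        truncNorm_succ_mul_le_left hW k (hN0 a b) (P b c)).trans (by gcongr)
    have hPN' : matTruncNorm W (k + 1) (P * N') ≤ (cp + y) * ε :=
      (matTruncNorm_mul_le_of hW fun a b c =>
        truncNorm_succ_mul_le_right hW k (P a b) (hN0 b c)).trans (by gcongr)
    have hDk : matTruncNorm W (k + 1) D ≤ ε * y := by
      rw [hy, matTruncNorm, matTruncNorm, Finset.mul_sum]
      refine Finset.sum_le_sum fun a _ => ?_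
      rw [Finset.mul_sum]
      refine Finset.sum_le_sum fun b _ => ?_
      have hPYd : MvPowerSeries.pderiv ℂ i (P a b) = MvPowerSeries.pderiv ℂ i (Y a b) := by
        simp [hY, hpC]
      rw [hD, Matrix.map_apply, hPYd]
      have h1 := truncNorm_succ_mul_le_left hW k (constantCoeff_monomial_eq_zero hm0)
        (MvPowerSeries.X i * MvPowerSeries.pderiv ℂ i (Y a b))
      have h2 := truncNorm_monomial_le hi hm hr0.le hr1.2 hσ0.le hσ1.2 M (k + 1)
      have h3 := truncNorm_X_mul_pderiv_le hi hr0.le hσ0.le M k (Y a b)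
      have h4 := truncNorm_nonneg hW k (Y a b)
      calc _ ≤ _ := h1
        _ ≤ σ * (M * truncNorm W k (Y a b)) := by
            gcongr
            exact truncNorm_nonneg hW k _
        _ = (σ * M) * truncNorm W k (Y a b) := by ring
        _ ≤ _ := by gcongr
    have hRk : matTruncNorm W (k + 1) R ≤
        y * y + 2 * cp * (ε * (cp + y) + (cp + y) * ε) + 2 * cp * (ε * y) := by
      have h1 := matTruncNorm_sub_le hW (k + 1)
        (Y * Y - (pC * (N' * P - P * N') - (N' * P - P * N') * pC)) (pC * D - D * pC)
      have h2 := matTruncNorm_sub_le hW (k + 1) (Y * Y)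
        (pC * (N' * P - P * N') - (N' * P - P * N') * pC)
      have h3 := matTruncNorm_commutator_C_le hW (k + 1) p (N' * P - P * N')
      have h4 := matTruncNorm_commutator_C_le hW (k + 1) p D
      have h5 := matTruncNorm_sub_le hW (k + 1) (N' * P) (P * N')
      have h6 : 2 * cp * matTruncNorm W (k + 1) (N' * P - P * N') ≤
          2 * cp * (ε * (cp + y) + (cp + y) * ε) := by
        gcongr
        linarith
      have h7 : 2 * cp * matTruncNorm W (k + 1) D ≤ 2 * cp * (ε * y) := by gcongr
      linarith
    refine (hbound hW (k + 1)).trans ((mul_le_mul_of_nonneg_left hRk hc0.le).trans ?_)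
    have e1 : 0 ≤ c * (4 * cp ^ 2 + 6 * cp) * y ^ 2 := by positivity
    have e2 : 0 ≤ c * (1 + 6 * cp) * ε := by positivity
    have e3 : 0 ≤ c * (1 + 4 * cp ^ 2) * (ε * y) := by positivity
    have e4 : 0 ≤ y ^ 2 + ε * (1 + y) := by positivity
    rw [hK]
    nlinarith

end Core

end GoodLattice

namespace GoodLattice

/-! ### Elements with poles along the divisor -/

section Mero

variable {n : ℕ} {L : Finset (Fin n)}

/-- The inclusion of `ℂ⟦t⟧` in `ℂ⟦t⟧(*D)`. -/
noncomputable abbrev toMero (L : Finset (Fin n)) : MvPowerSeries (Fin n) ℂ →+* FormalMero L :=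
  algebraMap (MvPowerSeries (Fin n) ℂ) (FormalMero L)

/-- The monomial `t^m`. -/
noncomputable abbrev mono {n : ℕ} (m : Fin n →₀ ℕ) : MvPowerSeries (Fin n) ℂ :=
  MvPowerSeries.monomial m 1

lemma mono_add (a b : Fin n →₀ ℕ) : mono (a + b) = mono a * mono b := by
  rw [MvPowerSeries.monomial_mul_monomial, one_mul]

lemma mono_ne_zero (m : Fin n →₀ ℕ) : mono m ≠ 0 := fun h => by
  have := congrArg (MvPowerSeries.coeff m) h
  simp at this

lemma divEq_pow (J : Finset (Fin n)) (N : ℕ) :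
    divEq J ^ N = mono (∑ i ∈ J, Finsupp.single i N) := by
  classical
  unfold divEq
  induction J using Finset.induction_on with
  | empty => simp [mono]
  | insert a s ha ih =>
    rw [Finset.prod_insert ha, Finset.sum_insert ha, mul_pow, ih, mono_add,
      MvPowerSeries.X_pow_eq]

lemma sum_single_apply (J : Finset (Fin n)) (N : ℕ) (i : Fin n) :
    (∑ j ∈ J, Finsupp.single j N) i = if i ∈ J then N else 0 := by
  classical
  simp [Finsupp.finsetSum_apply, Finsupp.single_apply]

lemma divEq_ne_zero (J : Finset (Fin n)) : divEq J ≠ 0 := by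
  have := mono_ne_zero (∑ i ∈ J, Finsupp.single i 1)
  rwa [← divEq_pow, pow_one] at this

lemma powers_divEq_le (L : Finset (Fin n)) :
    Submonoid.powers (divEq L) ≤ nonZeroDivisors (MvPowerSeries (Fin n) ℂ) :=
  powers_le_nonZeroDivisors_of_noZeroDivisors (divEq_ne_zero L)

instance (L : Finset (Fin n)) : IsDomain (FormalMero L) :=
  have := NoZeroDivisors.to_isDomain (MvPowerSeries (Fin n) ℂ)
  IsLocalization.isDomain_of_le_nonZeroDivisors _ (powers_divEq_le L)

lemma toMero_injective (L : Finset (Fin n)) : Function.Injective (toMero L) :=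
  IsLocalization.injective _ (powers_divEq_le L)

lemma toMero_mono_ne_zero (m : Fin n →₀ ℕ) : toMero L (mono m) ≠ 0 := fun h =>
  mono_ne_zero m (toMero_injective L (by rw [h, map_zero]))

lemma mono_mem_germs (S : Set (Fin n)) (m : Fin n →₀ ℕ) : mono m ∈ germs S := by
  classical
  refine ⟨1, one_pos, fun N => summable_of_ne_finset_zero (s := {m}) fun d hd => ?_⟩
  have hd' : d ≠ m := by simpa using hd
  simp [weight, Set.indicator_apply, MvPowerSeries.coeff_monomial, hd']

lemma X_mem_germs (S : Set (Fin n)) (i : Fin n) : (MvPowerSeries.X i) ∈ germs S :=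
  mono_mem_germs S _

lemma germs_mono {S S' : Set (Fin n)} (h : S ⊆ S') : germs S ≤ germs S' :=
  fun _ hf => IsGermAlong.mono h hf

lemma mem_germs_univ (f : MvPowerSeries (Fin n) ℂ) : f ∈ germs (Set.univ : Set (Fin n)) := by
  refine ⟨1, one_pos, fun N => summable_of_ne_finset_zero
    (s := (Finsupp.finite_of_degree_le (σ := Fin n) (n * N)).toFinset) fun d hd => ?_⟩
  refine weight_of_notMem f fun h => hd ?_
  simp only [Set.Finite.mem_toFinset, Set.mem_ofPred_eq]
  rw [Finsupp.degree_eq_sum]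
  refine (Finset.sum_le_card_nsmul _ _ N fun i _ => h i (Set.mem_univ i)).trans ?_
  simp

lemma mem_mero_iff {S : Set (Fin n)} {J : Finset (Fin n)} {f : FormalMero L} :
    f ∈ mero L S J ↔ ∃ m : Fin n →₀ ℕ, m.support ⊆ J ∧ ∃ g ∈ germs S,
      toMero L (mono m) * f = toMero L g := by
  constructor
  · rintro ⟨N, g, hg, h⟩
    refine ⟨∑ i ∈ J, Finsupp.single i N, fun i hi => ?_, g, hg, ?_⟩
    · rw [Finsupp.mem_support_iff, sum_single_apply] at hi
      by_contra hiJ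
      exact hi (if_neg hiJ)
    · rw [← divEq_pow, map_pow]
      exact h
  · rintro ⟨m, hm, g, hg, h⟩
    refine ⟨m.degree, mono (∑ i ∈ J, Finsupp.single i m.degree - m) * g,
      mul_mem (mono_mem_germs S _) hg, ?_⟩
    have hle : m ≤ ∑ i ∈ J, Finsupp.single i m.degree := fun i => by
      rw [sum_single_apply]
      split_ifs with hi
      · exact Finsupp.le_degree i m
      · exact (Finsupp.notMem_support_iff.1 fun h => hi (hm h)).le
    rw [← map_pow, divEq_pow, map_mul, ← h, ← mul_assoc, ← map_mul, ← mono_add,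
      tsub_add_cancel_of_le hle]

lemma toMero_mem_mero {S : Set (Fin n)} (J : Finset (Fin n)) {g : MvPowerSeries (Fin n) ℂ}
    (hg : g ∈ germs S) : toMero L g ∈ mero L S J :=
  mem_mero_iff.2 ⟨0, by simp, g, hg, by simp [mono]⟩

lemma mem_germs_of_toMero_mem_mero {S : Set (Fin n)} {J : Finset (Fin n)}
    {g : MvPowerSeries (Fin n) ℂ} (h : toMero L g ∈ mero L S J) : g ∈ germs S := by
  obtain ⟨m, -, h', hh', h⟩ := mem_mero_iff.1 h
  rw [← map_mul] at h
  exact mem_germs_of_monomial_mul_mem (m := m) (by rw [toMero_injective L h]; exact hh')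

/-- Position of the poles and convergence can be tested separately: comparing the two presentations
gives t^m' g = t^m g' with g' convergent outside S, and division by a monomial preserves
convergence. -/
lemma mem_mero_of_mem_mero_univ {S : Set (Fin n)} {J J' : Finset (Fin n)} {f : FormalMero L}
    (h : f ∈ mero L Set.univ J) (h' : f ∈ mero L S J') : f ∈ mero L S J := by
  obtain ⟨m, hm, g, -, hg⟩ := mem_mero_iff.1 h
  obtain ⟨m', -, g', hg', hf⟩ := mem_mero_iff.1 h'
  refine mem_mero_iff.2 ⟨m, hm, g, ?_, hg⟩
  have : mono m' * g = mono m * g' := toMero_injective L (by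
    rw [map_mul, map_mul, ← hg, ← hf]; ring)
  exact mem_germs_of_monomial_mul_mem (m := m')
    (by rw [this]; exact mul_mem (mono_mem_germs S _) hg')

lemma mem_mero_univ (f : FormalMero L) : f ∈ mero L Set.univ L := by
  obtain ⟨N, a, h⟩ := IsLocalization.Away.surj (divEq L) f
  exact ⟨N, a, mem_germs_univ a, by rw [mul_comm, h]⟩

lemma mem_mero_univ_empty {f : FormalMero L} :
    f ∈ mero L Set.univ ∅ ↔ ∃ g, toMero L g = f := by
  constructor
  · intro h
    obtain ⟨m, hm, g, -, hg⟩ := mem_mero_iff.1 h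
    have : m = 0 := by simpa using hm
    subst this
    exact ⟨g, by rw [← hg]; simp [mono]⟩
  · rintro ⟨g, rfl⟩
    exact toMero_mem_mero _ (mem_germs_univ g)

lemma toMero_mem_mero_univ (J : Finset (Fin n)) (g : MvPowerSeries (Fin n) ℂ) :
    toMero L g ∈ mero L Set.univ J := toMero_mem_mero J (mem_germs_univ g)

lemma pd_mem_mero {S : Set (Fin n)} {J : Finset (Fin n)} (i : Fin n) {f : FormalMero L}
    (h : f ∈ mero L S J) : pd L i f ∈ mero L S J := by
  obtain ⟨m, hm, g, hg, h⟩ := mem_mero_iff.1 h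
  refine mem_mero_iff.2 ⟨m + m, fun j hj => hm ?_,
    mono m * MvPowerSeries.pderiv ℂ i g - MvPowerSeries.pderiv ℂ i (mono m) * g,
    sub_mem (mul_mem (mono_mem_germs S _) (pderiv_mem_germs i hg))
      (mul_mem (pderiv_mem_germs i (mono_mem_germs S _)) hg), ?_⟩
  · rw [Finsupp.mem_support_iff, Finsupp.add_apply] at hj
    rw [Finsupp.mem_support_iff]
    omega
  · have h1 := congrArg (pd L i) h
    rw [Derivation.leibniz, pd_algebraMap, pd_algebraMap, smul_eq_mul, smul_eq_mul] at h1
    rw [map_sub, map_mul, map_mul, ← h, ← h1, mono_add, map_mul]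
    ring

lemma logCoord_mem_mero (S : Set (Fin n)) (J : Finset (Fin n)) (i : Fin n) :
    MeroConnection.logCoord L i ∈ mero L S J := by
  refine toMero_mem_mero J ?_
  split_ifs
  · exact X_mem_germs S i
  · exact one_mem _

lemma logCoord_of_mem {i : Fin n} (hi : i ∈ L) :
    MeroConnection.logCoord L i = toMero L (MvPowerSeries.X i) := by
  rw [MeroConnection.logCoord, if_pos hi]

end Mero

end GoodLattice

namespace GoodLattice

open MeroConnection

/-! ### Idempotent matrices and the linearized splitting problem. -/

section Idempotents

variable {ι κ : Type*} [Fintype ι] [DecidableEq ι]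

/-- A complex idempotent matrix of trace zero vanishes. -/
lemma trace_ne_zero_of_idempotent {Q : Matrix ι ι ℂ} (h : Q * Q = Q) (h0 : Q ≠ 0) :
    Q.trace ≠ 0 := by
  intro ht
  apply h0
  have h1 : IsIdempotentElem (Matrix.toLin' Q) := by
    rw [IsIdempotentElem, Module.End.mul_eq_comp, ← Matrix.toLin'_mul, h]
  have h2 := (LinearMap.IsIdempotentElem.trace_eq_zero_iff h1).1
    (by rw [Matrix.trace_toLin'_eq, ht])
  exact (LinearEquiv.map_eq_zero_iff _).1 h2

/-- A nonzero idempotent matrix of power series is nonzero at the origin. -/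
lemma map_constantCoeff_ne_zero_of_idempotent {n : ℕ}
    {P : Matrix ι ι (MvPowerSeries (Fin n) ℂ)} (h : P * P = P) (h0 : P ≠ 0) :
    P.map (MvPowerSeries.constantCoeff (R := ℂ)) ≠ 0 := by
  intro hc
  apply h0
  -- If P vanishes at the origin, then 1 - P is invertible there, hence invertible, and it
  -- annihilates P.
  have h1 : IsUnit (1 - P).det := by
    rw [MvPowerSeries.isUnit_iff_constantCoeff, RingHom.map_det, map_sub, map_one,
      RingHom.mapMatrix_apply, hc, sub_zero, Matrix.det_one]
    exact isUnit_one
  have h2 : (1 - P) * P = 0 := by rw [sub_mul, one_mul, h, sub_self]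
  exact ((Matrix.isUnit_iff_isUnit_det _).2 h1).mul_right_eq_zero.1 h2

/-- Traces of nonzero projectors are units of ℂ⟦t⟧, since at the origin the projector is still
nonzero. This permits division by the trace when averaging the connection over a summand. -/
lemma constantCoeff_trace_ne_zero_of_idempotent {n : ℕ}
    {P : Matrix ι ι (MvPowerSeries (Fin n) ℂ)} (h : P * P = P) (h0 : P ≠ 0) :
    MvPowerSeries.constantCoeff P.trace ≠ 0 := by
  have h1 : (P.map (MvPowerSeries.constantCoeff (R := ℂ))).trace ≠ 0 :=
    trace_ne_zero_of_idempotent (by rw [← Matrix.map_mul, h])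
      (map_constantCoeff_ne_zero_of_idempotent h h0)
  intro h2
  apply h1
  rw [← h2]
  simp [Matrix.trace]

variable {R : Type*} [Ring R]

lemma smul_sum_mul_of_orthogonal [Fintype κ] {A : Type*} [CommRing A] [Algebra A R] {P : κ → R}
    (h1 : ∀ a, P a * P a = P a) (h2 : ∀ a b, a ≠ b → P a * P b = 0) (μ : κ → A) (b : κ) :
    (∑ a, μ a • P a) * P b = μ b • P b := by
  rw [Finset.sum_mul, Finset.sum_eq_single_of_mem b (Finset.mem_univ b)
    fun a _ hab => by rw [smul_mul_assoc, h2 a b hab, smul_zero], smul_mul_assoc, h1]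

lemma mul_smul_sum_of_orthogonal [Fintype κ] {A : Type*} [CommRing A] [Algebra A R] {P : κ → R}
    (h1 : ∀ a, P a * P a = P a) (h2 : ∀ a b, a ≠ b → P a * P b = 0) (μ : κ → A) (b : κ) :
    P b * (∑ a, μ a • P a) = μ b • P b := by
  rw [Finset.mul_sum, Finset.sum_eq_single_of_mem b (Finset.mem_univ b)
    fun a _ hab => by rw [mul_smul_comm, h2 b a hab.symm, smul_zero], mul_smul_comm, h1]

variable [DecidableEq κ]

lemma sum_mul_of_orthogonal {P : κ → R} (h1 : ∀ a, P a * P a = P a)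
    (h2 : ∀ a b, a ≠ b → P a * P b = 0) (s : Finset κ) (b : κ) :
    (∑ a ∈ s, P a) * P b = if b ∈ s then P b else 0 := by
  rw [Finset.sum_mul]
  split_ifs with h
  · rw [Finset.sum_eq_single_of_mem b h fun a _ hab => h2 a b hab, h1]
  · exact Finset.sum_eq_zero fun a ha => h2 a b fun hab => h (hab ▸ ha)

lemma mul_sum_of_orthogonal {P : κ → R} (h1 : ∀ a, P a * P a = P a)
    (h2 : ∀ a b, a ≠ b → P a * P b = 0) (s : Finset κ) (b : κ) :
    P b * (∑ a ∈ s, P a) = if b ∈ s then P b else 0 := by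
  rw [Finset.mul_sum]
  split_ifs with h
  · rw [Finset.sum_eq_single_of_mem b h fun a _ hab => h2 b a hab.symm, h1]
  · exact Finset.sum_eq_zero fun a ha => h2 b a fun hab => h (hab ▸ ha)

lemma sum_mul_sum_of_orthogonal {P : κ → R} (h1 : ∀ a, P a * P a = P a)
    (h2 : ∀ a b, a ≠ b → P a * P b = 0) (s s' : Finset κ) :
    (∑ a ∈ s, P a) * (∑ a ∈ s', P a) = ∑ a ∈ s ∩ s', P a := by
  rw [Finset.mul_sum, Finset.inter_comm, ← Finset.sum_ite_mem]
  exact Finset.sum_congr rfl fun b _ => sum_mul_of_orthogonal h1 h2 s b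

/-- Injectivity of the split operator for a projector `p` onto a part of the eigenspaces of a
diagonalizable matrix `∑ μ_a Q_a`, if the eigenvalues on this part are different from the other
ones. -/
lemma eq_zero_of_splitOperator_eq_zero [Fintype κ] {Q : κ → Matrix ι ι ℂ}
    (h1 : ∀ a, Q a * Q a = Q a) (h2 : ∀ a b, a ≠ b → Q a * Q b = 0) (hsum : ∑ a, Q a = 1)
    {s : Finset κ} {μ : κ → ℂ} (hμ : ∀ a ∈ s, ∀ b ∉ s, μ a ≠ μ b) {Z : Matrix ι ι ℂ}
    (hZ : splitOperator (∑ a ∈ s, Q a) (∑ a, μ a • Q a) Z = 0) : Z = 0 := by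
  -- If a and b are both in s or both outside, the double commutator contributes nothing and the
  -- remaining part is -1 or 1 times the block. In a mixed block the remaining part cancels, and the
  -- double commutator multiplies by the difference of the eigenvalues, up to sign.
  have key : ∀ a b, Q a * Z * Q b = 0 := by
    intro a b
    have hl := mul_sum_of_orthogonal h1 h2 s a
    have hr := sum_mul_of_orthogonal h1 h2 s b
    have hml := mul_smul_sum_of_orthogonal h1 h2 μ a
    have hmr := smul_sum_mul_of_orthogonal h1 h2 μ b
    have e := congrArg (fun Y => Q a * Y * Q b) hZ
    simp only [splitOperator_apply, mul_zero, zero_mul] at e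
    set p := ∑ a ∈ s, Q a
    set q := ∑ a, μ a • Q a
    have e1 : Q a * (p * (q * Z - Z * q) - (q * Z - Z * q) * p + (Z - p * Z - Z * p)) * Q b =
        (Q a * p) * q * Z * Q b - (Q a * p) * Z * (q * Q b) - (Q a * q) * Z * (p * Q b) +
          Q a * Z * (q * (p * Q b)) + (Q a * Z * Q b - (Q a * p) * Z * Q b -
          Q a * Z * (p * Q b)) := by noncomm_ring
    rw [e1, hl, hr, hml, hmr] at e
    by_cases ha : a ∈ s <;> by_cases hb : b ∈ s
    · simp only [ha, hb, if_true, hml, hmr, smul_mul_assoc, mul_smul_comm] at e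
      rw [← neg_eq_zero, ← e]
      module
    · simp only [ha, hb, if_true, if_false, hml, smul_mul_assoc, mul_smul_comm, mul_zero] at e
      have e2 : (μ a - μ b) • (Q a * Z * Q b) = 0 := by
        rw [← e]
        module
      exact (smul_eq_zero.1 e2).resolve_left (sub_ne_zero.2 (hμ a ha b hb))
    · simp only [ha, hb, if_true, if_false, hmr, smul_mul_assoc, mul_smul_comm, zero_mul] at e
      have e2 : (μ b - μ a) • (Q a * Z * Q b) = 0 := by
        rw [← e]
        module
      exact (smul_eq_zero.1 e2).resolve_left (sub_ne_zero.2 (hμ b hb a ha))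
    · simpa only [ha, hb, if_false, mul_zero, zero_mul, zero_add, sub_zero] using e
  calc Z = (∑ a, Q a) * Z * (∑ b, Q b) := by rw [hsum, one_mul, mul_one]
    _ = ∑ a, ∑ b, Q a * Z * Q b := by
      rw [Finset.sum_mul, Finset.sum_mul]
      simp only [Finset.mul_sum]
    _ = 0 := by simp [key]

end Idempotents

end GoodLattice

namespace GoodLattice

open MeroConnection

/-! ### Formal splittings and the separation of one pole level. -/

section Splitting

lemma trace_mem_of_mem_matrix {ι R B : Type*} [Fintype ι] [CommRing R] [CommRing B] [Algebra R B]
    {S : Subalgebra R B} {M : Matrix ι ι B} (h : ∀ a b, M a b ∈ S) : M.trace ∈ S :=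
  sum_mem fun a _ => h a a

variable {n : ℕ} {L : Finset (Fin n)} {ι κ : Type*} [Fintype ι] [DecidableEq ι] [Fintype κ]

/-- The inclusion of matrices over `ℂ⟦t⟧` in matrices over `ℂ⟦t⟧(*D)`. -/
noncomputable abbrev toMeroMat (L : Finset (Fin n)) :
    Matrix ι ι (MvPowerSeries (Fin n) ℂ) →+* Matrix ι ι (FormalMero L) :=
  (toMero L).mapMatrix

lemma toMeroMat_injective (L : Finset (Fin n)) :
    Function.Injective (toMeroMat L : Matrix ι ι (MvPowerSeries (Fin n) ℂ) → _) := by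
  intro M M' h
  ext1 a b
  exact toMero_injective L (congrFun (congrFun h a) b)

lemma toMeroMat_smul (f : MvPowerSeries (Fin n) ℂ) (M : Matrix ι ι (MvPowerSeries (Fin n) ℂ)) :
    toMeroMat L (f • M) = toMero L f • toMeroMat L M := by
  ext1 a b
  simp

lemma trace_toMeroMat (M : Matrix ι ι (MvPowerSeries (Fin n) ℂ)) :
    (toMeroMat L M).trace = toMero L M.trace := by
  simp [Matrix.trace]

lemma toMeroMat_mem {S : Set (Fin n)}
    {M : Matrix ι ι (MvPowerSeries (Fin n) ℂ)} (h : ∀ a b, M a b ∈ germs S) (J : Finset (Fin n)) :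
    toMeroMat L M ∈ (mero L S J).matrix := fun a b => toMero_mem_mero J (h a b)

/-- A formal splitting of the connection with matrices `A i`: complete orthogonal horizontal
projectors `P φ`, on whose images the connection is `df_φ` plus logarithmic terms, such that the
differences of the exponential factors `f_φ` are purely monomial. -/
structure FormalSplitting (L : Finset (Fin n)) (A : Fin n → Matrix ι ι (FormalMero L))
    (f : κ → FormalMero L) (P : κ → Matrix ι ι (MvPowerSeries (Fin n) ℂ)) : Prop where
  conv : ∀ i, A i ∈ (mero L ∅ L).matrix
  ne_zero : ∀ φ, P φ ≠ 0
  mul_self : ∀ φ, P φ * P φ = P φ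
  orthogonal : ∀ φ ψ, φ ≠ ψ → P φ * P ψ = 0
  sum_eq_one : ∑ φ, P φ = 1
  horizontal : ∀ i φ, toMeroMat L ((P φ).map (MvPowerSeries.pderiv ℂ i)) =
    toMeroMat L (P φ) * A i - A i * toMeroMat L (P φ)
  logarithmic : ∀ i φ, ∃ R : Matrix ι ι (MvPowerSeries (Fin n) ℂ),
    logCoord L i • (toMeroMat L (P φ) * A i - pd L i (f φ) • toMeroMat L (P φ)) = toMeroMat L R
  good : ∀ φ ψ, φ ≠ ψ → ∃ m : Fin n →₀ ℕ, m ≠ 0 ∧ m.support ⊆ L ∧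
    ∃ u : MvPowerSeries (Fin n) ℂ, MvPowerSeries.constantCoeff u ≠ 0 ∧
      toMero L (mono m) * (f φ - f ψ) = toMero L u

/-- Multiplying a polar part by a monomial and differentiating. -/
lemma mono_mul_pd_eq {i : Fin n} {m : Fin n →₀ ℕ} {g : FormalMero L}
    {v : MvPowerSeries (Fin n) ℂ} (h : toMero L (mono m) * g = toMero L v) :
    toMero L (mono m) * (toMero L (MvPowerSeries.X i) * pd L i g) =
      toMero L (MvPowerSeries.X i * MvPowerSeries.pderiv ℂ i v - MvPowerSeries.C (m i : ℂ) * v) := by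
  have h1 := congrArg (pd L i) h
  rw [Derivation.leibniz, pd_algebraMap, pd_algebraMap, smul_eq_mul, smul_eq_mul] at h1
  have h2 : MvPowerSeries.X i * MvPowerSeries.pderiv ℂ i (mono m) =
      MvPowerSeries.C (m i : ℂ) * mono m := by
    classical
    ext d
    rw [coeff_X_mul_pderiv, MvPowerSeries.coeff_C_mul, MvPowerSeries.coeff_monomial]
    split_ifs with hd
    · rw [hd]
    · simp
  have h3 := congrArg (toMero L) h2
  rw [map_mul, map_mul] at h3
  rw [map_sub, map_mul, map_mul, ← h, ← h1]
  linear_combination (-g) * h3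

variable {A : Fin n → Matrix ι ι (FormalMero L)}
  {f : κ → FormalMero L} {P : κ → Matrix ι ι (MvPowerSeries (Fin n) ℂ)}

lemma FormalSplitting.horizontal_sum (H : FormalSplitting L A f P) (i : Fin n) (s : Finset κ) :
    toMeroMat L ((∑ ψ ∈ s, P ψ).map (MvPowerSeries.pderiv ℂ i)) =
      toMeroMat L (∑ ψ ∈ s, P ψ) * A i - A i * toMeroMat L (∑ ψ ∈ s, P ψ) := by
  have h : (∑ ψ ∈ s, P ψ).map (MvPowerSeries.pderiv ℂ i) =
      ∑ ψ ∈ s, (P ψ).map (MvPowerSeries.pderiv ℂ i) := by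
    ext1 a b
    simp [Matrix.sum_apply]
  rw [h, map_sum, map_sum, Finset.sum_mul, Finset.mul_sum, ← Finset.sum_sub_distrib]
  exact Finset.sum_congr rfl fun φ _ => H.horizontal i φ

/-- The trace of the connection on a sum of summands. -/
lemma FormalSplitting.exists_trace_eq (H : FormalSplitting L A f P) (i : Fin n) (s : Finset κ) :
    ∃ r : MvPowerSeries (Fin n) ℂ, logCoord L i * (toMeroMat L (∑ ψ ∈ s, P ψ) * A i).trace =
      ∑ ψ ∈ s, logCoord L i * pd L i (f ψ) * toMero L (P ψ).trace + toMero L r := by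
  choose R hR using H.logarithmic i
  refine ⟨∑ ψ ∈ s, (R ψ).trace, ?_⟩
  rw [map_sum, Finset.sum_mul, Matrix.trace_sum, Finset.mul_sum, map_sum,
    ← Finset.sum_add_distrib]
  refine Finset.sum_congr rfl fun ψ _ => ?_
  have h := congrArg Matrix.trace (hR ψ)
  rw [Matrix.trace_smul, Matrix.trace_sub, Matrix.trace_smul, trace_toMeroMat, trace_toMeroMat,
    smul_eq_mul, smul_eq_mul] at h
  rw [← h]
  ring

variable [DecidableEq κ]

lemma FormalSplitting.sum_ne_zero (H : FormalSplitting L A f P) {s : Finset κ} {φ : κ}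
    (hφ : φ ∈ s) : ∑ ψ ∈ s, P ψ ≠ 0 := by
  intro h
  have h1 := sum_mul_of_orthogonal H.mul_self H.orthogonal s φ
  rw [h, zero_mul, if_pos hφ] at h1
  exact H.ne_zero φ h1.symm

lemma FormalSplitting.constantCoeff_trace_ne_zero (H : FormalSplitting L A f P) {s : Finset κ}
    {φ : κ} (hφ : φ ∈ s) : MvPowerSeries.constantCoeff (∑ ψ ∈ s, P ψ).trace ≠ 0 :=
  constantCoeff_trace_ne_zero_of_idempotent
    (by rw [sum_mul_sum_of_orthogonal H.mul_self H.orthogonal, Finset.inter_self])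
    (H.sum_ne_zero hφ)

/-- The scalar part `tr (P_s A_i) / tr P_s` of the connection on a sum of summands. -/
noncomputable def scalarPart (A : Fin n → Matrix ι ι (FormalMero L))
    (P : κ → Matrix ι ι (MvPowerSeries (Fin n) ℂ)) (i : Fin n) (s : Finset κ) : FormalMero L :=
  toMero L ((∑ ψ ∈ s, P ψ).trace)⁻¹ * (logCoord L i * (toMeroMat L (∑ ψ ∈ s, P ψ) * A i).trace)

/-- Only the convergent matrix of the connection and the sum of projectors enter, so convergence of
the sum suffices and nothing is needed about the individual exponential factors. -/
lemma FormalSplitting.scalarPart_mem (H : FormalSplitting L A f P) {S : Set (Fin n)} (i : Fin n)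
    {s : Finset κ} {φ : κ} (hφ : φ ∈ s) (hs : ∀ a b, (∑ ψ ∈ s, P ψ) a b ∈ germs S) :
    scalarPart A P i s ∈ mero L S L := by
  refine mul_mem (toMero_mem_mero _ (inv_mem_germs (trace_mem_of_mem_matrix hs)
    (H.constantCoeff_trace_ne_zero hφ))) (mul_mem (logCoord_mem_mero S L i) ?_)
  have h : toMeroMat L (∑ ψ ∈ s, P ψ) * A i ∈ (mero L S L).matrix :=
    mul_mem (toMeroMat_mem hs L)
      fun a b => mero_mono L (Set.empty_subset S) subset_rfl (H.conv i a b)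
  exact trace_mem_of_mem_matrix h

lemma FormalSplitting.trace_mul_scalarPart (H : FormalSplitting L A f P) (i : Fin n)
    {s : Finset κ} {φ : κ} (hφ : φ ∈ s) :
    toMero L (∑ ψ ∈ s, P ψ).trace * scalarPart A P i s =
      logCoord L i * (toMeroMat L (∑ ψ ∈ s, P ψ) * A i).trace := by
  rw [scalarPart, ← mul_assoc, ← map_mul,
    MvPowerSeries.mul_inv_cancel _ (H.constantCoeff_trace_ne_zero hφ), map_one, one_mul]

/-- One step of the splitting: if the projector on the sum of the summands in `s` is formal in `t_i`
only, and the polar parts `f_φ - f_φ₀`, `φ ∈ s`, have the common denominator `t^m` with `m_i > 0`,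
then also the projector on the sum of the summands where `t^m (f_φ - f_φ₀)` vanishes at the origin
is formal in `t_i` only. -/
theorem FormalSplitting.mem_germs_of_level (H : FormalSplitting L A f P) {i : Fin n} (hi : i ∈ L)
    {s : Finset κ} (hs : ∀ a b, (∑ ψ ∈ s, P ψ) a b ∈ germs {i}) {φ₀ : κ} (hφ₀ : φ₀ ∈ s)
    {m : Fin n →₀ ℕ} (hm : m i ≠ 0) {v : κ → MvPowerSeries (Fin n) ℂ}
    (hv : ∀ φ ∈ s, toMero L (mono m) * (f φ - f φ₀) = toMero L (v φ)) (a b : ι) :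
    (∑ ψ ∈ s.filter fun φ => MvPowerSeries.constantCoeff (v φ) = 0, P ψ) a b ∈ germs {i} := by
  have hm0 : m ≠ 0 := fun h => hm (by simp [h])
  have hlog := logCoord_of_mem hi
  choose R hR using H.logarithmic i
  set s' := s.filter fun φ => MvPowerSeries.constantCoeff (v φ) = 0 with hs'
  have hs's : s' ⊆ s := Finset.filter_subset _ _
  set e := ∑ ψ ∈ s, P ψ with he
  set e' := ∑ ψ ∈ s', P ψ with he'
  have hee : e * e = e := by
    rw [he, sum_mul_sum_of_orthogonal H.mul_self H.orthogonal, Finset.inter_self]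
  have hee' : e * e' = e' := by
    rw [he, he', sum_mul_sum_of_orthogonal H.mul_self H.orthogonal,
      Finset.inter_eq_right.2 hs's]
  have he'e : e' * e = e' := by
    rw [he, he', sum_mul_sum_of_orthogonal H.mul_self H.orthogonal,
      Finset.inter_eq_left.2 hs's]
  have he'e' : e' * e' = e' := by
    rw [he', sum_mul_sum_of_orthogonal H.mul_self H.orthogonal, Finset.inter_self]
  set B := logCoord L i • A i with hB
  set σ := scalarPart A P i s with hσ
  -- This is t^m t_i ∂_i (f_φ - f_φ₀) for φ in s. Its value at the origin is -m_i v_φ(0), so m_i ≠ 0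
  -- makes it detect whether v_φ(0) vanishes.
  set θ : κ → MvPowerSeries (Fin n) ℂ := fun φ =>
    MvPowerSeries.X i * MvPowerSeries.pderiv ℂ i (v φ) - MvPowerSeries.C (m i : ℂ) * v φ with hθ
  have hθf : ∀ φ ∈ s, toMero L (mono m) * (logCoord L i * pd L i (f φ)) =
      toMero L (θ φ) + toMero L (mono m) * (logCoord L i * pd L i (f φ₀)) := by
    intro φ hφ
    rw [hlog, hθ, ← mono_mul_pd_eq (hv φ hφ), map_sub]
    ring
  -- the scalar part agrees with the one of the summand `φ₀` up to `t^(-m) q`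
  obtain ⟨q, hq⟩ : ∃ q : MvPowerSeries (Fin n) ℂ,
      toMero L (mono m) * (σ - logCoord L i * pd L i (f φ₀)) = toMero L q := by
    obtain ⟨r, hr⟩ := H.exists_trace_eq i s
    refine ⟨e.trace⁻¹ * (∑ ψ ∈ s, θ ψ * (P ψ).trace + mono m * r), ?_⟩
    have hc : MvPowerSeries.constantCoeff e.trace ≠ 0 := H.constantCoeff_trace_ne_zero hφ₀
    have hne : toMero L e.trace ≠ 0 := fun h => hc (by
      rw [toMero_injective L (h.trans (map_zero _).symm), map_zero])
    apply mul_left_cancel₀ hne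
    rw [← map_mul, ← mul_assoc e.trace, MvPowerSeries.mul_inv_cancel _ hc, one_mul]
    have h1 := H.trace_mul_scalarPart i hφ₀
    rw [hr] at h1
    have h2 : toMero L e.trace = ∑ ψ ∈ s, toMero L (P ψ).trace := by
      rw [he, Matrix.trace_sum, map_sum]
    have h3 : ∑ ψ ∈ s, toMero L (mono m) * (logCoord L i * pd L i (f ψ) * toMero L (P ψ).trace) =
        ∑ ψ ∈ s, toMero L (θ ψ) * toMero L (P ψ).trace +
          toMero L (mono m) * (logCoord L i * pd L i (f φ₀)) * toMero L e.trace := by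
      rw [h2, Finset.mul_sum, ← Finset.sum_add_distrib]
      refine Finset.sum_congr rfl fun ψ hψ => ?_
      rw [← add_mul, ← hθf ψ hψ]
      ring
    rw [map_add, map_sum, map_mul]
    simp only [map_mul]
    rw [← Finset.mul_sum] at h3
    linear_combination toMero L (mono m) * h1 + h3
  have hσf : ∀ φ ∈ s, toMero L (mono m) * (logCoord L i * pd L i (f φ) - σ) =
      toMero L (θ φ - q) := by
    intro φ hφ
    rw [map_sub (toMero L) (θ φ) q]
    linear_combination hθf φ hφ - hq
  set xd : Matrix ι ι (MvPowerSeries (Fin n) ℂ) → Matrix ι ι (MvPowerSeries (Fin n) ℂ) :=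
    fun M => (MvPowerSeries.X i : MvPowerSeries (Fin n) ℂ) •
      (M.map (MvPowerSeries.pderiv ℂ i) : Matrix ι ι (MvPowerSeries (Fin n) ℂ)) with hxd
  have hor : ∀ u : Finset κ, toMeroMat L (xd (∑ ψ ∈ u, P ψ)) =
      toMeroMat L (∑ ψ ∈ u, P ψ) * B - B * toMeroMat L (∑ ψ ∈ u, P ψ) := by
    intro u
    rw [hxd, toMeroMat_smul, H.horizontal_sum, hB, hlog, smul_sub, mul_smul_comm, smul_mul_assoc]
  clear_value B
  set q₀ := MvPowerSeries.constantCoeff q with hq₀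
  -- On the summands in s the value N(0) has eigenvalues -m_i v_φ(0) - q₀, equal to -q₀ exactly on
  -- s'. The value 1 - q₀ on the complement of s keeps it apart from -q₀ as well.
  set c : ℂ := 1 - q₀ with hc
  -- This form shows that N has no pole. In the form `hTN`, t^m (eB + Be - eBe - σe) + c (1 - e),
  -- all ingredients are formal in t_i only. Since e need not commute with B, the combination eB +
  -- Be - eBe is used: multiplied by e' from the left it gives e'B, from the right Be'. Thus [e', N]
  -- = t^m [e', B].
  set N : Matrix ι ι (MvPowerSeries (Fin n) ℂ) :=
    ∑ ψ ∈ s, ((θ ψ - q) • P ψ + mono m • R ψ) - mono m • ((1 - e) * xd e) +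
      (MvPowerSeries.C c : MvPowerSeries (Fin n) ℂ) • (1 - e) with hN
  set Te := toMeroMat L e with hTe
  have hTee : Te * Te = Te := by rw [hTe, ← map_mul, hee]
  have hTN : toMeroMat L N = toMero L (mono m) • (Te * B + B * Te - Te * B * Te - σ • Te) +
      toMero L (MvPowerSeries.C c) • (1 - Te) := by
    have h1 : ∑ ψ ∈ s, toMeroMat L ((θ ψ - q) • P ψ + mono m • R ψ) =
        toMero L (mono m) • (Te * B - σ • Te) := by
      have h2 : Te * B - σ • Te = ∑ ψ ∈ s, (toMeroMat L (P ψ) * B - σ • toMeroMat L (P ψ)) := by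
        rw [Finset.sum_sub_distrib, ← Finset.smul_sum, ← Finset.sum_mul, ← map_sum]
      rw [h2, Finset.smul_sum]
      refine Finset.sum_congr rfl fun ψ hψ => ?_
      rw [map_add, toMeroMat_smul, toMeroMat_smul, ← hR ψ, ← hσf ψ hψ, hB, mul_smul_comm]
      simp only [smul_sub, smul_smul, mul_sub, sub_smul]
      abel
    have h2 : Te * B + B * Te - Te * B * Te - σ • Te =
        (Te * B - σ • Te) - (1 - Te) * toMeroMat L (xd e) := by
      rw [he, hor s, ← he, ← hTe]
      have : (1 - Te) * (Te * B - B * Te) = Te * B - B * Te - Te * Te * B + Te * B * Te := by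
        noncomm_ring
      rw [this, hTee]
      abel
    rw [hN, map_add, map_sub, map_sum, h1, h2, toMeroMat_smul, toMeroMat_smul, map_mul, map_sub,
      map_one, ← hTe, smul_sub _ (Te * B - σ • Te)]
  have hNgerm : ∀ a b, N a b ∈ germs {i} := by
    intro a b
    apply mem_germs_of_toMero_mem_mero (L := L) (J := L)
    have hTm : Te ∈ (mero L {i} L).matrix := toMeroMat_mem hs L
    have hsm : ∀ (g : FormalMero L) (M : Matrix ι ι (FormalMero L)), g ∈ mero L {i} L →
        M ∈ (mero L {i} L).matrix → g • M ∈ (mero L {i} L).matrix :=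
      fun g M hg hM a b => (mero L {i} L).mul_mem hg (hM a b)
    have hBm : B ∈ (mero L {i} L).matrix := by
      rw [hB]
      exact hsm _ _ (logCoord_mem_mero _ _ i)
        fun a b => mero_mono L (Set.empty_subset _) subset_rfl (H.conv i a b)
    have hσT := hsm _ _ (H.scalarPart_mem i hφ₀ hs) hTm
    have h2 : Te * B + B * Te - Te * B * Te - σ • Te ∈ (mero L {i} L).matrix :=
      Subalgebra.sub_mem _ (Subalgebra.sub_mem _ (Subalgebra.add_mem _
        (Subalgebra.mul_mem _ hTm hBm) (Subalgebra.mul_mem _ hBm hTm))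
        (Subalgebra.mul_mem _ (Subalgebra.mul_mem _ hTm hBm) hTm)) hσT
    have h3 : 1 - Te ∈ (mero L {i} L).matrix := Subalgebra.sub_mem _ (Subalgebra.one_mem _) hTm
    have h1 : toMeroMat L N ∈ (mero L {i} L).matrix := by
      rw [hTN]
      exact Subalgebra.add_mem _ (hsm _ _ (toMero_mem_mero _ (mono_mem_germs _ m)) h2)
        (hsm _ _ (toMero_mem_mero _ ((germs _).algebraMap_mem c)) h3)
    exact h1 a b
  refine mem_germs_of_horizontal_idempotent (S := {i}) (Set.mem_singleton i) hm hNgerm he'e' ?_ ?_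
    a b
  · have h1 : e'.map (fun f => MvPowerSeries.monomial m 1 *
        (MvPowerSeries.X i * MvPowerSeries.pderiv ℂ i f)) = mono m • xd e' := by
      ext1 a b
      simp [hxd]
    apply toMeroMat_injective L
    rw [h1, toMeroMat_smul, he', hor s', ← he', map_sub, map_mul, map_mul, hTN]
    set Te' := toMeroMat L e' with hTe'
    have h2 : Te' * Te = Te' := by rw [hTe, hTe', ← map_mul, he'e]
    have h3 : Te * Te' = Te' := by rw [hTe, hTe', ← map_mul, hee']
    have h4 : Te' * (Te * B + B * Te - Te * B * Te - σ • Te) = Te' * B - σ • Te' := by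
      rw [mul_sub, mul_sub, mul_add, ← mul_assoc, ← mul_assoc, ← mul_assoc, ← mul_assoc, h2,
        mul_smul_comm, h2]
      abel
    have h5 : (Te * B + B * Te - Te * B * Te - σ • Te) * Te' = B * Te' - σ • Te' := by
      rw [sub_mul, sub_mul, add_mul, mul_assoc B, mul_assoc (Te * B), h3, smul_mul_assoc, h3]
      abel
    rw [mul_add, add_mul, mul_smul_comm, mul_smul_comm, smul_mul_assoc, smul_mul_assoc, h4, h5,
      mul_sub, sub_mul, mul_one, one_mul, h2, h3, sub_self]
    simp only [smul_sub, smul_zero]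
    abel
  · set ev := (MvPowerSeries.constantCoeff (σ := Fin n) (R := ℂ)).mapMatrix (m := ι) with hev
    have hsum1 : ∑ φ, ev (P φ) = 1 := by rw [← map_sum, H.sum_eq_one, map_one]
    have hsmul : ∀ (g : MvPowerSeries (Fin n) ℂ) (M : Matrix ι ι (MvPowerSeries (Fin n) ℂ)),
        ev (g • M) = MvPowerSeries.constantCoeff g • ev M := fun g M => by
      ext1 a b
      simp [hev]
    set μ : κ → ℂ := fun φ => if φ ∈ s then -(m i : ℂ) * MvPowerSeries.constantCoeff (v φ) - q₀
      else 1 - q₀ with hμ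
    have hNμ : ev N = ∑ φ, μ φ • ev (P φ) := by
      have h1 : 1 - e = ∑ ψ ∈ sᶜ, P ψ := by
        rw [← H.sum_eq_one, he, ← Finset.sum_compl_add_sum s, add_sub_cancel_right]
      rw [hN, map_add, map_sub, map_sum, hsmul, hsmul, constantCoeff_monomial_eq_zero hm0,
        zero_smul, sub_zero, h1, map_sum, ← Finset.sum_add_sum_compl s, Finset.smul_sum]
      congr 1
      · refine Finset.sum_congr rfl fun ψ hψ => ?_
        rw [map_add, hsmul, hsmul, constantCoeff_monomial_eq_zero hm0, zero_smul, add_zero, hμ]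
        simp [hθ, hψ, hq₀]
      · refine Finset.sum_congr rfl fun ψ hψ => ?_
        simp [hμ, Finset.mem_compl.1 hψ, hc]
    have hpe : e'.map (MvPowerSeries.constantCoeff (R := ℂ)) = ∑ φ ∈ s', ev (P φ) := by
      rw [← map_sum]
      rfl
    intro Z hZ
    rw [hpe, show N.map (MvPowerSeries.constantCoeff (R := ℂ)) = ev N from rfl, hNμ] at hZ
    refine eq_zero_of_splitOperator_eq_zero (fun φ => ?_) (fun φ ψ h => ?_) hsum1 ?_ hZ
    · rw [← map_mul, H.mul_self]
    · rw [← map_mul, H.orthogonal φ ψ h, map_zero]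
    · intro φ hφ ψ hψ h
      obtain ⟨hφs, hφ0⟩ := Finset.mem_filter.1 hφ
      simp only [hμ, hφs, if_true, hφ0] at h
      split_ifs at h with hψs
      · have : MvPowerSeries.constantCoeff (v ψ) = 0 := by
          have h' : (m i : ℂ) * MvPowerSeries.constantCoeff (v ψ) = 0 := by linear_combination h
          exact (mul_eq_zero.1 h').resolve_left (by exact_mod_cast hm)
        exact hψ (Finset.mem_filter.2 ⟨hψs, this⟩)
      · have : (1 : ℂ) = 0 := by linear_combination -h
        exact one_ne_zero this

end Splitting

end GoodLattice

namespace GoodLattice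

open MeroConnection

/-! ### Classes of exponential factors along one component of the divisor. -/

section Classes

variable {n : ℕ} {L : Finset (Fin n)}

lemma coeff_mono_mul_self (m : Fin n →₀ ℕ) (g : MvPowerSeries (Fin n) ℂ) :
    MvPowerSeries.coeff m (mono m * g) = MvPowerSeries.constantCoeff g := by
  have := MvPowerSeries.coeff_add_monomial_mul m 0 g (1 : ℂ)
  rwa [add_zero, one_mul] at this

lemma coeff_mono_mul_of_not_le {m d : Fin n →₀ ℕ} (h : ¬ m ≤ d) (g : MvPowerSeries (Fin n) ℂ) :
    MvPowerSeries.coeff d (mono m * g) = 0 := by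
  classical
  rw [MvPowerSeries.coeff_monomial_mul, if_neg h]

/-- The class of `t^(-m) u` with `u(0) ≠ 0` has poles in `D(J)` only if `m` is supported in `J`. -/
lemma support_subset_of_mem_mero {m : Fin n →₀ ℕ} {g : FormalMero L}
    {u : MvPowerSeries (Fin n) ℂ} (hu : MvPowerSeries.constantCoeff u ≠ 0)
    (h : toMero L (mono m) * g = toMero L u) {J : Finset (Fin n)}
    (hg : g ∈ mero L Set.univ J) : m.support ⊆ J := by
  obtain ⟨m', hm', g', -, hg'⟩ := mem_mero_iff.1 hg
  have h1 : mono m * g' = mono m' * u := toMero_injective L (by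
    rw [map_mul, map_mul, ← h, ← hg']; ring)
  have h2 : m ≤ m' := by
    by_contra hle
    apply hu
    rw [← coeff_mono_mul_self m' u, ← h1, coeff_mono_mul_of_not_le hle]
  exact (Finsupp.support_mono h2).trans hm'

lemma mem_mero_of_support_subset {m : Fin n →₀ ℕ} {g : FormalMero L}
    {u : MvPowerSeries (Fin n) ℂ} (h : toMero L (mono m) * g = toMero L u) {J : Finset (Fin n)}
    (hm : m.support ⊆ J) : g ∈ mero L Set.univ J :=
  mem_mero_iff.2 ⟨m, hm, u, mem_germs_univ u, h⟩

/-- If two polar parts and their difference are purely monomial, then their pole orders are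
comparable. -/
lemma le_or_le_of_purely_monomial {a b c : Fin n →₀ ℕ} {g h : FormalMero L}
    {u v w : MvPowerSeries (Fin n) ℂ} (hu : MvPowerSeries.constantCoeff u ≠ 0)
    (hv : MvPowerSeries.constantCoeff v ≠ 0) (hw : MvPowerSeries.constantCoeff w ≠ 0)
    (hg : toMero L (mono a) * g = toMero L u) (hh : toMero L (mono b) * h = toMero L v)
    (hgh : toMero L (mono c) * (g - h) = toMero L w) : a ≤ b ∨ b ≤ a := by
  have key : mono (b + c) * u - mono (a + c) * v = mono (a + b) * w := toMero_injective L (by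
    simp only [mono_add, map_sub, map_mul, ← hg, ← hh, ← hgh]
    ring)
  -- For incomparable a and b, the coefficients of t^(b+c) and t^(a+c) force a ≤ c and b ≤ c. Then
  -- t^(a+b) does not occur on the left of `key`, whereas its coefficient on the right is w(0) ≠ 0.
  by_contra! hab
  have h1 : a ≤ c := by
    by_contra hac
    have h := congrArg (MvPowerSeries.coeff (b + c)) key
    rw [map_sub, coeff_mono_mul_self, coeff_mono_mul_of_not_le (by simpa using hab.1),
      coeff_mono_mul_of_not_le (by simpa [add_comm a b] using hac), sub_zero] at h
    exact hu h
  have h2 : b ≤ c := by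
    by_contra hac
    have h := congrArg (MvPowerSeries.coeff (a + c)) key
    rw [map_sub, coeff_mono_mul_self, coeff_mono_mul_of_not_le (by simpa using hab.2),
      coeff_mono_mul_of_not_le (by simpa using hac), zero_sub, neg_eq_zero] at h
    exact hv h
  have h := congrArg (MvPowerSeries.coeff (a + b)) key
  rw [map_sub, coeff_mono_mul_self,
    coeff_mono_mul_of_not_le (by simpa [add_comm a b] using fun h => hab.2 (h2.trans h)),
    coeff_mono_mul_of_not_le (by simpa using fun h => hab.1 (h1.trans h)), sub_zero] at h
  exact hw h.symm

variable {ι κ : Type*} [Fintype ι] [DecidableEq ι] [Fintype κ]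
  {A : Fin n → Matrix ι ι (FormalMero L)}
  {f : κ → FormalMero L} {P : κ → Matrix ι ι (MvPowerSeries (Fin n) ℂ)}

open Classical in
/-- The indices of the summands with the same polar part as `φ₀` outside `D(J)`. -/
noncomputable def polarClass (f : κ → FormalMero L) (J : Finset (Fin n)) (φ₀ : κ) : Finset κ :=
  Finset.univ.filter fun φ => f φ - f φ₀ ∈ mero L Set.univ J

lemma mem_polarClass {J : Finset (Fin n)} {φ₀ φ : κ} :
    φ ∈ polarClass f J φ₀ ↔ f φ - f φ₀ ∈ mero L Set.univ J := by
  simp [polarClass]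

lemma self_mem_polarClass (J : Finset (Fin n)) (φ₀ : κ) : φ₀ ∈ polarClass f J φ₀ := by
  rw [mem_polarClass, sub_self]
  exact zero_mem _

/-- The projector on the sum of the summands with the same polar part along `t_i = 0` is formal in
`t_i` only. -/
theorem FormalSplitting.mem_germs_polarClass (H : FormalSplitting L A f P) {i : Fin n}
    (hi : i ∈ L) (φ₀ : κ) (a b : ι) :
    (∑ ψ ∈ polarClass f (L.erase i) φ₀, P ψ) a b ∈ germs {i} := by
  classical
  set c := polarClass f (L.erase i) φ₀ with hc
  have hex : ∀ φ, ∃ (m : Fin n →₀ ℕ) (u : MvPowerSeries (Fin n) ℂ), φ ≠ φ₀ →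
      m.support ⊆ L ∧ MvPowerSeries.constantCoeff u ≠ 0 ∧
        toMero L (mono m) * (f φ - f φ₀) = toMero L u := by
    intro φ
    by_cases h : φ = φ₀
    · exact ⟨0, 0, fun h' => absurd h h'⟩
    · obtain ⟨m, -, hm, u, hu, h'⟩ := H.good φ φ₀ h
      exact ⟨m, u, fun _ => ⟨hm, hu, h'⟩⟩
  choose m u hmu using hex
  have hmi : ∀ φ, φ ≠ φ₀ → (φ ∈ c ↔ m φ i = 0) := by
    intro φ hφ
    obtain ⟨hm, hu, h⟩ := hmu φ hφ
    rw [hc, mem_polarClass]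
    constructor
    · intro hf
      have := support_subset_of_mem_mero hu h hf
      by_contra h0
      exact Finset.notMem_erase i L (this (Finsupp.mem_support_iff.2 h0))
    · intro h0
      refine mem_mero_of_support_subset h fun j hj => Finset.mem_erase.2 ⟨?_, hm hj⟩
      rintro rfl
      exact Finsupp.mem_support_iff.1 hj h0
  have hcomp : ∀ φ ψ, φ ≠ φ₀ → ψ ≠ φ₀ → m φ ≤ m ψ ∨ m ψ ≤ m φ := by
    intro φ ψ hφ hψ
    by_cases hφψ : φ = ψ
    · exact Or.inl (le_of_eq (by rw [hφψ]))
    obtain ⟨k, -, -, w, hw, h⟩ := H.good φ ψ hφψ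
    refine le_or_le_of_purely_monomial (hmu φ hφ).2.1 (hmu ψ hψ).2.1 hw (hmu φ hφ).2.2
      (hmu ψ hψ).2.2 (c := k) ?_
    rw [← h]
    ring
  -- Descent from the full index set, whose projector is 1, down to c: as long as s is larger than
  -- c, the summands with the largest pole order and nonvanishing leading coefficient are removed.
  suffices hmain : ∀ s : Finset κ, c ⊆ s → (∀ a b, (∑ ψ ∈ s, P ψ) a b ∈ germs {i}) →
      ∀ a b, (∑ ψ ∈ c, P ψ) a b ∈ germs {i} by
    refine hmain Finset.univ (Finset.subset_univ c) (fun a b => ?_) a b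
    rw [H.sum_eq_one, Matrix.one_apply]
    split_ifs
    · exact one_mem _
    · exact zero_mem _
  intro s
  induction s using Finset.strongInduction with
  | H s ih =>
    intro hcs hs
    by_cases hsc : s ⊆ c
    · rwa [hsc.antisymm hcs] at hs
    obtain ⟨ψ₁, hψ₁s, hψ₁c⟩ := Finset.not_subset.1 hsc
    have hφ₀c : φ₀ ∈ c := self_mem_polarClass _ _
    have hne : ψ₁ ≠ φ₀ := fun h => hψ₁c (h ▸ hφ₀c)
    obtain ⟨ψ, hψ⟩ := Finset.exists_maximalFor m (s.erase φ₀)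
      ⟨ψ₁, Finset.mem_erase.2 ⟨hne, hψ₁s⟩⟩
    obtain ⟨hψ0, hψs⟩ := Finset.mem_erase.1 hψ.prop
    have hle : ∀ φ ∈ s, φ ≠ φ₀ → m φ ≤ m ψ := fun φ hφ hφ0 =>
      (hcomp φ ψ hφ0 hψ0).elim id fun h => hψ.le_of_le (Finset.mem_erase.2 ⟨hφ0, hφ⟩) h
    have hMi : m ψ i ≠ 0 := by
      have h1 := hle ψ₁ hψ₁s hne i
      have h2 : m ψ₁ i ≠ 0 := fun h => hψ₁c ((hmi ψ₁ hne).2 h)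
      omega
    -- All pole orders in s are at most m_ψ by comparability, so v_φ = t^(m_ψ) (f_φ - f_φ₀) is a
    -- power series, zero for φ₀. The index ψ is discarded since v_ψ(0) = u_ψ(0) ≠ 0, and the class
    -- c is kept because there the exponent of t_i in m_φ is 0, strictly below that in m_ψ.
    set v : κ → MvPowerSeries (Fin n) ℂ := fun φ =>
      if φ = φ₀ then 0 else mono (m ψ - m φ) * u φ with hv
    have hlev := H.mem_germs_of_level hi hs (hcs hφ₀c) hMi (v := v) (fun φ hφ => by
      by_cases hφ0 : φ = φ₀
      · simp [hv, hφ0]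
      · simp only [hv, hφ0, if_false]
        rw [map_mul, ← (hmu φ hφ0).2.2, ← mul_assoc, ← map_mul, ← mono_add,
          tsub_add_cancel_of_le (hle φ hφ hφ0)])
    refine ih _ ?_ ?_ hlev
    · refine Finset.filter_ssubset.2 ⟨ψ, hψs, ?_⟩
      simpa [hv, hψ0, mono] using (hmu ψ hψ0).2.1
    · intro φ hφ
      refine Finset.mem_filter.2 ⟨hcs hφ, ?_⟩
      by_cases hφ0 : φ = φ₀
      · simp [hv, hφ0]
      · simp only [hv, hφ0, if_false, map_mul]
        rw [constantCoeff_monomial_eq_zero, zero_mul]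
        intro h0
        have h1 := DFunLike.congr_fun h0 i
        rw [Finsupp.tsub_apply, (hmi φ hφ0).1 hφ] at h1
        simp at h1
        exact hMi h1

end Classes

end GoodLattice

namespace GoodLattice

open MeroConnection Filter Topology

/-! ### Projectors along D_I and convergence of the exponential factors. -/

section Assembly

variable {n : ℕ} {L : Finset (Fin n)}

variable {ι κ : Type*} [Fintype ι] [DecidableEq ι] [Fintype κ]
  {A : Fin n → Matrix ι ι (FormalMero L)}
  {f : κ → FormalMero L} {P : κ → Matrix ι ι (MvPowerSeries (Fin n) ℂ)}

/-- By goodness the poles of a difference are governed by a single monomial, so they can be tested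
one component of the divisor at a time. This fails for general polar parts and makes the classes
along D_I intersections of classes along single components. -/
lemma FormalSplitting.sub_mem_mero_iff (H : FormalSplitting L A f P) (φ ψ : κ) :
    ∃ m : Fin n →₀ ℕ, m.support ⊆ L ∧
      ∀ J, f φ - f ψ ∈ mero L Set.univ J ↔ m.support ⊆ J := by
  by_cases h : φ = ψ
  · refine ⟨0, by simp, fun J => ?_⟩
    simp [h]
  · obtain ⟨m, -, hm, u, hu, h⟩ := H.good φ ψ h
    exact ⟨m, hm, fun J => ⟨support_subset_of_mem_mero hu h, mem_mero_of_support_subset h⟩⟩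

/-- The projector on the sum of the summands with the same polar part as `φ₀` along `D_I`
is formal in the variables `t_i`, `i ∈ I`, only. -/
theorem FormalSplitting.mem_germs_polarClass_sdiff [DecidableEq κ] (H : FormalSplitting L A f P)
    {I : Finset (Fin n)} (hI : I ⊆ L) (φ₀ : κ) (a b : ι) :
    (∑ ψ ∈ polarClass f (L \ I) φ₀, P ψ) a b ∈ germs (I : Set (Fin n)) := by
  induction I using Finset.induction_on generalizing a b with
  | empty =>
    have : polarClass f (L \ ∅) φ₀ = Finset.univ := by
      ext φ
      simpa [mem_polarClass] using mem_mero_univ (f φ - f φ₀)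
    rw [this, H.sum_eq_one, Matrix.one_apply]
    split_ifs
    · exact one_mem _
    · exact zero_mem _
  | insert i I hiI ih =>
    obtain ⟨hi, hIL⟩ := Finset.insert_subset_iff.1 hI
    have : polarClass f (L \ insert i I) φ₀ =
        polarClass f (L.erase i) φ₀ ∩ polarClass f (L \ I) φ₀ := by
      ext φ
      obtain ⟨m, -, hm⟩ := H.sub_mem_mero_iff φ φ₀
      rw [Finset.mem_inter, mem_polarClass, mem_polarClass, mem_polarClass, hm, hm, hm,
        ← Finset.subset_inter_iff]
      congr! 1
      ext j
      simp only [Finset.mem_sdiff, Finset.mem_insert, Finset.mem_inter, Finset.mem_erase]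
      tauto
    rw [this, ← sum_mul_sum_of_orthogonal H.mul_self H.orthogonal, Matrix.mul_apply]
    refine sum_mem fun c _ => mul_mem (germs_mono ?_ (H.mem_germs_polarClass hi φ₀ a c))
      (germs_mono ?_ (ih hIL c b))
    · simp
    · simp

/-- The logarithmic derivative of an exponential factor along `t_i = 0` is convergent in the other
variables, up to terms without pole along `t_i = 0`. -/
lemma FormalSplitting.exists_pd_sub_mem [DecidableEq κ] (H : FormalSplitting L A f P) {i : Fin n}
    (hi : i ∈ L) (φ : κ) : ∃ σ ∈ mero L {i} L,
      logCoord L i * pd L i (f φ) - σ ∈ mero L Set.univ (L.erase i) := by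
  set c := polarClass f (L.erase i) φ with hc
  have hφc : φ ∈ c := self_mem_polarClass _ _
  -- Up to a power series this is the mean of the t_i ∂_i f_ψ over the class, weighted by the traces
  -- of the P_ψ. All of them agree with t_i ∂_i f_φ up to terms without pole along t_i = 0.
  refine ⟨scalarPart A P i c, H.scalarPart_mem i hφc (H.mem_germs_polarClass hi φ), ?_⟩
  obtain ⟨r, hr⟩ := H.exists_trace_eq i c
  have h1 := H.trace_mul_scalarPart i hφc
  rw [hr] at h1
  have hne := H.constantCoeff_trace_ne_zero hφc
  have h2 : toMero L (∑ ψ ∈ c, P ψ).trace * (logCoord L i * pd L i (f φ) - scalarPart A P i c) =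
      ∑ ψ ∈ c, logCoord L i * pd L i (f φ - f ψ) * toMero L (P ψ).trace - toMero L r := by
    have h3 : toMero L (∑ ψ ∈ c, P ψ).trace = ∑ ψ ∈ c, toMero L (P ψ).trace := by
      rw [Matrix.trace_sum, map_sum]
    have h4 : ∑ ψ ∈ c, logCoord L i * pd L i (f φ - f ψ) * toMero L (P ψ).trace =
        (∑ ψ ∈ c, toMero L (P ψ).trace) * (logCoord L i * pd L i (f φ)) -
          ∑ ψ ∈ c, logCoord L i * pd L i (f ψ) * toMero L (P ψ).trace := by
      rw [Finset.sum_mul, ← Finset.sum_sub_distrib]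
      refine Finset.sum_congr rfl fun ψ _ => ?_
      rw [map_sub]
      ring
    rw [mul_sub, h1, h3, h4]
    ring
  have h5 : logCoord L i * pd L i (f φ) - scalarPart A P i c =
      toMero L ((∑ ψ ∈ c, P ψ).trace)⁻¹ *
        (∑ ψ ∈ c, logCoord L i * pd L i (f φ - f ψ) * toMero L (P ψ).trace - toMero L r) := by
    rw [← h2, ← mul_assoc, ← map_mul, MvPowerSeries.inv_mul_cancel _ hne, map_one, one_mul]
  rw [h5]
  refine mul_mem (toMero_mem_mero_univ _ _) (sub_mem (sum_mem fun ψ hψ => mul_mem (mul_mem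
    (logCoord_mem_mero _ _ i) (pd_mem_mero i ?_)) (toMero_mem_mero_univ _ _))
    (toMero_mem_mero_univ _ _))
  rw [← neg_sub]
  exact neg_mem (mem_polarClass.1 hψ)

/-- Stated for all large exponents so that one power of the equation clears finitely many
denominators at once. -/
lemma eventually_divEq_pow_mul {S : Set (Fin n)} {J : Finset (Fin n)} {g : FormalMero L}
    (hg : g ∈ mero L S J) : ∀ᶠ M : ℕ in atTop, ∃ h ∈ germs S,
      toMero L (divEq J ^ M) * g = toMero L h := by
  obtain ⟨N, h, hh, hN⟩ := hg
  filter_upwards [eventually_ge_atTop N] with M hM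
  obtain ⟨k, rfl⟩ := Nat.exists_eq_add_of_le' hM
  refine ⟨divEq J ^ k * h, mul_mem (pow_mem (divEq_mem S J) k) hh, ?_⟩
  rw [pow_add, map_mul, map_mul, mul_assoc, map_pow _ _ N, hN]

/-- A polar part is convergent if its logarithmic derivatives along the components of the divisor
are convergent in the other variables, up to terms without pole along the component. -/
theorem exists_convergent_of_pd {g : FormalMero L} (hg : ∀ i ∈ L, ∃ σ ∈ mero L {i} L,
      logCoord L i * pd L i g - σ ∈ mero L Set.univ (L.erase i)) :
    ∃ g' ∈ mero L ∅ L, g - g' ∈ mero L Set.univ ∅ := by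
  classical
  have hg' : ∀ i, ∃ σ, i ∈ L → σ ∈ mero L {i} L ∧
      logCoord L i * pd L i g - σ ∈ mero L Set.univ (L.erase i) := by
    intro i
    by_cases hi : i ∈ L
    · obtain ⟨σ, h⟩ := hg i hi
      exact ⟨σ, fun _ => h⟩
    · exact ⟨0, fun h => absurd h hi⟩
  choose σ hσ using hg'
  have hev1 := eventually_divEq_pow_mul (mem_mero_univ g)
  have hev2 : ∀ᶠ M : ℕ in atTop, ∀ i ∈ L, ∃ h ∈ germs {i},
      toMero L (divEq L ^ M) * σ i = toMero L h := by
    rw [eventually_all_finset]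
    exact fun i hi => eventually_divEq_pow_mul (hσ i hi).1
  have hev3 : ∀ᶠ M : ℕ in atTop, ∀ i ∈ L, ∃ h ∈ germs Set.univ,
      toMero L (divEq (L.erase i) ^ M) * (logCoord L i * pd L i g - σ i) = toMero L h := by
    rw [eventually_all_finset]
    exact fun i hi => eventually_divEq_pow_mul (hσ i hi).2
  obtain ⟨M, ⟨⟨p, -, hp⟩, h2⟩, h3⟩ := ((hev1.and hev2).and hev3).exists
  set e := ∑ i ∈ L, Finsupp.single i M with he
  have hei : ∀ i ∈ L, e i = M := fun i hi => by rw [he, sum_single_apply, if_pos hi]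
  rw [divEq_pow] at hp
  -- the coefficients of `p` are dominated by those of convergent series
  have hcoef : ∀ i, ∃ h : MvPowerSeries (Fin n) ℂ, i ∈ L → h ∈ germs {i} ∧
      ∀ d : Fin n →₀ ℕ, d i < M → ‖MvPowerSeries.coeff d p‖ ≤ ‖MvPowerSeries.coeff d h‖ := by
    intro i
    by_cases hi : i ∈ L
    swap
    · exact ⟨0, fun h => absurd h hi⟩
    obtain ⟨h, hh, hhσ⟩ := h2 i hi
    obtain ⟨q, -, hq⟩ := h3 i hi
    refine ⟨h, fun _ => ⟨hh, fun d hd => ?_⟩⟩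
    have hX : divEq L ^ M = MvPowerSeries.X i ^ M * divEq (L.erase i) ^ M := by
      rw [← mul_pow, divEq, divEq, Finset.mul_prod_erase L _ hi]
    have h4 := mono_mul_pd_eq (i := i) hp
    rw [hei i hi] at h4
    have h5 : MvPowerSeries.X i * MvPowerSeries.pderiv ℂ i p - MvPowerSeries.C (M : ℂ) * p - h =
        MvPowerSeries.X i ^ M * q := by
      apply toMero_injective L
      rw [map_sub, ← h4, ← hhσ, map_mul, ← hq, ← logCoord_of_mem hi, ← divEq_pow, hX, map_mul]
      ring
    have h6 := congrArg (MvPowerSeries.coeff d) h5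
    rw [map_sub, map_sub, coeff_X_mul_pderiv, MvPowerSeries.coeff_C_mul, MvPowerSeries.X_pow_eq,
      coeff_mono_mul_of_not_le (fun hle => by
        have := hle i
        rw [Finsupp.single_eq_same] at this
        omega)] at h6
    -- The error term is divisible by t_i^M and does not contribute when d_i < M. There t_i ∂_i - M
    -- multiplies the coefficient by d_i - M, which has absolute value at least 1, so integrating
    -- back does not enlarge coefficients.
    have h7 : MvPowerSeries.coeff d h = -(((M - d i : ℕ) : ℂ) * MvPowerSeries.coeff d p) := by
      rw [Nat.cast_sub hd.le]
      linear_combination -h6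
    rw [h7, norm_neg, norm_mul, Complex.norm_natCast]
    refine le_mul_of_one_le_left (norm_nonneg _) ?_
    exact_mod_cast Nat.sub_pos_of_lt hd
  choose h hh using hcoef
  -- These are the terms of p not divisible by t^e, each dominated by a term with d_i < M of one of
  -- the finitely many h_i. The remaining terms form t^e w and change g only by the power series w.
  set p' : MvPowerSeries (Fin n) ℂ := fun d =>
    if ∃ i ∈ L, d i < M then MvPowerSeries.coeff d p else 0 with hp'
  have hp'c : ∀ d, MvPowerSeries.coeff d p' =
      if ∃ i ∈ L, d i < M then MvPowerSeries.coeff d p else 0 := fun d => rfl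
  have hp'g : p' ∈ germs (∅ : Set (Fin n)) := by
    have hev : ∀ᶠ r in 𝓝[>] (0 : ℝ), ∀ i ∈ L, Summable (weight {i} r M (h i)) := by
      rw [eventually_all_finset]
      intro i hi
      obtain ⟨R, hR, hs⟩ := (hh i hi).1
      filter_upwards [Ioc_mem_nhdsGT hR] with r hr
      exact (hs M).of_nonneg_of_le (weight_nonneg hr.1.le M _)
        (weight_mono subset_rfl hr.1.le hr.2 M _)
    obtain ⟨r, hr, hr0⟩ := (hev.and self_mem_nhdsWithin).exists
    have hr0 : 0 < r := hr0
    refine ⟨r, hr0, fun N => ?_⟩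
    refine (summable_sum fun i hi => hr i hi).of_nonneg_of_le (weight_nonneg hr0.le N _)
      fun d => ?_
    have hnn : 0 ≤ ∑ i ∈ L, weight {i} r M (h i) d :=
      Finset.sum_nonneg fun i _ => weight_nonneg hr0.le M _ d
    rw [weight_of_mem _ (by simp), hp'c]
    split_ifs with hd
    · obtain ⟨i, hi, hd⟩ := hd
      calc ‖MvPowerSeries.coeff d p‖ * r ^ d.degree
          ≤ ‖MvPowerSeries.coeff d (h i)‖ * r ^ d.degree := by
            gcongr
            exact (hh i hi).2 d hd
        _ = weight {i} r M (h i) d := (weight_of_mem _ (by simpa using hd.le)).symm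
        _ ≤ _ := Finset.single_le_sum (f := fun i => weight {i} r M (h i) d)
          (fun i _ => weight_nonneg hr0.le M _ d) hi
    · simpa using hnn
  set w : MvPowerSeries (Fin n) ℂ := fun d => MvPowerSeries.coeff (e + d) p with hw
  have hpw : p - mono e * w = p' := by
    ext d
    rw [map_sub, MvPowerSeries.coeff_monomial_mul, hp'c]
    have hed : e ≤ d ↔ ¬ ∃ i ∈ L, d i < M := by
      push Not
      constructor
      · intro hle i hi
        rw [← hei i hi]
        exact hle i
      · intro hle i
        rw [he, sum_single_apply]
        split_ifs with hi
        · exact hle i hi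
        · exact Nat.zero_le _
    by_cases hd : e ≤ d
    · rw [if_pos hd, if_neg (hed.1 hd), one_mul, sub_eq_zero]
      change _ = MvPowerSeries.coeff (e + (d - e)) p
      rw [add_tsub_cancel_of_le hd]
    · rw [if_neg hd, if_pos (not_not.1 fun h => hd (hed.2 h)), sub_zero]
  refine ⟨g - toMero L w, mem_mero_iff.2 ⟨e, fun i hi => ?_, p', hp'g, ?_⟩, ?_⟩
  · rw [Finsupp.mem_support_iff, he, sum_single_apply] at hi
    by_contra hiL
    exact hi (if_neg hiL)
  · rw [mul_sub, hp, ← map_mul, ← map_sub, hpw]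
  · rw [sub_sub_cancel]
    exact toMero_mem_mero_univ _ _

end Assembly

end GoodLattice

namespace GoodLattice

open scoped TensorProduct
open MeroConnection

/-! ### Connections and lattices in coordinates. -/

section Coordinates

variable {n : ℕ} {L : Finset (Fin n)} {E : Type*} [AddCommGroup E] [Module (Conv n) E]
  {ι : Type*} [Fintype ι]

lemma mem_mero_empty_iff {S : Set (Fin n)} {g : FormalMero L} :
    g ∈ mero L S ∅ ↔ ∃ h ∈ germs S, toMero L h = g := by
  constructor
  · rintro ⟨N, h, hh, h'⟩
    exact ⟨h, hh, by rw [← h']; simp [divEq]⟩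
  · rintro ⟨h, hh, rfl⟩
    exact toMero_mem_mero _ hh

/-- The coordinates of `ℂ⟦t⟧(*D) ⊗ E` in a basis of `E`. -/
noncomputable def coord (L : Finset (Fin n)) (b : Module.Basis ι (Conv n) E) :
    FormalModule L E ≃ₗ[FormalMero L] (ι → FormalMero L) :=
  (Algebra.TensorProduct.basis (FormalMero L) b).equivFun

lemma eq_sum_coord (b : Module.Basis ι (Conv n) E) (v : FormalModule L E) :
    v = ∑ k, coord L b v k • (1 : FormalMero L) ⊗ₜ[Conv n] b k := by
  have := (Algebra.TensorProduct.basis (FormalMero L) b).sum_equivFun v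
  simp only [Algebra.TensorProduct.basis_apply] at this
  exact this.symm

lemma germs_smul_eq {S : Set (Fin n)} (g : germs S) (v : FormalModule L E) :
    g • v = toMero L (g : MvPowerSeries (Fin n) ℂ) • v :=
  (algebraMap_smul (FormalMero L) g v).symm

lemma mero_smul_eq {S : Set (Fin n)} {J : Finset (Fin n)} (g : mero L S J)
    (v : FormalModule L E) : g • v = (g : FormalMero L) • v := rfl

lemma coord_one_tmul_mem (b : Module.Basis ι (Conv n) E) (S : Set (Fin n)) (e : E) (a : ι) :
    coord L b ((1 : FormalMero L) ⊗ₜ[Conv n] e) a ∈ mero L S ∅ := by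
  have h : coord L b ((1 : FormalMero L) ⊗ₜ[Conv n] e) a =
      toMero L (b.repr e a : MvPowerSeries (Fin n) ℂ) := by
    rw [coord, Module.Basis.equivFun_apply, Algebra.TensorProduct.basis_repr_tmul]
    simp
    rfl
  rw [h]
  exact toMero_mem_mero _ (germs_mono (Set.empty_subset S) (b.repr e a).2)

lemma mem_lattice_iff (b : Module.Basis ι (Conv n) E) {S : Set (Fin n)} {v : FormalModule L E} :
    v ∈ lattice L S E ↔ ∀ a, coord L b v a ∈ mero L S ∅ := by
  constructor
  · intro hv
    induction hv using Submodule.span_induction with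
    | mem x hx =>
      obtain ⟨e, rfl⟩ := hx
      exact coord_one_tmul_mem b S e
    | zero =>
      intro a
      rw [map_zero]
      exact zero_mem _
    | add x y _ _ hx hy =>
      intro a
      rw [map_add]
      exact add_mem (hx a) (hy a)
    | smul g x _ hx =>
      intro a
      rw [germs_smul_eq, map_smul]
      exact mul_mem (toMero_mem_mero _ g.2) (hx a)
  · intro hv
    rw [eq_sum_coord b v]
    refine sum_mem fun k _ => ?_
    obtain ⟨g, hg, h⟩ := mem_mero_empty_iff.1 (hv k)
    rw [← h, ← germs_smul_eq (⟨g, hg⟩ : germs S)]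
    exact Submodule.smul_mem _ _ (Submodule.subset_span ⟨b k, rfl⟩)

/-- The connection matrices in a basis of `E`. -/
noncomputable def connMatrix (C : MeroConnection L E) (b : Module.Basis ι (Conv n) E) (i : Fin n) :
    Matrix ι ι (FormalMero L) :=
  Matrix.of fun a k => coord L b (C.nabla i (b k)) a

variable [DecidableEq ι]

lemma coord_tmul (b : Module.Basis ι (Conv n) E) (g : FormalMero L) (k : ι) :
    coord L b (g ⊗ₜ b k) = Pi.single k g := by
  have h : g ⊗ₜ[Conv n] b k = g • (Algebra.TensorProduct.basis (FormalMero L) b) k := by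
    rw [Algebra.TensorProduct.basis_apply, TensorProduct.smul_tmul', smul_eq_mul, mul_one]
  rw [h, map_smul, coord]
  ext j
  rw [Pi.smul_apply, Module.Basis.equivFun_self, smul_eq_mul, mul_ite, mul_one, mul_zero,
    Pi.single_apply]
  exact if_congr eq_comm rfl rfl

lemma connMatrix_mem (C : MeroConnection L E) (b : Module.Basis ι (Conv n) E) (i : Fin n) :
    connMatrix C b i ∈ (mero L ∅ L).matrix := by
  intro a k
  have h : ∀ v ∈ Submodule.span (mero L ∅ L)
      (Set.range fun e : E => (1 : FormalMero L) ⊗ₜ[Conv n] e), ∀ a,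
      coord L b v a ∈ mero L ∅ L := by
    intro v hv
    induction hv using Submodule.span_induction with
    | mem x hx =>
      obtain ⟨e, rfl⟩ := hx
      exact fun a => mero_mono L subset_rfl (Finset.empty_subset L) (coord_one_tmul_mem b ∅ e a)
    | zero =>
      intro a
      rw [map_zero]
      exact zero_mem _
    | add x y _ _ hx hy =>
      intro a
      rw [map_add]
      exact add_mem (hx a) (hy a)
    | smul g x _ hx =>
      intro a
      rw [mero_smul_eq, map_smul]
      exact mul_mem g.2 (hx a)
  exact h _ (C.nabla_mem i (b k)) a

/-- The componentwise derivative of a vector. -/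
noncomputable def pdVec {L : Finset (Fin n)} (i : Fin n) (y : ι → FormalMero L) :
    ι → FormalMero L := fun a => pd L i (y a)

lemma coord_ext (C : MeroConnection L E) (b : Module.Basis ι (Conv n) E) (i : Fin n)
    (v : FormalModule L E) : coord L b (C.ext i v) =
      pdVec i (coord L b v) + (connMatrix C b i).mulVec (coord L b v) := by
  have h1 : ∀ (g : FormalMero L) (k : ι), coord L b (C.ext i (g ⊗ₜ b k)) =
      pdVec i (coord L b (g ⊗ₜ b k)) + (connMatrix C b i).mulVec (coord L b (g ⊗ₜ b k)) := by
    intro g k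
    rw [ext_tmul, map_add, map_smul, coord_tmul, coord_tmul]
    congr 1
    · ext j
      by_cases hj : j = k
      · subst hj; simp [pdVec]
      · simp [pdVec, hj]
    · ext j
      simp [connMatrix, mul_comm]
  have h2 : ∀ v : FormalModule L E, v = ∑ k, coord L b v k ⊗ₜ[Conv n] b k := by
    intro v
    conv_lhs => rw [eq_sum_coord b v]
    refine Finset.sum_congr rfl fun k _ => ?_
    rw [TensorProduct.smul_tmul', smul_eq_mul, mul_one]
  rw [h2 v, map_sum, map_sum, map_sum]
  simp only [h1]
  rw [Finset.sum_add_distrib]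
  congr 1
  · ext a
    simp [pdVec, Finset.sum_apply]
  · rw [Matrix.mulVec_sum]

lemma pdVec_mulVec (i : Fin n) (M : Matrix ι ι (MvPowerSeries (Fin n) ℂ))
    (y : ι → FormalMero L) : pdVec i ((toMeroMat L M).mulVec y) =
      (toMeroMat L (M.map (MvPowerSeries.pderiv ℂ i))).mulVec y +
        (toMeroMat L M).mulVec (pdVec i y) := by
  ext a
  simp only [pdVec, Matrix.mulVec, dotProduct, map_sum, Pi.add_apply, ← Finset.sum_add_distrib]
  refine Finset.sum_congr rfl fun k _ => ?_
  simp only [RingHom.mapMatrix_apply, Matrix.map_apply]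
  rw [Derivation.leibniz, pd_algebraMap, smul_eq_mul, smul_eq_mul]
  ring

lemma mulVec_mem {S : Set (Fin n)} {J : Finset (Fin n)} {M : Matrix ι ι (FormalMero L)}
    (hM : M ∈ (mero L S J).matrix) {y : ι → FormalMero L} (hy : ∀ k, y k ∈ mero L S J) (a : ι) :
    M.mulVec y a ∈ mero L S J :=
  sum_mem fun k _ => (mero L S J).mul_mem (hM a k) (hy k)

lemma polarMk_eq_polarMk_iff {S : Set (Fin n)} {J : Finset (Fin n)}
    (f g : (mero L S L).toSubmodule) :
    polarMk L S J f = polarMk L S J g ↔ (f : FormalMero L) - g ∈ mero L S J := by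
  rw [polarMk, Submodule.mkQ_apply, Submodule.mkQ_apply, Submodule.Quotient.eq]
  rfl

end Coordinates

end GoodLattice

namespace GoodLattice

open scoped TensorProduct
open MeroConnection

/-! ### From a decomposition of the formal completion to a formal splitting. -/

section FromDecomposition

variable {n : ℕ} {L : Finset (Fin n)} {E : Type*} [AddCommGroup E] [Module (Conv n) E]
  {ι : Type*} [Fintype ι] [DecidableEq ι]

/-- The projectors of a direct sum decomposition of the formal completion of a free module. -/
lemma exists_projectors (b : Module.Basis ι (Conv n) E) {κ : Type*} [Fintype κ] [DecidableEq κ]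
    {N : κ → Submodule (germs (Set.univ : Set (Fin n))) (FormalModule L E)}
    (hind : iSupIndep N) (hsup : ⨆ φ, N φ = lattice L Set.univ E) :
    ∃ P : κ → Matrix ι ι (MvPowerSeries (Fin n) ℂ),
      (∀ φ k, (coord L b).symm ((toMeroMat L (P φ)).col k) ∈ N φ) ∧ ∑ φ, P φ = 1 ∧
      ∀ φ ψ, ∀ v ∈ N ψ, (toMeroMat L (P φ)).mulVec (coord L b v) =
        if φ = ψ then coord L b v else 0 := by
  have hdec : ∀ k, ∃ μ : ∀ φ, N φ, ∑ φ, (μ φ : FormalModule L E) = 1 ⊗ₜ b k := by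
    intro k
    have h : (1 : FormalMero L) ⊗ₜ[Conv n] b k ∈ ⨆ φ ∈ (Finset.univ : Finset κ), N φ := by
      simp only [Finset.mem_univ, iSup_pos, hsup]
      exact Submodule.subset_span ⟨b k, rfl⟩
    exact (Submodule.mem_iSup_finset_iff_exists_sum N _).1 h
  choose μ hμ using hdec
  have hNlat : ∀ φ, N φ ≤ lattice L Set.univ E := fun φ => hsup ▸ le_iSup N φ
  have hex : ∀ φ a k, ∃ g : MvPowerSeries (Fin n) ℂ,
      toMero L g = coord L b (μ k φ : FormalModule L E) a := by
    intro φ a k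
    obtain ⟨g, -, hg⟩ := mem_mero_empty_iff.1 ((mem_lattice_iff b).1 (hNlat φ (μ k φ).2) a)
    exact ⟨g, hg⟩
  choose P hP using hex
  set Pm : κ → Matrix ι ι (MvPowerSeries (Fin n) ℂ) := fun φ => Matrix.of (P φ) with hPm
  have hcol : ∀ φ k, (toMeroMat L (Pm φ)).col k = coord L b (μ k φ : FormalModule L E) := by
    intro φ k
    ext a
    exact hP φ a k
  have hvec : ∀ φ (y : ι → FormalMero L), (toMeroMat L (Pm φ)).mulVec y =
      ∑ k, y k • coord L b (μ k φ : FormalModule L E) := by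
    intro φ y
    ext a
    rw [Finset.sum_apply]
    refine Finset.sum_congr rfl fun k _ => ?_
    rw [Pi.smul_apply, ← hcol, smul_eq_mul, mul_comm]
    rfl
  refine ⟨Pm, fun φ k => ?_, ?_, ?_⟩
  · rw [hcol, LinearEquiv.symm_apply_apply]
    exact (μ k φ).2
  · apply toMeroMat_injective L
    rw [map_sum, map_one]
    ext a k
    have h := congrArg (fun v => coord L b v a) (hμ k)
    simp only [map_sum, Finset.sum_apply, coord_tmul] at h
    rw [Matrix.sum_apply, Matrix.one_apply, ← Pi.single_apply k (1 : FormalMero L) a, ← h]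
    exact Finset.sum_congr rfl fun φ _ => hP φ a k
  · intro φ ψ v hv
    have hvl := (mem_lattice_iff b).1 (hNlat ψ hv)
    choose g _ hg using fun a => mem_mero_empty_iff.1 (hvl a)
    set w : κ → FormalModule L E := fun φ => ∑ k, toMero L (g k) • (μ k φ : FormalModule L E)
      with hw
    have hwN : ∀ φ, w φ ∈ N φ := fun φ => sum_mem fun k _ => by
      rw [← germs_smul_eq (⟨g k, mem_germs_univ _⟩ : germs (Set.univ : Set (Fin n)))]
      exact Submodule.smul_mem _ _ (μ k φ).2
    have hwsum : ∑ φ, w φ = v := by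
      rw [hw, Finset.sum_comm, eq_sum_coord b v]
      refine Finset.sum_congr rfl fun k _ => ?_
      rw [← hμ k, Finset.smul_sum, hg]
    have hweq := (iSupIndep_iff_finsetSum_eq_imp_eq N).1 hind Finset.univ w
      (fun φ => if φ = ψ then v else 0)
      (fun φ _ => ⟨hwN φ, by
        split_ifs with h
        · rwa [h]
        · exact zero_mem _⟩)
      (by rw [hwsum]; simp) φ (Finset.mem_univ φ)
    have h1 : (toMeroMat L (Pm φ)).mulVec (coord L b v) = coord L b (w φ) := by
      rw [hvec, hw, map_sum]
      refine Finset.sum_congr rfl fun k _ => ?_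
      rw [map_smul, hg]
    rw [h1, hweq]
    split_ifs <;> simp

/-- A decomposition of the formal completion gives a formal splitting in a basis of `E`, for any
lifting of the exponential factors. -/
theorem exists_formalSplitting (C : MeroConnection L E) (b : Module.Basis ι (Conv n) E)
    {Φ : Set (Polar L (Set.univ : Set (Fin n)) ∅)} [Fintype Φ] [DecidableEq Φ] (hgood : IsGood Φ)
    (hdec : C.HasDecomposition Set.univ ∅ Φ) :
    ∃ P : Φ → Matrix ι ι (MvPowerSeries (Fin n) ℂ),
      ∀ f : Φ → (mero L Set.univ L).toSubmodule, (∀ φ, polarMk L Set.univ ∅ (f φ) = φ) →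
        FormalSplitting L (connMatrix C b) (fun φ => (f φ : FormalMero L)) P := by
  obtain ⟨N, hind, hsup, hN⟩ := hdec
  obtain ⟨P, hPN, hsum, hPv⟩ := exists_projectors b hind hsup
  -- The projectors are fixed before the lift f, so arbitrary lifts can later be exchanged for
  -- convergent ones.
  refine ⟨P, fun f hf => ?_⟩
  have hmul : ∀ φ ψ, P φ * P ψ = if φ = ψ then P ψ else 0 := by
    intro φ ψ
    apply toMeroMat_injective L
    ext a k
    have h := congrFun (hPv φ ψ _ (hPN ψ k)) a
    rw [LinearEquiv.apply_symm_apply] at h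
    rw [map_mul]
    refine Eq.trans ?_ (h.trans ?_)
    · rfl
    · split_ifs <;> simp
  -- the projectors on the spans over rings of meromorphic functions
  have hspan : ∀ φ ψ, ∀ v ∈ Submodule.span (mero L Set.univ ∅) (N ψ : Set (FormalModule L E)),
      (toMeroMat L (P φ)).mulVec (coord L b v) = if φ = ψ then coord L b v else 0 := by
    intro φ ψ v hv
    induction hv using Submodule.span_induction with
    | mem x hx => exact hPv φ ψ x hx
    | zero => simp
    | add x y _ _ hx hy =>
      rw [map_add, Matrix.mulVec_add, hx, hy]
      split_ifs <;> simp
    | smul g x _ hx =>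
      rw [mero_smul_eq, map_smul, Matrix.mulVec_smul, hx]
      split_ifs <;> simp
  have hlogne : ∀ i, logCoord L i ≠ 0 := by
    intro i
    rw [logCoord]
    split_ifs
    · exact toMero_mono_ne_zero _
    · simp
  set nk : Φ → ι → FormalModule L E := fun φ k =>
    (coord L b).symm ((toMeroMat L (P φ)).col k) with hnk
  have hcoordnk : ∀ φ k, coord L b (nk φ k) = (toMeroMat L (P φ)).col k := fun φ k =>
    LinearEquiv.apply_symm_apply _ _
  -- After multiplication by the logarithmic coordinate, ∇_i v - ∂_i f_ψ v lies in the span of N ψ,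
  -- where the projectors act as 0 or 1. The term with f_ψ is itself in this span, and the
  -- coordinate cancels because it is nonzero in a domain.
  have hext : ∀ i φ ψ k, (toMeroMat L (P φ)).mulVec (coord L b (C.ext i (nk ψ k))) =
      if φ = ψ then coord L b (C.ext i (nk ψ k)) else 0 := by
    intro i φ ψ k
    have h1 := hspan φ ψ _ ((hN ψ).2.2 (f ψ) (hf ψ) i _ (hPN ψ k))
    have h2 := hPv φ ψ _ (hPN ψ k)
    rw [map_smul, map_sub, map_smul, Matrix.mulVec_smul, Matrix.mulVec_sub, Matrix.mulVec_smul,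
      h2] at h1
    split_ifs at h1 ⊢ with h
    · exact sub_left_injective (smul_right_injective _ (hlogne i) h1)
    · simpa [hlogne i, hnk] using h1
  -- Decompose the basis vector as the sum of its components n_ψ; applying ∇_i and projecting leaves
  -- ∇_i n_φ. In coordinates this reads P A = ∂P + A P, which is horizontality.
  have hextsum : ∀ i φ k, (toMeroMat L (P φ)).mulVec ((connMatrix C b i).col k) =
      coord L b (C.ext i (nk φ k)) := by
    intro i φ k
    have h1 : ∑ ψ, nk ψ k = 1 ⊗ₜ b k := by
      apply (coord L b).injective
      rw [map_sum, coord_tmul]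
      simp only [hcoordnk]
      ext a
      have h2 := congrArg (fun M => toMeroMat L M a k) hsum
      simp only [map_sum, map_one] at h2
      rw [Matrix.sum_apply, Matrix.one_apply] at h2
      rw [Finset.sum_apply, Pi.single_apply]
      exact h2
    have h3 : coord L b (C.ext i (1 ⊗ₜ b k)) = (connMatrix C b i).col k := by
      rw [ext_tmul]
      simp only [Derivation.map_one_eq_zero, TensorProduct.zero_tmul, zero_add, one_smul]
      rfl
    rw [← h3, ← h1, map_sum, map_sum, Matrix.mulVec_sum]
    simp only [hext]
    simp
  exact
    { conv := connMatrix_mem C b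
      ne_zero := by
        intro φ h0
        refine (hN φ).1 ((Submodule.eq_bot_iff _).2 fun v hv => ?_)
        have h := hPv φ φ v hv
        rw [h0, map_zero, Matrix.zero_mulVec, if_pos rfl] at h
        exact (LinearEquiv.map_eq_zero_iff _).1 h.symm
      mul_self := fun φ => by rw [hmul, if_pos rfl]
      orthogonal := fun φ ψ h => by rw [hmul, if_neg h]
      sum_eq_one := hsum
      horizontal := by
        intro i φ
        ext a k
        have h := congrFun (hextsum i φ k) a
        rw [coord_ext, hcoordnk] at h
        have h' : (toMeroMat L (P φ) * connMatrix C b i) a k =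
            toMeroMat L ((P φ).map (MvPowerSeries.pderiv ℂ i)) a k +
              (connMatrix C b i * toMeroMat L (P φ)) a k := by
          refine h.trans ?_
          rw [Pi.add_apply]
          congr 1
          exact pd_algebraMap L i _
        rw [Matrix.sub_apply, h', add_sub_cancel_right]
      logarithmic := by
        intro i φ
        have hmem : ∀ a k, (logCoord L i • (toMeroMat L (P φ) * connMatrix C b i -
            pd L i (f φ : FormalMero L) • toMeroMat L (P φ))) a k ∈ mero L Set.univ ∅ := by
          intro a k
          have h1 : ∀ v ∈ Submodule.span (mero L Set.univ ∅) (N φ : Set (FormalModule L E)),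
              coord L b v a ∈ mero L Set.univ ∅ := by
            intro v hv
            induction hv using Submodule.span_induction with
            | mem x hx => exact (mem_lattice_iff b).1 ((hsup ▸ le_iSup N φ : N φ ≤ _) hx) a
            | zero =>
              rw [map_zero]
              exact zero_mem _
            | add x y _ _ hx hy =>
              rw [map_add]
              exact add_mem hx hy
            | smul g x _ hx =>
              rw [mero_smul_eq, map_smul]
              exact mul_mem g.2 hx
          have h2 := h1 _ ((hN φ).2.2 (f φ) (hf φ) i _ (hPN φ k))
          rw [map_smul, map_sub, map_smul, ← hextsum, hcoordnk] at h2
          exact h2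
        choose R hR using fun a k => mem_mero_univ_empty.1 (hmem a k)
        refine ⟨Matrix.of R, ?_⟩
        ext a k
        exact (hR a k).symm
      good := by
        intro φ ψ h
        obtain ⟨m, hmL, ⟨i, -, hi⟩, u, -, hu, g, hg, hgu⟩ :=
          hgood.2 φ φ.2 ψ ψ.2 fun h' => h (Subtype.ext h')
        have hm0 : m ≠ 0 := fun h' => hi (by simp [h'])
        rw [← hf φ, ← hf ψ, ← map_sub, eq_comm, polarMk_eq_polarMk_iff] at hg
        obtain ⟨q, hq⟩ := mem_mero_univ_empty.1 hg
        -- The class determines the difference of the lifts up to a power series q. The correction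
        -- t^m q does not affect the constant term since m ≠ 0.
        refine ⟨m, hm0, hmL, u + mono m * q, ?_, ?_⟩
        · rwa [map_add, map_mul, constantCoeff_monomial_eq_zero hm0, zero_mul, add_zero]
        · rw [map_add, map_mul, hq, ← hgu, Submodule.coe_sub]
          ring }

end FromDecomposition

end GoodLattice

namespace GoodLattice

open scoped TensorProduct
open MeroConnection

/-! ### Freeness of direct summands of the lattice. -/

section Lattice

variable {n : ℕ}

instance isDomain_germs (S : Set (Fin n)) : IsDomain (germs S) :=
  have := NoZeroDivisors.to_isDomain (MvPowerSeries (Fin n) ℂ)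
  inferInstance

/-- Series with nonzero constant term are units by `inv_mem_germs`. Locality makes finite projective
modules free, which gives the freeness of the summands. -/
instance isLocalRing_germs (S : Set (Fin n)) : IsLocalRing (germs S) := by
  have hunit : ∀ f : germs S, MvPowerSeries.constantCoeff (f : MvPowerSeries (Fin n) ℂ) ≠ 0 →
      IsUnit f := fun f hf =>
    IsUnit.of_mul_eq_one ⟨_, inv_mem_germs f.2 hf⟩
      (Subtype.ext (MvPowerSeries.mul_inv_cancel _ hf))
  refine IsLocalRing.of_isUnit_or_isUnit_one_sub_self fun f => ?_
  by_cases hf : MvPowerSeries.constantCoeff (f : MvPowerSeries (Fin n) ℂ) = 0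
  · refine Or.inr (hunit _ ?_)
    change MvPowerSeries.constantCoeff (1 - (f : MvPowerSeries (Fin n) ℂ)) ≠ 0
    rw [map_sub, hf, map_one, sub_zero]
    exact one_ne_zero
  · exact Or.inl (hunit f hf)

variable {L : Finset (Fin n)} {E : Type*} [AddCommGroup E] [Module (Conv n) E]
  {ι : Type*} [Fintype ι]

lemma lattice_eq_span (b : Module.Basis ι (Conv n) E) (S : Set (Fin n)) :
    lattice L S E = Submodule.span (germs S)
      (Set.range (Algebra.TensorProduct.basis (FormalMero L) b)) := by
  apply le_antisymm
  · intro v hv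
    rw [eq_sum_coord b v]
    refine sum_mem fun k _ => ?_
    obtain ⟨g, hg, h⟩ := mem_mero_empty_iff.1 ((mem_lattice_iff b).1 hv k)
    rw [← h, ← germs_smul_eq (⟨g, hg⟩ : germs S)]
    exact Submodule.smul_mem _ _ (Submodule.subset_span
      ⟨k, Algebra.TensorProduct.basis_apply b k⟩)
  · refine Submodule.span_mono ?_
    rintro _ ⟨k, rfl⟩
    exact ⟨b k, (Algebra.TensorProduct.basis_apply b k).symm⟩

lemma free_lattice (b : Module.Basis ι (Conv n) E) (S : Set (Fin n)) :
    Module.Free (germs S) (lattice L S E) := by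
  have : Module.IsTorsionFree (germs S) (FormalMero L) := by
    refine ⟨fun r hr x y hxy => ?_⟩
    have hr0 : toMero L (r : MvPowerSeries (Fin n) ℂ) ≠ 0 := fun h => by
      have : (r : MvPowerSeries (Fin n) ℂ) = 0 :=
        toMero_injective L (h.trans (map_zero _).symm)
      exact hr.ne_zero (Subtype.ext this)
    exact mul_left_cancel₀ hr0 (by simpa [Algebra.smul_def] using hxy)
  rw [lattice_eq_span b S]
  exact Module.Free.of_basis
    ((Algebra.TensorProduct.basis (FormalMero L) b).restrictScalars (germs S))

lemma finite_lattice (b : Module.Basis ι (Conv n) E) (S : Set (Fin n)) :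
    Module.Finite (germs S) (lattice L S E) := by
  rw [lattice_eq_span b S]
  exact Module.Finite.span_of_finite _ (Set.finite_range _)

/-- The image of a free lattice of finite rank under a projector preserving it is free. -/
lemma free_map_lattice (b : Module.Basis ι (Conv n) E) (S : Set (Fin n))
    {q : FormalModule L E →ₗ[germs S] FormalModule L E}
    (hq : ∀ v ∈ lattice L S E, q v ∈ lattice L S E) (hqq : ∀ v, q (q v) = q v) :
    Module.Free (germs S) ((lattice L S E).map q) := by
  have := free_lattice (L := L) b S
  have := finite_lattice (L := L) b S
  have hle : (lattice L S E).map q ≤ lattice L S E := by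
    rintro _ ⟨v, hv, rfl⟩
    exact hq v hv
  have : Module.Projective (germs S) ((lattice L S E).map q) := by
    refine Module.Projective.of_split (Submodule.inclusion hle)
      (q.restrict fun v hv => Submodule.mem_map_of_mem hv) ?_
    ext ⟨_, v, -, rfl⟩
    exact hqq v
  have : Module.Finite (germs S) ((lattice L S E).map q) :=
    Module.Finite.of_surjective
      (q.restrict fun v hv => Submodule.mem_map_of_mem hv :
        lattice L S E →ₗ[germs S] (lattice L S E).map q)
      (by
        rintro ⟨_, v, hv, rfl⟩
        exact ⟨⟨v, hv⟩, rfl⟩)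
  exact Module.free_of_flat_of_isLocalRing (R := germs S) (P := (lattice L S E).map q)

variable [DecidableEq ι]

/-- The endomorphism of `ℂ⟦t⟧(*D) ⊗ E` with a given matrix. -/
noncomputable def matEnd (b : Module.Basis ι (Conv n) E)
    (M : Matrix ι ι (MvPowerSeries (Fin n) ℂ)) :
    FormalModule L E →ₗ[FormalMero L] FormalModule L E :=
  (coord L b).symm.toLinearMap ∘ₗ (toMeroMat L M).mulVecLin ∘ₗ (coord L b).toLinearMap

lemma coord_matEnd (b : Module.Basis ι (Conv n) E) (M : Matrix ι ι (MvPowerSeries (Fin n) ℂ))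
    (v : FormalModule L E) :
    coord L b (matEnd b M v) = (toMeroMat L M).mulVec (coord L b v) := by
  simp [matEnd]

lemma matEnd_mul (b : Module.Basis ι (Conv n) E) (M M' : Matrix ι ι (MvPowerSeries (Fin n) ℂ))
    (v : FormalModule L E) : matEnd b M (matEnd b M' v) = matEnd b (M * M') v := by
  apply (coord L b).injective
  rw [coord_matEnd, coord_matEnd, coord_matEnd, Matrix.mulVec_mulVec, map_mul]

lemma matEnd_one (b : Module.Basis ι (Conv n) E) (v : FormalModule L E) : matEnd b 1 v = v := by
  apply (coord L b).injective
  rw [coord_matEnd, map_one, Matrix.one_mulVec]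

lemma matEnd_zero (b : Module.Basis ι (Conv n) E) (v : FormalModule L E) : matEnd b 0 v = 0 := by
  apply (coord L b).injective
  rw [coord_matEnd, map_zero, Matrix.zero_mulVec, map_zero]

lemma matEnd_sum (b : Module.Basis ι (Conv n) E) {κ : Type*} (s : Finset κ)
    (M : κ → Matrix ι ι (MvPowerSeries (Fin n) ℂ)) (v : FormalModule L E) :
    matEnd b (∑ φ ∈ s, M φ) v = ∑ φ ∈ s, matEnd b (M φ) v := by
  apply (coord L b).injective
  rw [coord_matEnd, map_sum, map_sum, Matrix.sum_mulVec]
  exact Finset.sum_congr rfl fun φ _ => (coord_matEnd b _ _).symm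

lemma matEnd_mem_lattice (b : Module.Basis ι (Conv n) E) {S : Set (Fin n)}
    {M : Matrix ι ι (MvPowerSeries (Fin n) ℂ)} (hM : ∀ a k, M a k ∈ germs S)
    {v : FormalModule L E} (hv : v ∈ lattice L S E) : matEnd b M v ∈ lattice L S E := by
  rw [mem_lattice_iff b] at hv ⊢
  rw [coord_matEnd]
  exact mulVec_mem (toMeroMat_mem hM _) hv

end Lattice

/-! ### From a formal splitting back to decompositions along D_I. -/

section ToDecomposition

variable {n : ℕ} {L : Finset (Fin n)} {E : Type*} [AddCommGroup E] [Module (Conv n) E]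
  {ι κ : Type*} [Fintype ι] [DecidableEq ι] [Fintype κ]
  {f : κ → FormalMero L} {P : κ → Matrix ι ι (MvPowerSeries (Fin n) ℂ)}

/-- Horizontal projectors commute with the connection. -/
lemma FormalSplitting.ext_matEnd {C : MeroConnection L E} {b : Module.Basis ι (Conv n) E}
    (H : FormalSplitting L (connMatrix C b) f P) (i : Fin n) (s : Finset κ)
    (v : FormalModule L E) :
    C.ext i (matEnd b (∑ φ ∈ s, P φ) v) = matEnd b (∑ φ ∈ s, P φ) (C.ext i v) := by
  apply (coord L b).injective
  rw [coord_ext, coord_matEnd, coord_matEnd, coord_ext, pdVec_mulVec, H.horizontal_sum,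
    Matrix.sub_mulVec, Matrix.mulVec_add, Matrix.mulVec_mulVec, Matrix.mulVec_mulVec]
  abel

/-- On a summand with exponential factor `f φ`, the connection minus `df φ` is logarithmic. -/
lemma FormalSplitting.coord_log_mem {C : MeroConnection L E} {b : Module.Basis ι (Conv n) E}
    (H : FormalSplitting L (connMatrix C b) f P) (i : Fin n) (φ : κ) {J : Finset (Fin n)}
    {g : FormalMero L} (hg : f φ - g ∈ mero L Set.univ J) {v : FormalModule L E}
    (hv : ∀ k, coord L b v k ∈ mero L Set.univ J) (a : ι) :
    (toMeroMat L (P φ)).mulVec (coord L b (logCoord L i • (C.ext i v - pd L i g • v))) a ∈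
      mero L Set.univ J := by
  obtain ⟨R, hR⟩ := H.logarithmic i φ
  have hlog := logCoord_mem_mero (L := L) Set.univ J i
  have hPm := fun a b => mem_germs_univ (P φ a b)
  have h1 : (toMeroMat L (P φ)).mulVec
      (coord L b (logCoord L i • (C.ext i v - pd L i g • v))) =
      logCoord L i • (toMeroMat L (P φ)).mulVec (pdVec i (coord L b v)) +
        (toMeroMat L R).mulVec (coord L b v) +
        (logCoord L i * pd L i (f φ - g)) • (toMeroMat L (P φ)).mulVec (coord L b v) := by
    rw [← hR, map_smul, map_sub, map_smul, coord_ext, Matrix.mulVec_smul, Matrix.mulVec_sub,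
      Matrix.mulVec_add, Matrix.mulVec_smul, Matrix.mulVec_mulVec, Matrix.smul_mulVec,
      Matrix.sub_mulVec, Matrix.smul_mulVec, map_sub, mul_sub, sub_smul, smul_sub, smul_sub,
      smul_add, smul_smul, smul_smul]
    abel
  rw [h1]
  refine add_mem (add_mem ?_ ?_) ?_
  · exact mul_mem hlog (mulVec_mem (toMeroMat_mem hPm _) (fun k => pd_mem_mero i (hv k)) a)
  · exact mulVec_mem (toMeroMat_mem (fun _ _ => mem_germs_univ _) _) hv a
  · exact mul_mem (mul_mem hlog (pd_mem_mero i hg)) (mulVec_mem (toMeroMat_mem hPm _) hv a)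

/-- A formal splitting with convergent exponential factors gives a decomposition along `D_I`. -/
theorem FormalSplitting.hasDecomposition [DecidableEq κ] {C : MeroConnection L E} {b : Module.Basis ι (Conv n) E}
    (H : FormalSplitting L (connMatrix C b) f P) {I : Finset (Fin n)} (hI : I ⊆ L)
    (hf : ∀ φ, f φ ∈ mero L (I : Set (Fin n)) L) :
    C.HasDecomposition (I : Set (Fin n)) (L \ I)
      (Set.range fun φ => polarMk L (I : Set (Fin n)) (L \ I) ⟨f φ, hf φ⟩) := by
  classical
  set Φ := Set.range fun φ => polarMk L (I : Set (Fin n)) (L \ I) ⟨f φ, hf φ⟩ with hΦ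
  have hΦfin : Φ.Finite := Set.finite_range _
  have : Fintype Φ := hΦfin.fintype
  set c : Φ → Finset κ := fun η =>
    Finset.univ.filter fun φ => polarMk L (I : Set (Fin n)) (L \ I) ⟨f φ, hf φ⟩ = η with hc
  have hcne : ∀ η, ∃ φ, φ ∈ c η := by
    rintro ⟨_, φ, rfl⟩
    exact ⟨φ, by simp [hc]⟩
  have hcclass : ∀ η φ, φ ∈ c η → c η = polarClass f (L \ I) φ := by
    intro η φ hφ
    have hφη := (Finset.mem_filter.1 hφ).2
    ext ψ
    rw [mem_polarClass, hc, Finset.mem_filter, ← hφη, polarMk_eq_polarMk_iff]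
    constructor
    · exact fun h => mero_mono L (Set.subset_univ _) subset_rfl h.2
    · exact fun h => ⟨Finset.mem_univ _,
        mem_mero_of_mem_mero_univ h (sub_mem (hf ψ) (hf φ))⟩
  set Q : Φ → Matrix ι ι (MvPowerSeries (Fin n) ℂ) := fun η => ∑ φ ∈ c η, P φ with hQ
  have hQgerm : ∀ η a k, Q η a k ∈ germs (I : Set (Fin n)) := by
    intro η a k
    obtain ⟨φ, hφ⟩ := hcne η
    rw [hQ]
    simp only [hcclass η φ hφ]
    exact H.mem_germs_polarClass_sdiff hI φ a k
  have hQQ : ∀ η η', Q η * Q η' = if η = η' then Q η else 0 := by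
    intro η η'
    rw [hQ]
    simp only [sum_mul_sum_of_orthogonal H.mul_self H.orthogonal]
    split_ifs with h
    · rw [h, Finset.inter_self]
    · refine Finset.sum_eq_zero fun φ hφ => absurd ?_ h
      obtain ⟨h1, h2⟩ := Finset.mem_inter.1 hφ
      exact Subtype.ext ((Finset.mem_filter.1 h1).2.symm.trans (Finset.mem_filter.1 h2).2)
  have hQsum : ∑ η, Q η = 1 := by
    rw [← H.sum_eq_one, hQ, ← Finset.sum_fiberwise Finset.univ
      (fun φ => (⟨_, φ, rfl⟩ : Φ)) P]
    refine Finset.sum_congr rfl fun η _ => Finset.sum_congr ?_ fun _ _ => rfl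
    ext φ
    simp [hc, Subtype.ext_iff]
  set q : Φ → (FormalModule L E →ₗ[germs (I : Set (Fin n))] FormalModule L E) := fun η =>
    (matEnd b (Q η)).restrictScalars _ with hq
  have hqapp : ∀ η v, q η v = matEnd b (Q η) v := fun _ _ => rfl
  have hqq : ∀ η η' v, q η (q η' v) = if η = η' then q η v else 0 := by
    intro η η' v
    rw [hqapp, hqapp, matEnd_mul, hQQ]
    split_ifs
    · rfl
    · exact matEnd_zero b v
  have hqlat : ∀ η, ∀ v ∈ lattice L (I : Set (Fin n)) E, q η v ∈ lattice L (I : Set (Fin n)) E :=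
    fun η v hv => matEnd_mem_lattice b (hQgerm η) hv
  -- The individual projectors need not preserve the partially formal lattice, but their sums over
  -- classes do.
  refine ⟨fun η => (lattice L (I : Set (Fin n)) E).map (q η), ?_, ?_, fun η => ⟨?_, ?_, ?_⟩⟩
  · rw [iSupIndep_def]
    intro η
    rw [Submodule.disjoint_def]
    rintro _ ⟨v, -, rfl⟩ hx
    have hle : ⨆ η', ⨆ (_ : η' ≠ η), (lattice L (I : Set (Fin n)) E).map (q η') ≤
        LinearMap.ker (q η) := by
      refine iSup₂_le fun η' hη' => ?_
      rintro _ ⟨w, -, rfl⟩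
      rw [LinearMap.mem_ker, hqq, if_neg hη'.symm]
    have h := hle hx
    rwa [LinearMap.mem_ker, hqq, if_pos rfl] at h
  · apply le_antisymm
    · refine iSup_le fun η => ?_
      rintro _ ⟨v, hv, rfl⟩
      exact hqlat η v hv
    · intro v hv
      rw [← matEnd_one b v, ← hQsum, matEnd_sum]
      exact sum_mem fun η _ => Submodule.mem_iSup_of_mem η ⟨v, hv, rfl⟩
  · obtain ⟨φ, hφ⟩ := hcne η
    intro hbot
    apply H.sum_ne_zero hφ
    apply toMeroMat_injective L
    ext a k
    have h : q η (1 ⊗ₜ b k) = 0 := by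
      rw [← Submodule.mem_bot (germs (I : Set (Fin n))), ← hbot]
      exact ⟨_, Submodule.subset_span ⟨b k, rfl⟩, rfl⟩
    have h' := congrArg (fun v => coord L b v a) h
    simp only [hqapp, coord_matEnd, coord_tmul] at h'
    have hQ0 : Q η a k = 0 := by simpa using h'
    change toMero L (Q η a k) = _
    rw [hQ0]
    simp
  · exact free_map_lattice b _ (hqlat η) fun v => by rw [hqq, if_pos rfl]
  · rintro ⟨g, hg⟩ hgη i _ ⟨w, hw, rfl⟩
    set v := q η w with hv
    have hvlat := hqlat η w hw
    have hqv : q η v = v := by rw [hv, hqq, if_pos rfl]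
    have hvI := (mem_lattice_iff b).1 hvlat
    set x := logCoord L i • (C.ext i v - pd L i g • v) with hx
    have hqx : matEnd b (Q η) x = x := by
      rw [hx, map_smul, map_sub, map_smul, ← H.ext_matEnd, ← hqapp η v, hqv]
    have hxL : ∀ a, coord L b x a ∈ mero L (I : Set (Fin n)) L := by
      intro a
      have hvL : ∀ k, coord L b v k ∈ mero L (I : Set (Fin n)) L := fun k =>
        mero_mono L subset_rfl (Finset.empty_subset L) (hvI k)
      rw [hx, map_smul, map_sub, map_smul, coord_ext]
      refine mul_mem (logCoord_mem_mero _ _ i) (sub_mem (add_mem (pd_mem_mero i (hvL a)) ?_)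
        (mul_mem (pd_mem_mero i hg) (hvL a)))
      exact mulVec_mem (fun a k => mero_mono L (Set.empty_subset _) subset_rfl
        (connMatrix_mem C b i a k)) hvL a
    -- The poles are bounded summand by summand over formal series, where the single projectors are
    -- available. Convergence, with arbitrary poles along D, comes from `hxL`, and the two facts
    -- combine in `hxI`.
    have hxuniv : ∀ a, coord L b x a ∈ mero L Set.univ (L \ I) := by
      intro a
      have h1 : coord L b x a = ∑ φ ∈ c η, (toMeroMat L (P φ)).mulVec (coord L b x) a := by
        conv_lhs => rw [← hqx, coord_matEnd, hQ]
        simp only [map_sum, Matrix.sum_mulVec, Finset.sum_apply]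
      rw [h1]
      refine sum_mem fun φ hφ => H.coord_log_mem i φ ?_ (fun k =>
        mero_mono L (Set.subset_univ _) (Finset.empty_subset _) (hvI k)) a
      have h2 := (Finset.mem_filter.1 hφ).2
      rw [← hgη, polarMk_eq_polarMk_iff] at h2
      exact mero_mono L (Set.subset_univ _) subset_rfl h2
    have hxI : ∀ a, coord L b x a ∈ mero L (I : Set (Fin n)) (L \ I) := fun a =>
      mem_mero_of_mem_mero_univ (hxuniv a) (hxL a)
    -- As x is fixed by the projector, it is the combination of the projected basis vectors, which
    -- lie in the summand, with its own coordinates as coefficients.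
    rw [← hqx, eq_sum_coord b x, map_sum]
    refine sum_mem fun k _ => ?_
    rw [map_smul]
    exact Submodule.smul_mem _ (⟨_, hxI k⟩ : mero L (I : Set (Fin n)) (L \ I))
      (Submodule.subset_span ⟨_, Submodule.subset_span ⟨b k, rfl⟩, rfl⟩)

end ToDecomposition

end GoodLattice

namespace GoodLattice

open MeroConnection

/-! ### Goodness of the convergent exponential factors and conclusion. -/

section Main

variable {n : ℕ} {L : Finset (Fin n)}

/-- The classes of the exponential factors of a formal splitting form a good set. -/
lemma FormalSplitting.isGood_range {ι κ : Type*} [Fintype ι] [DecidableEq ι] [Fintype κ]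
    {A : Fin n → Matrix ι ι (FormalMero L)} {f : κ → FormalMero L}
    {P : κ → Matrix ι ι (MvPowerSeries (Fin n) ℂ)} (H : FormalSplitting L A f P)
    {S : Set (Fin n)} (hf : ∀ φ, f φ ∈ mero L S L) (J : Finset (Fin n)) :
    IsGood (Set.range fun φ => polarMk L S J ⟨f φ, hf φ⟩) := by
  refine ⟨Set.finite_range _, ?_⟩
  rintro _ ⟨φ, rfl⟩ _ ⟨ψ, rfl⟩ hne
  have hφψ : φ ≠ ψ := fun h => hne (by rw [h])
  obtain ⟨m, -, hm, u, hu, h⟩ := H.good φ ψ hφψ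
  -- The unit obtained formally is t^m (f_φ - f_ψ), so it inherits the convergence of the factors.
  have huS : u ∈ germs S := mem_germs_of_toMero_mem_mero (L := L) (J := L) (by
    rw [← h]
    exact mul_mem (toMero_mem_mero _ (mono_mem_germs S m)) (sub_mem (hf φ) (hf ψ)))
  refine ⟨m, hm, ?_, u, huS, hu, ⟨f φ, hf φ⟩ - ⟨f ψ, hf ψ⟩, map_sub _ _ _, h⟩
  by_contra! hall
  apply hne
  rw [polarMk_eq_polarMk_iff]
  refine mem_mero_iff.2 ⟨m, fun i hi => ?_, u, huS, h⟩
  by_contra hiJ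
  exact Finsupp.mem_support_iff.1 hi (hall i (Finset.mem_sdiff.2 ⟨hm hi, hiJ⟩))

end Main

end GoodLattice

theorem mainTheorem7 {n : ℕ} (L : Finset (Fin n)) {E : Type*} [AddCommGroup E]
    [Module (Conv n) E] [Module.Free (Conv n) E] [Module.Finite (Conv n) E]
    (C : MeroConnection L E) (hflat : C.IsFlat)
    (Φhat : Set (Polar L Set.univ ∅)) (hgood : IsGood Φhat)
    (hdec : C.HasDecomposition Set.univ ∅ Φhat) :
    ∃ Φ : Set (Polar L ∅ ∅),
      polarMap L (Set.empty_subset Set.univ) (Finset.Subset.refl ∅) '' Φ = Φhat ∧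
      IsGood Φ ∧
      ∀ I ⊆ L, ∃ ΦI : Set (Polar L ∅ (L \ I)),
        ΦI = polarMap L (Set.Subset.refl ∅) (Finset.empty_subset (L \ I)) '' Φ ∧
        IsGood ΦI ∧
        C.HasDecomposition (I : Set (Fin n)) (L \ I)
          (polarMap L (Set.empty_subset (I : Set (Fin n))) (Finset.Subset.refl (L \ I)) '' ΦI) := by
  classical
  set b := Module.Free.chooseBasis (Conv n) E
  have : Fintype Φhat := hgood.1.fintype
  obtain ⟨P, hP⟩ := exists_formalSplitting C b hgood hdec
  have hlift : ∀ φ : Φhat, ∃ f : (mero L Set.univ L).toSubmodule,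
      polarMk L Set.univ ∅ f = φ := fun φ => Submodule.mkQ_surjective _ _
  choose f hf using hlift
  have hconv : ∀ φ, ∃ g ∈ mero L ∅ L, (f φ : FormalMero L) - g ∈ mero L Set.univ ∅ := fun φ =>
    exists_convergent_of_pd fun i hi => (hP f hf).exists_pd_sub_mem hi φ
  choose g hg hfg using hconv
  -- The convergent g and the original lifts f differ by power series, hence represent the same
  -- classes, and the same projectors give a splitting with convergent factors.
  have H : FormalSplitting L (connMatrix C b) g P :=
    hP (fun φ => ⟨g φ, mem_mero_univ _⟩) fun φ => by
      rw [← hf φ, eq_comm, polarMk_eq_polarMk_iff]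
      exact hfg φ
  have hlift : ∀ φ, polarMk L Set.univ ∅ ⟨g φ, mem_mero_univ _⟩ = φ := fun φ => by
    rw [← hf φ, eq_comm, polarMk_eq_polarMk_iff]
    exact hfg φ
  refine ⟨Set.range fun φ => polarMk L ∅ ∅ ⟨g φ, hg φ⟩, ?_, H.isGood_range hg ∅, fun I hI =>
    ⟨Set.range fun φ => polarMk L ∅ (L \ I) ⟨g φ, hg φ⟩, ?_, H.isGood_range hg _, ?_⟩⟩
  · rw [← Set.range_comp]
    ext φ
    constructor
    · rintro ⟨ψ, rfl⟩
      have h : polarMap L (Set.empty_subset Set.univ) (Finset.Subset.refl ∅)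
          (polarMk L ∅ ∅ ⟨g ψ, hg ψ⟩) = ψ := hlift ψ
      rw [Function.comp_apply, h]
      exact ψ.2
    · exact fun hφ => ⟨⟨φ, hφ⟩, hlift ⟨φ, hφ⟩⟩
  · rw [← Set.range_comp]
    rfl
  · rw [← Set.range_comp]
    exact H.hasDecomposition hI fun φ => mero_mono L (Set.empty_subset _) subset_rfl (hg φ)
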